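/- Let $a\in\mathbb C^{\times}$ be either not a root of unity, or a primitive $4r$-th root of unity with $r\ge 3$, and put $q=a^2$, $q^{1/2}=a$. **The Temperley–Lieb category $\mathcal S(a)$.** Its objects are the natural numbers. A morphism $k\to\ell$ is an element of $E_{k,\ell}$, the complex vector space spanned by the planar diagrams with $k$ inputs and $\ell$ outputs (arcs and circles immersed in a strip, with over/under information at each crossing), up to planar isotopy, modulo removal of a circle with the factor $-(a^2+a^{-2})$ and Kauffman's relation (crossing) $=a\,(\text{vertical smoothing})+a^{-1}(\text{horizontal smoothing})$. Composition is stacking, $\otimes$ is addition of objects and juxtaposition of diagrams, and the unit is $0$. The braiding $c_{n,m}$ is the diagram in which $n$ parallel strands cross $m$ parallel strands, with $c_{1,1}=a\,\mathrm{id}+a^{-1}\,\cup\circ\cap$; $b_n:0\to n\otimes n$ and $d_n:n\otimes n\to 0$ are $n$ nested cups and $n$ nested caps; the twist $\theta_n$ is $(-1)^n$ times a curl of $n$ parallel strands, $\theta_n=(-1)^n(\mathrm{id}_n\otimes d_n)(c_{n,n}\otimes\mathrm{id}_n)(\mathrm{id}_n\otimes b_n)$. **Modules.** $U_q=U_q(sl_2)$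 is the algebra generated by $K^{\pm1},X,Y$ with $KXK^{-1}=q^2X$, $KYK^{-1}=q^{-2}Y$, $XY-YX=\frac{K-K^{-1}}{q-q^{-1}}$, with $\Delta(X)=1\otimes X+X\otimes K$, $\Delta(Y)=K^{-1}\otimes Y+Y\otimes 1$, $\Delta(K)=K\otimes K$, counit $\varepsilon(X)=\varepsilon(Y)=0$, $\varepsilon(K)=1$, and antipode $S(X)=-XK^{-1}$, $S(Y)=-KY$, $S(K)=K^{-1}$. $U_q$-Mod is the monoidal category of its finite-dimensional modules; the dual module $M^*$ has the usual $b_M:\mathbb C\to M\otimes M^*$, $1\mapsto\sum_i e_i\otimes e^i$, and $d_M:M^*\otimes M\to\mathbb C$ (evaluation). $V$ is the module with basis $v_0,v_1$ and $Kv_0=qv_0$, $Xv_0=0$, $Yv_0=v_1$, $Kv_1=q^{-1}v_1$, $Xv_1=v_0$, $Yv_1=0$; $\alpha:V\to V^*$ is the isomorphism with $\alpha(v_0)=v^1$, $\alpha(v_1)=-q^{-1}v^0$; and $b=(\mathrm{id}_V\otimes\alpha^{-1})b_V$, $d=d_V(\alpha\otimes\mathrm{id}_V)$. The braiding of $V^{\otimes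 n}$ with $V^{\otimes m}$ is the flip composed with the action of the $R$-matrix $R=q^{H\otimes H/2}\sum_{k\ge0}\frac{q^{k(k-1)/2}(q-q^{-1})^k}{[k]!}X^k\otimes Y^k$, where $H$ is the weight ($v_0$ has weight $1$, $v_1$ has weight $-1$, weights add), and the sum runs over the $k$ with $[k]!\ne0$; the twist of $V^{\otimes n}$ is the action of the inverse ribbon element $\sum tKs$, where $R=\sum s\otimes t$. On $V$ these give $c_{V,V}(v_0\otimes v_0)=q^{1/2}v_0\otimes v_0$, $c_{V,V}(v_1\otimes v_1)=q^{1/2}v_1\otimes v_1$, $c_{V,V}(v_0\otimes v_1)=q^{-1/2}v_1\otimes v_0$, $c_{V,V}(v_1\otimes v_0)=q^{-1/2}v_0\otimes v_1+q^{-1/2}(q-q^{-1})v_1\otimes v_0$, and $\theta_V=q^{3/2}\,\mathrm{id}_V$. **Proposition.** There is a functor $\mathcal F:\mathcal S(a)\to U_q\text{-Mod}$ that preserves the tensor structures (it is $\mathbb C$-linear on morphisms, strong monoidal, and bijective on the endomorphisms of the unit objects), with $\mathcal F(1)\cong V$, such that $\mathcal F(\cup)=b$ and $\mathcal F(\cap)=d$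 under this identification. It is unique: between any two such functors there is exactly one monoidal natural isomorphism that is compatible with the identifications of $\mathcal F(1)$ with $V$. Moreover, under the induced identifications $\mathcal F(n)\cong V^{\otimes n}$, every such functor satisfies, for all $n,m\ge0$, $$\mathcal F(c_{n,m})=c_{\mathcal F(n),\mathcal F(m)},\qquad \mathcal F(\theta_n)=\theta_{\mathcal F(n)},$$ $$\mathcal F(b_n)=\bigl(\mathrm{id}_{\mathcal F(n)}\otimes(\alpha^{-1})^{\otimes n}\bigr)b_{\mathcal F(n)},\qquad \mathcal F(d_n)=d_{\mathcal F(n)}\bigl(\alpha^{\otimes n}\otimes\mathrm{id}_{\mathcal F(n)}\bigr),$$ where $(V^{*})^{\otimes n}$ is identified with $(V^{\otimes n})^*$ by $(M\otimes N)^*=N^*\otimes M^*$. -/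

import Mathlib

open CategoryTheory MonoidalCategory

noncomputable section

/-! # The Temperley-Lieb category `S(a)` of planar diagrams -/

namespace TemperleyLieb

/-- The elementary pieces of a diagram in generic position: a cup, a cap, and the two
crossings (which differ by exchanging the over- and the understrand). -/
inductive Piece : Type
  | cup : Piece
  | cap : Piece
  | pos : Piece
  | neg : Piece

/-- Number of inputs (at the bottom). -/
def Piece.dom : Piece → ℕ
  | .cup => 0
  | .cap => 2
  | .pos => 2
  | .neg => 2

/-- Number of outputs (at the top). -/
def Piece.cod : Piece → ℕ
  | .cup => 2
  | .cap => 0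
  | .pos => 2
  | .neg => 2

/-- A horizontal slice of a diagram: one elementary piece with `left` vertical strands on its
left and `right` vertical strands on its right. -/
@[ext] structure Slice : Type where
  left : ℕ
  piece : Piece
  right : ℕ

def Slice.dom (s : Slice) : ℕ := s.left + s.piece.dom + s.right

def Slice.cod (s : Slice) : ℕ := s.left + s.piece.cod + s.right

/-- Add `n` vertical strands on the left and `m` on the right. -/
def Slice.shift (n m : ℕ) (s : Slice) : Slice := ⟨n + s.left, s.piece, s.right + m⟩

theorem Slice.shift_shift (n m n' m' : ℕ) (s : Slice) :
    Slice.shift n' m' (Slice.shift n m s) = Slice.shift (n' + n) (m + m') s := by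
  simp [Slice.shift, Nat.add_assoc]

/-- The slices of `w`, stacked from bottom to top, form a diagram with `k` inputs and
`l` outputs. -/
def IsDiagram (k : ℕ) : List Slice → ℕ → Prop
  | [], l => k = l
  | s :: w, l => s.dom = k ∧ IsDiagram s.cod w l

/-- Diagrams of type `(k, l)` in generic position with respect to the height. -/
def Diagram (k l : ℕ) : Type := {w : List Slice // IsDiagram k w l}

theorem IsDiagram.append {k l m : ℕ} {v w : List Slice} (hv : IsDiagram k v l)
    (hw : IsDiagram l w m) : IsDiagram k (v ++ w) m := by
  induction v generalizing k with
  | nil => simp only [IsDiagram] at hv; subst hv; exact hw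
  | cons s v ih => exact ⟨hv.1, ih hv.2⟩

theorem IsDiagram.shift (n m : ℕ) {k l : ℕ} {w : List Slice} (h : IsDiagram k w l) :
    IsDiagram (n + k + m) (w.map (Slice.shift n m)) (n + l + m) := by
  induction w generalizing k with
  | nil => simp only [IsDiagram] at h; subst h; rfl
  | cons s w ih =>
    refine ⟨?_, ?_⟩
    · rw [← h.1]; simp only [Slice.dom, Slice.shift]; omega
    · have := ih h.2
      have e : (Slice.shift n m s).cod = n + s.cod + m := by
        simp only [Slice.cod, Slice.shift]; omega
      rw [e]; exact this

theorem IsDiagram.congr {k l k' l' : ℕ} {w : List Slice} (h : IsDiagram k w l) (hk : k = k')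
    (hl : l = l') : IsDiagram k' w l' := by
  subst hk; subst hl; exact h

namespace Diagram

@[ext] theorem ext {k l : ℕ} {D D' : Diagram k l} (h : D.1 = D'.1) : D = D' := Subtype.ext h

/-- The diagram of vertical strands. -/
def vert {k l : ℕ} (h : k = l) : Diagram k l := ⟨[], h⟩

/-- `D` below, `D'` above. -/
def comp {k l m : ℕ} (D : Diagram k l) (D' : Diagram l m) : Diagram k m :=
  ⟨D.1 ++ D'.1, D.2.append D'.2⟩

/-- `n` vertical strands to the left of `D` and `m` to the right. -/
def whisker (n m : ℕ) {k l : ℕ} (D : Diagram k l) : Diagram (n + k + m) (n + l + m) :=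
  ⟨D.1.map (Slice.shift n m), D.2.shift n m⟩

def whiskerLeft (n : ℕ) {k l : ℕ} (D : Diagram k l) : Diagram (n + k) (n + l) :=
  ⟨D.1.map (Slice.shift n 0), D.2.shift n 0⟩

def whiskerRight {k l : ℕ} (D : Diagram k l) (m : ℕ) : Diagram (k + m) (l + m) :=
  ⟨D.1.map (Slice.shift 0 m), by simpa using D.2.shift 0 m⟩

/-- `D` inserted in a larger diagram, which is `u` below `D` and `v` above `D`. -/
def plug {k l p p' : ℕ} (n m : ℕ) (u : Diagram k (n + p + m)) (v : Diagram (n + p' + m) l)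
    (D : Diagram p p') : Diagram k l :=
  u.comp ((D.whisker n m).comp v)

end Diagram

/-- The elementary planar isotopies between diagrams in generic position: exchange of the heights
of two pieces that are side by side, straightening of a strand, and rotation of a crossing
past a cap or a cup (a quarter turn exchanges the two kinds of crossings). -/
inductive Isotopy : List Slice → List Slice → Prop
  | exchange (P Q : Piece) (g : ℕ) :
      Isotopy [⟨0, P, g + Q.dom⟩, ⟨P.cod + g, Q, 0⟩] [⟨P.dom + g, Q, 0⟩, ⟨0, P, g + Q.cod⟩]
  | zigzag_left : Isotopy [⟨1, .cup, 0⟩, ⟨0, .cap, 1⟩] []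
  | zigzag_right : Isotopy [⟨0, .cup, 1⟩, ⟨1, .cap, 0⟩] []
  | cap_pos : Isotopy [⟨1, .pos, 0⟩, ⟨0, .cap, 1⟩] [⟨0, .neg, 1⟩, ⟨1, .cap, 0⟩]
  | cap_neg : Isotopy [⟨1, .neg, 0⟩, ⟨0, .cap, 1⟩] [⟨0, .pos, 1⟩, ⟨1, .cap, 0⟩]
  | cup_pos : Isotopy [⟨0, .cup, 1⟩, ⟨1, .pos, 0⟩] [⟨1, .cup, 0⟩, ⟨0, .neg, 1⟩]
  | cup_neg : Isotopy [⟨0, .cup, 1⟩, ⟨1, .neg, 0⟩] [⟨1, .cup, 0⟩, ⟨0, .pos, 1⟩]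

/-- Formal linear combinations of diagrams. -/
abbrev Chain (k l : ℕ) : Type := Diagram k l →₀ ℂ

/-- The local relations: planar isotopy, Kauffman's relation for a crossing (in its two positions
up to a half turn), and removal of a circle. -/
inductive Relator (a : ℂ) : (p p' : ℕ) → Chain p p' → Prop
  | isotopy {p p' : ℕ} (D D' : Diagram p p') (h : Isotopy D.1 D'.1) :
      Relator a p p' (Finsupp.single D 1 - Finsupp.single D' 1)
  | kauffman_pos :
      Relator a 2 2 (Finsupp.single ⟨[⟨0, .pos, 0⟩], rfl, rfl⟩ 1
        - (Finsupp.single (Diagram.vert rfl) a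
          + Finsupp.single ⟨[⟨0, .cap, 0⟩, ⟨0, .cup, 0⟩], rfl, rfl, rfl⟩ a⁻¹))
  | kauffman_neg :
      Relator a 2 2 (Finsupp.single ⟨[⟨0, .neg, 0⟩], rfl, rfl⟩ 1
        - (Finsupp.single (Diagram.vert rfl) a⁻¹
          + Finsupp.single ⟨[⟨0, .cap, 0⟩, ⟨0, .cup, 0⟩], rfl, rfl, rfl⟩ a))
  | circle :
      Relator a 0 0 (Finsupp.single ⟨[⟨0, .cup, 0⟩, ⟨0, .cap, 0⟩], rfl, rfl, rfl⟩ 1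
        - Finsupp.single (Diagram.vert rfl) (-(a ^ 2 + (a ^ 2)⁻¹)))

/-- The local relations, inserted anywhere in a diagram. -/
def relationSet (a : ℂ) (k l : ℕ) : Set (Chain k l) :=
  {x | ∃ (p p' n m : ℕ) (u : Diagram k (n + p + m)) (v : Diagram (n + p' + m) l)
    (r : Chain p p'), Relator a p p' r ∧ x = Finsupp.mapDomain (Diagram.plug n m u v) r}

def relations (a : ℂ) (k l : ℕ) : Submodule ℂ (Chain k l) :=
  Submodule.span ℂ (relationSet a k l)

/-- The space `E_{k,l}` of diagrams of type `(k, l)` modulo isotopy and the skein relations. -/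
def Skein (a : ℂ) (k l : ℕ) : Type := Chain k l ⧸ relations a k l

namespace Skein

variable {a : ℂ}

instance (k l : ℕ) : AddCommGroup (Skein a k l) :=
  inferInstanceAs (AddCommGroup (Chain k l ⧸ relations a k l))

instance (k l : ℕ) : Module ℂ (Skein a k l) :=
  inferInstanceAs (Module ℂ (Chain k l ⧸ relations a k l))

/-- The quotient map. -/
def mkL (a : ℂ) (k l : ℕ) : Chain k l →ₗ[ℂ] Skein a k l := (relations a k l).mkQ

/-- The class of a diagram. -/
def mk (a : ℂ) {k l : ℕ} (D : Diagram k l) : Skein a k l := mkL a k l (Finsupp.single D 1)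

theorem mkL_eq_zero {k l : ℕ} {x : Chain k l} (h : x ∈ relations a k l) : mkL a k l x = 0 :=
  (Submodule.Quotient.mk_eq_zero _).2 h

theorem hom_ext {k l : ℕ} {M : Type*} [AddCommGroup M] [Module ℂ M] {f g : Skein a k l →ₗ[ℂ] M}
    (h : ∀ D, f (mk a D) = g (mk a D)) : f = g := by
  apply Submodule.linearMap_qext
  apply Finsupp.lhom_ext'
  intro D
  apply LinearMap.ext_ring
  exact h D

theorem induction {k l : ℕ} {P : Skein a k l → Prop} (x : Skein a k l) (hzero : P 0)
    (hadd : ∀ x y, P x → P y → P (x + y)) (hmk : ∀ (c : ℂ) D, P (c • mk a D)) : P x := by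
  obtain ⟨x, rfl⟩ := Submodule.mkQ_surjective _ x
  induction x using Finsupp.induction_linear with
  | zero => rw [map_zero]; exact hzero
  | add f g hf hg => rw [map_add]; exact hadd _ _ hf hg
  | single D c =>
    have := hmk c D
    rwa [mk, ← map_smul, Finsupp.smul_single, smul_eq_mul, mul_one] at this

/-- An operation on diagrams that is compatible with insertion. -/
def Local {k l k' l' : ℕ} (Φ : Diagram k l → Diagram k' l') : Prop :=
  ∀ (p p' n m : ℕ) (u : Diagram k (n + p + m)) (v : Diagram (n + p' + m) l),
    ∃ (n' m' : ℕ) (u' : Diagram k' (n' + p + m')) (v' : Diagram (n' + p' + m') l'),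
      ∀ D, Φ (Diagram.plug n m u v D) = Diagram.plug n' m' u' v' D

theorem Local.relations_le {k l k' l' : ℕ} {Φ : Diagram k l → Diagram k' l'} (h : Local Φ) :
    relations a k l ≤ (relations a k' l').comap (Finsupp.lmapDomain ℂ ℂ Φ) := by
  refine Submodule.span_le.2 ?_
  rintro x ⟨p, p', n, m, u, v, r, hr, rfl⟩
  obtain ⟨n', m', u', v', e⟩ := h p p' n m u v
  refine Submodule.subset_span ⟨p, p', n', m', u', v', r, hr, ?_⟩
  rw [Finsupp.lmapDomain_apply, ← Finsupp.mapDomain_comp]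
  congr 1
  exact funext e

/-- The linear map that extends a local operation on diagrams. -/
def lift {k l k' l' : ℕ} (Φ : Diagram k l → Diagram k' l') (h : Local Φ) :
    Skein a k l →ₗ[ℂ] Skein a k' l' :=
  Submodule.mapQ _ _ (Finsupp.lmapDomain ℂ ℂ Φ) h.relations_le

theorem lift_mk {k l k' l' : ℕ} (Φ : Diagram k l → Diagram k' l') (h : Local Φ)
    (D : Diagram k l) : lift Φ h (mk a D) = mk a (Φ D) := by
  change mkL a k' l' (Finsupp.mapDomain Φ (Finsupp.single D 1)) = _
  rw [Finsupp.mapDomain_single]; rfl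

theorem local_comp_left {k l m : ℕ} (D : Diagram k l) :
    Local (fun D' : Diagram l m => D.comp D') := by
  intro p p' i j u v
  exact ⟨i, j, D.comp u, v, fun D' => Diagram.ext (by simp [Diagram.plug, Diagram.comp])⟩

theorem local_comp_right {k l m : ℕ} (D' : Diagram l m) :
    Local (fun D : Diagram k l => D.comp D') := by
  intro p p' i j u v
  exact ⟨i, j, u, v.comp D', fun D => Diagram.ext (by simp [Diagram.plug, Diagram.comp])⟩

theorem shift_shift (n m n' m' : ℕ) (w : List Slice) :
    (w.map (Slice.shift n m)).map (Slice.shift n' m') = w.map (Slice.shift (n' + n) (m + m')) := by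
  rw [List.map_map]
  congr 1
  funext s
  simp [Slice.shift, Nat.add_assoc]

theorem local_whiskerLeft (n : ℕ) {k l : ℕ} :
    Local (fun D : Diagram k l => D.whiskerLeft n) := by
  intro p p' i j u v
  refine ⟨n + i, j, ⟨(u.whiskerLeft n).1, ?_⟩, ⟨(v.whiskerLeft n).1, ?_⟩, fun D => Diagram.ext ?_⟩
  · exact (u.whiskerLeft n).2.congr rfl (by omega)
  · exact (v.whiskerLeft n).2.congr (by omega) rfl
  · simp only [Diagram.plug, Diagram.comp, Diagram.whiskerLeft, Diagram.whisker, List.map_append,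
      shift_shift, Nat.add_zero]

theorem local_whiskerRight (n : ℕ) {k l : ℕ} :
    Local (fun D : Diagram k l => D.whiskerRight n) := by
  intro p p' i j u v
  refine ⟨i, j + n, ⟨(u.whiskerRight n).1, ?_⟩, ⟨(v.whiskerRight n).1, ?_⟩,
    fun D => Diagram.ext ?_⟩
  · exact (u.whiskerRight n).2.congr rfl (by omega)
  · exact (v.whiskerRight n).2.congr (by omega) rfl
  · simp only [Diagram.plug, Diagram.comp, Diagram.whiskerRight, Diagram.whisker, List.map_append,
      shift_shift, Nat.zero_add]

/-- Composition: the first diagram below the second one, extended bilinearly. -/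
def comp {k l m : ℕ} : Skein a k l →ₗ[ℂ] Skein a l m →ₗ[ℂ] Skein a k m :=
  Submodule.liftQ (relations a k l)
    (Finsupp.linearCombination ℂ
      (fun D : Diagram k l => lift (fun D' => D.comp D') (local_comp_left D)))
    (by
      intro x hx
      rw [LinearMap.mem_ker]
      apply hom_ext
      intro D'
      have h := (local_comp_right (k := k) D').relations_le (a := a) hx
      rw [LinearMap.zero_apply, ← mkL_eq_zero h]
      clear h hx
      induction x using Finsupp.induction_linear with
      | zero => simp
      | add f g hf hg => rw [map_add, LinearMap.add_apply, hf, hg, map_add, map_add]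
      | single D c =>
        rw [Finsupp.linearCombination_single, LinearMap.smul_apply,
          lift_mk, Finsupp.lmapDomain_apply, Finsupp.mapDomain_single, mk, ← map_smul,
          Finsupp.smul_single, smul_eq_mul, mul_one])

theorem comp_mk {k l m : ℕ} (D : Diagram k l) (D' : Diagram l m) :
    comp (mk a D) (mk a D') = mk a (D.comp D') := by
  change Finsupp.linearCombination ℂ (fun D : Diagram k l =>
    lift (a := a) (fun D' : Diagram l m => D.comp D') (local_comp_left D)) (Finsupp.single D 1) _ = _
  rw [Finsupp.linearCombination_single, one_smul, lift_mk]

/-- `n` vertical strands added on the left. -/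
def whiskerLeft (n : ℕ) {k l : ℕ} : Skein a k l →ₗ[ℂ] Skein a (n + k) (n + l) :=
  lift (fun D => D.whiskerLeft n) (local_whiskerLeft n)

/-- `n` vertical strands added on the right. -/
def whiskerRight {k l : ℕ} (n : ℕ) : Skein a k l →ₗ[ℂ] Skein a (k + n) (l + n) :=
  lift (fun D => D.whiskerRight n) (local_whiskerRight n)

theorem whiskerLeft_mk (n : ℕ) {k l : ℕ} (D : Diagram k l) :
    whiskerLeft n (mk a D) = mk a (D.whiskerLeft n) := lift_mk _ _ _

theorem whiskerRight_mk (n : ℕ) {k l : ℕ} (D : Diagram k l) :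
    whiskerRight n (mk a D) = mk a (D.whiskerRight n) := lift_mk _ _ _

theorem mk_congr_isotopy {k l p p' n m : ℕ} (u : Diagram k (n + p + m))
    (v : Diagram (n + p' + m) l) (D D' : Diagram p p') (h : Isotopy D.1 D'.1) :
    mk a (Diagram.plug n m u v D) = mk a (Diagram.plug n m u v D') := by
  have : mkL a k l (Finsupp.mapDomain (Diagram.plug n m u v)
      (Finsupp.single D 1 - Finsupp.single D' 1)) = 0 :=
    mkL_eq_zero (Submodule.subset_span ⟨p, p', n, m, u, v, _, Relator.isotopy D D' h, rfl⟩)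
  rw [← Finsupp.lmapDomain_apply ℂ ℂ, map_sub, map_sub, sub_eq_zero, Finsupp.lmapDomain_apply, Finsupp.lmapDomain_apply,
    Finsupp.mapDomain_single, Finsupp.mapDomain_single] at this
  exact this

/-- Exchange of two slices that are side by side. -/
theorem exchange_slice (s t : Slice) (h : IsDiagram (s.dom + t.dom)
    [s.shift 0 t.dom, t.shift s.cod 0] (s.cod + t.cod))
    (h' : IsDiagram (s.dom + t.dom) [t.shift s.dom 0, s.shift 0 t.cod] (s.cod + t.cod)) :
    mk a (⟨_, h⟩ : Diagram _ _) = mk a ⟨_, h'⟩ := by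
  obtain ⟨i, P, j⟩ := s
  obtain ⟨i', Q, j'⟩ := t
  have d1 : IsDiagram (P.dom + (j + i') + Q.dom)
      [⟨0, P, (j + i') + Q.dom⟩, ⟨P.cod + (j + i'), Q, 0⟩] (P.cod + (j + i') + Q.cod) := by
    refine ⟨?_, ?_, ?_⟩ <;> simp only [Slice.dom, Slice.cod, IsDiagram] <;> omega
  have d2 : IsDiagram (P.dom + (j + i') + Q.dom)
      [⟨P.dom + (j + i'), Q, 0⟩, ⟨0, P, (j + i') + Q.cod⟩] (P.cod + (j + i') + Q.cod) := by
    refine ⟨?_, ?_, ?_⟩ <;> simp only [Slice.dom, Slice.cod, IsDiagram] <;> omega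
  have key := mk_congr_isotopy (a := a) (n := i) (m := j')
    (Diagram.vert (k := Slice.dom ⟨i, P, j⟩ + Slice.dom ⟨i', Q, j'⟩)
      (by simp only [Slice.dom]; omega))
    (Diagram.vert (l := Slice.cod ⟨i, P, j⟩ + Slice.cod ⟨i', Q, j'⟩)
      (by simp only [Slice.cod]; omega))
    ⟨_, d1⟩ ⟨_, d2⟩ (.exchange P Q (j + i'))
  refine (congrArg (mk a) (Diagram.ext ?_)).trans (key.trans (congrArg (mk a) (Diagram.ext ?_))) <;>
    simp [Diagram.plug, Diagram.comp, Diagram.whisker, Diagram.vert, Slice.shift, Slice.dom,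
      Slice.cod] <;>
    omega

end Skein

/-- The objects of the Temperley-Lieb category are the natural numbers. -/
@[ext] structure Obj (a : ℂ) : Type where
  strands : ℕ

variable {a : ℂ}

/-- The Temperley-Lieb category: the morphisms `k ⟶ l` are the elements of `E_{k,l}`. -/
instance : Category (Obj a) where
  Hom X Y := Skein a X.strands Y.strands
  id X := Skein.mk a (Diagram.vert rfl)
  comp f g := Skein.comp f g
  id_comp {X Y} f := by
    induction f using Skein.induction with
    | hzero => exact map_zero _
    | hadd x y hx hy => rw [map_add, hx, hy]
    | hmk c D => rw [map_smul, Skein.comp_mk]; rfl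
  comp_id {X Y} f := by
    induction f using Skein.induction with
    | hzero => exact LinearMap.map_zero₂ _ _
    | hadd x y hx hy => rw [LinearMap.map_add₂, hx, hy]
    | hmk c D =>
      rw [LinearMap.map_smul₂, Skein.comp_mk]
      congr 2
      exact Diagram.ext (List.append_nil _)
  assoc {W X Y Z} f g h := by
    induction f using Skein.induction with
    | hzero => simp
    | hadd x y hx hy => simp only [map_add, LinearMap.add_apply, hx, hy]
    | hmk c D =>
      induction g using Skein.induction with
      | hzero => simp
      | hadd x y hx hy => simp only [map_add, LinearMap.add_apply, hx, hy]
      | hmk c D' =>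
        induction h using Skein.induction with
        | hzero => simp
        | hadd x y hx hy => simp only [map_add, hx, hy]
        | hmk c D'' =>
          simp only [map_smul, LinearMap.smul_apply, Skein.comp_mk]
          congr 4
          exact Diagram.ext (List.append_assoc _ _ _)

instance (X Y : Obj a) : AddCommGroup (X ⟶ Y) :=
  inferInstanceAs (AddCommGroup (Skein a X.strands Y.strands))

instance (X Y : Obj a) : Module ℂ (X ⟶ Y) :=
  inferInstanceAs (Module ℂ (Skein a X.strands Y.strands))

theorem add_comp' {X Y Z : Obj a} (f f' : X ⟶ Y) (g : Y ⟶ Z) :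
    (f + f') ≫ g = f ≫ g + f' ≫ g := by
  change Skein.comp (a := a) (f + f') g = Skein.comp f g + Skein.comp f' g
  rw [← LinearMap.add_apply, ← map_add]

theorem comp_add' {X Y Z : Obj a} (f : X ⟶ Y) (g g' : Y ⟶ Z) :
    f ≫ (g + g') = f ≫ g + f ≫ g' := by
  change Skein.comp (a := a) f (g + g') = Skein.comp f g + Skein.comp f g'
  rw [← map_add]

theorem smul_comp' {X Y Z : Obj a} (c : ℂ) (f : X ⟶ Y) (g : Y ⟶ Z) :
    (c • f) ≫ g = c • f ≫ g := by
  change Skein.comp (a := a) (c • f) g = c • Skein.comp f g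
  rw [← LinearMap.smul_apply, ← map_smul]

theorem comp_smul' {X Y Z : Obj a} (f : X ⟶ Y) (c : ℂ) (g : Y ⟶ Z) :
    f ≫ (c • g) = c • f ≫ g := by
  change Skein.comp (a := a) f (c • g) = c • Skein.comp f g
  rw [← map_smul]

instance : Preadditive (Obj a) where
  homGroup _ _ := inferInstance
  add_comp _ _ _ f f' g := add_comp' f f' g
  comp_add _ _ _ f g g' := comp_add' f g g'

instance : Linear ℂ (Obj a) where
  smul_comp _ _ _ := smul_comp'
  comp_smul _ _ _ := comp_smul'

/-- A diagram as a morphism. -/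
def ofDiagram {X Y : Obj a} (D : Diagram X.strands Y.strands) : X ⟶ Y := Skein.mk a D

theorem ofDiagram_comp {X Y Z : Obj a} (D : Diagram X.strands Y.strands)
    (D' : Diagram Y.strands Z.strands) :
    ofDiagram D ≫ ofDiagram D' = ofDiagram (D.comp D') := Skein.comp_mk D D'

theorem ofDiagram_vert (X : Obj a) : ofDiagram (Diagram.vert rfl) = 𝟙 X := rfl

theorem isDiagram_singleton (s : Slice) : IsDiagram s.dom [s] s.cod := ⟨rfl, rfl⟩

/-- A single slice as a morphism. -/
def ofSlice (a : ℂ) (s : Slice) : (⟨s.dom⟩ : Obj a) ⟶ ⟨s.cod⟩ :=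
  ofDiagram (X := ⟨s.dom⟩) (Y := ⟨s.cod⟩) ⟨[s], isDiagram_singleton s⟩

theorem hom_induction {X Y : Obj a} {P : (X ⟶ Y) → Prop} (f : X ⟶ Y) (hzero : P 0)
    (hadd : ∀ x y, P x → P y → P (x + y)) (hmk : ∀ (c : ℂ) D, P (c • ofDiagram D)) : P f :=
  Skein.induction f hzero hadd hmk

/-- Objects with the same number of strands are identified by vertical strands. -/
def isoOfEq {X Y : Obj a} (h : X.strands = Y.strands) : X ≅ Y where
  hom := ofDiagram (Diagram.vert h)
  inv := ofDiagram (Diagram.vert h.symm)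
  hom_inv_id := Skein.comp_mk _ _
  inv_hom_id := Skein.comp_mk _ _

/-- The tensor product is addition on objects and juxtaposition on diagrams. -/
instance : MonoidalCategoryStruct (Obj a) where
  tensorObj X Y := ⟨X.strands + Y.strands⟩
  tensorUnit := ⟨0⟩
  whiskerLeft X _ _ f := Skein.whiskerLeft X.strands f
  whiskerRight f Y := Skein.whiskerRight Y.strands f
  associator _ _ _ := isoOfEq (Nat.add_assoc _ _ _)
  leftUnitor _ := isoOfEq (Nat.zero_add _)
  rightUnitor _ := isoOfEq (Nat.add_zero _)

theorem whiskerLeft_ofDiagram (X : Obj a) {Y Z : Obj a} (D : Diagram Y.strands Z.strands) :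
    X ◁ (ofDiagram D : Y ⟶ Z) = ofDiagram (D.whiskerLeft X.strands) := Skein.whiskerLeft_mk _ _

theorem whiskerRight_ofDiagram {Y Z : Obj a} (D : Diagram Y.strands Z.strands) (X : Obj a) :
    (ofDiagram D : Y ⟶ Z) ▷ X = ofDiagram (D.whiskerRight X.strands) := Skein.whiskerRight_mk _ _

theorem whiskerLeft_add' (X : Obj a) {Y Z : Obj a} (f g : Y ⟶ Z) : X ◁ (f + g) = X ◁ f + X ◁ g :=
  map_add _ _ _

theorem whiskerLeft_smul' (X : Obj a) {Y Z : Obj a} (c : ℂ) (f : Y ⟶ Z) :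
    X ◁ (c • f) = c • X ◁ f :=
  map_smul _ _ _

theorem whiskerLeft_zero' (X Y Z : Obj a) : X ◁ (0 : Y ⟶ Z) = 0 := map_zero _

theorem add_whiskerRight' (X : Obj a) {Y Z : Obj a} (f g : Y ⟶ Z) : (f + g) ▷ X = f ▷ X + g ▷ X :=
  map_add _ _ _

theorem smul_whiskerRight' (X : Obj a) {Y Z : Obj a} (c : ℂ) (f : Y ⟶ Z) :
    (c • f) ▷ X = c • f ▷ X :=
  map_smul _ _ _

theorem zero_whiskerRight' (X Y Z : Obj a) : (0 : Y ⟶ Z) ▷ X = 0 := map_zero _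

theorem shift_zero (w : List Slice) : w.map (Slice.shift 0 0) = w := by
  have : Slice.shift 0 0 = id := by funext s; simp [Slice.shift]
  rw [this, List.map_id]

theorem whiskerLeft_id' (X Y : Obj a) : X ◁ 𝟙 Y = 𝟙 (X ⊗ Y) := Skein.whiskerLeft_mk _ _

theorem id_whiskerRight' (X Y : Obj a) : 𝟙 X ▷ Y = 𝟙 (X ⊗ Y) := Skein.whiskerRight_mk _ _

theorem whiskerLeft_comp' (W : Obj a) {X Y Z : Obj a} (f : X ⟶ Y) (g : Y ⟶ Z) :
    W ◁ (f ≫ g) = W ◁ f ≫ W ◁ g := by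
  induction f using hom_induction with
  | hzero => simp only [whiskerLeft_zero', Limits.zero_comp]
  | hadd x y hx hy => simp only [Preadditive.add_comp, whiskerLeft_add', hx, hy]
  | hmk c D =>
    induction g using hom_induction with
    | hzero => simp only [whiskerLeft_zero', Limits.comp_zero]
    | hadd x y hx hy => simp only [Preadditive.comp_add, whiskerLeft_add', hx, hy]
    | hmk c D' =>
      simp only [Linear.smul_comp, Linear.comp_smul, whiskerLeft_smul', whiskerLeft_ofDiagram,
        ofDiagram_comp]
      congr 3
      exact Diagram.ext List.map_append

theorem comp_whiskerRight' {X Y Z : Obj a} (f : X ⟶ Y) (g : Y ⟶ Z) (W : Obj a) :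
    (f ≫ g) ▷ W = f ▷ W ≫ g ▷ W := by
  induction f using hom_induction with
  | hzero => simp only [zero_whiskerRight', Limits.zero_comp]
  | hadd x y hx hy => simp only [Preadditive.add_comp, add_whiskerRight', hx, hy]
  | hmk c D =>
    induction g using hom_induction with
    | hzero => simp only [zero_whiskerRight', Limits.comp_zero]
    | hadd x y hx hy => simp only [Preadditive.comp_add, add_whiskerRight', hx, hy]
    | hmk c D' =>
      simp only [Linear.smul_comp, Linear.comp_smul, smul_whiskerRight', whiskerRight_ofDiagram,
        ofDiagram_comp]
      congr 3
      exact Diagram.ext List.map_append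

/-- Every diagram is a composite of slices. -/
theorem diagram_induction {P : ∀ {X Y : Obj a}, (X ⟶ Y) → Prop} (hid : ∀ X : Obj a, P (𝟙 X))
    (hslice : ∀ s : Slice, P (ofSlice a s))
    (hcomp : ∀ {X Y Z : Obj a} (f : X ⟶ Y) (g : Y ⟶ Z), P f → P g → P (f ≫ g))
    {X Y : Obj a} (D : Diagram X.strands Y.strands) : P (ofDiagram D) := by
  obtain ⟨k⟩ := X
  obtain ⟨l⟩ := Y
  obtain ⟨w, hw⟩ := D
  induction w generalizing k with
  | nil =>
    simp only [IsDiagram] at hw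
    subst hw
    exact hid _
  | cons s w ih =>
    obtain ⟨h1, h2⟩ := hw
    simp only at h1
    subst h1
    have h := hcomp _ _ (hslice s) (ih s.cod h2)
    exact (ofDiagram_comp (X := ⟨s.dom⟩) (Y := ⟨s.cod⟩) (Z := ⟨l⟩) (a := a)
      ⟨[s], isDiagram_singleton s⟩ ⟨w, h2⟩) ▸ h

theorem whisker_exchange' {W X Y Z : Obj a} (f : W ⟶ X) (g : Y ⟶ Z) :
    f ▷ Y ≫ X ◁ g = W ◁ g ≫ f ▷ Z := by
  induction f using hom_induction with
  | hzero => simp only [zero_whiskerRight', Limits.zero_comp, Limits.comp_zero]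
  | hadd x y hx hy => simp only [Preadditive.add_comp, Preadditive.comp_add, add_whiskerRight',
      hx, hy]
  | hmk c D =>
    simp only [smul_whiskerRight', Linear.smul_comp, Linear.comp_smul]
    congr 1
    induction g using hom_induction with
    | hzero => simp only [whiskerLeft_zero', Limits.zero_comp, Limits.comp_zero]
    | hadd x y hx hy => simp only [Preadditive.add_comp, Preadditive.comp_add, whiskerLeft_add',
        hx, hy]
    | hmk c D' =>
      simp only [whiskerLeft_smul', Linear.smul_comp, Linear.comp_smul]
      congr 1
      refine diagram_induction (P := fun {W X} f =>
        f ▷ Y ≫ X ◁ (ofDiagram D' : Y ⟶ Z) = W ◁ (ofDiagram D' : Y ⟶ Z) ≫ f ▷ Z) ?_ ?_ ?_ D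
      · intro X
        rw [id_whiskerRight', id_whiskerRight', Category.id_comp, Category.comp_id]
      · intro s
        refine diagram_induction (P := fun {Y Z} g =>
          ofSlice a s ▷ Y ≫ _ ◁ g = _ ◁ g ≫ ofSlice a s ▷ Z)
            ?_ ?_ ?_ D'
        · intro X
          rw [whiskerLeft_id', whiskerLeft_id', Category.id_comp, Category.comp_id]
        · intro t
          have r (Y : Obj a) := whiskerRight_ofDiagram (Y := ⟨s.dom⟩) (Z := ⟨s.cod⟩)
            ⟨[s], isDiagram_singleton s⟩ Y
          have l (Y : Obj a) := whiskerLeft_ofDiagram Y (Y := ⟨t.dom⟩) (Z := ⟨t.cod⟩)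
            ⟨[t], isDiagram_singleton t⟩
          exact ((congrArg₂ (fun x y => x ≫ y) (r _) (l _)).trans (ofDiagram_comp _ _)).trans
            ((Skein.exchange_slice s t _ _).trans
            ((congrArg₂ (fun x y => x ≫ y) (l _) (r _)).trans (ofDiagram_comp _ _)).symm)
        · intro X Y Z f g hf hg
          rw [whiskerLeft_comp', ← Category.assoc, hf, Category.assoc, hg, whiskerLeft_comp',
            Category.assoc]
      · intro X Y Z f g hf hg
        rw [comp_whiskerRight', Category.assoc, hg, ← Category.assoc, hf, comp_whiskerRight',
          Category.assoc]

theorem tensorHom_def' {X Y X' Y' : Obj a} (f : X ⟶ Y) (g : X' ⟶ Y') :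
    f ⊗ₘ g = f ▷ X' ≫ Y ◁ g := rfl

theorem assoc_left {X Y : Obj a} (f : X ⟶ Y) (Z W : Obj a) :
    (f ▷ Z) ▷ W ≫ (α_ Y Z W).hom = (α_ X Z W).hom ≫ f ▷ (Z ⊗ W) := by
  induction f using hom_induction with
  | hzero => simp only [zero_whiskerRight', Limits.zero_comp, Limits.comp_zero]
  | hadd x y hx hy => simp only [Preadditive.add_comp, Preadditive.comp_add, add_whiskerRight',
      hx, hy]
  | hmk c D =>
    simp only [smul_whiskerRight', Linear.smul_comp, Linear.comp_smul, whiskerRight_ofDiagram,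
      MonoidalCategoryStruct.associator, isoOfEq, ofDiagram_comp]
    congr 2
    refine Diagram.ext ?_
    simp [Diagram.comp, Diagram.whiskerRight, Diagram.vert, Slice.shift_shift, MonoidalCategoryStruct.tensorObj]

theorem assoc_middle (X : Obj a) {Y Z : Obj a} (f : Y ⟶ Z) (W : Obj a) :
    (X ◁ f) ▷ W ≫ (α_ X Z W).hom = (α_ X Y W).hom ≫ X ◁ (f ▷ W) := by
  induction f using hom_induction with
  | hzero => simp only [zero_whiskerRight', whiskerLeft_zero', Limits.zero_comp, Limits.comp_zero]
  | hadd x y hx hy => simp only [Preadditive.add_comp, Preadditive.comp_add, add_whiskerRight',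
      whiskerLeft_add', hx, hy]
  | hmk c D =>
    simp only [smul_whiskerRight', whiskerLeft_smul', Linear.smul_comp, Linear.comp_smul,
      whiskerRight_ofDiagram, whiskerLeft_ofDiagram,
      MonoidalCategoryStruct.associator, isoOfEq, ofDiagram_comp]
    congr 2
    refine Diagram.ext ?_
    simp [Diagram.comp, Diagram.whiskerRight, Diagram.whiskerLeft, Diagram.vert, Slice.shift_shift]

theorem assoc_right (X Y : Obj a) {Z W : Obj a} (f : Z ⟶ W) :
    (X ⊗ Y) ◁ f ≫ (α_ X Y W).hom = (α_ X Y Z).hom ≫ X ◁ (Y ◁ f) := by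
  induction f using hom_induction with
  | hzero => simp only [whiskerLeft_zero', Limits.zero_comp, Limits.comp_zero]
  | hadd x y hx hy => simp only [Preadditive.add_comp, Preadditive.comp_add,
      whiskerLeft_add', hx, hy]
  | hmk c D =>
    simp only [whiskerLeft_smul', Linear.smul_comp, Linear.comp_smul, whiskerLeft_ofDiagram,
      MonoidalCategoryStruct.associator, isoOfEq, ofDiagram_comp]
    congr 2
    refine Diagram.ext ?_
    simp [Diagram.comp, Diagram.whiskerLeft, Diagram.vert, Slice.shift_shift, MonoidalCategoryStruct.tensorObj]

instance : MonoidalCategory (Obj a) where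
  tensorHom_def _ _ := rfl
  id_tensorHom_id X Y := by
    rw [tensorHom_def', whiskerLeft_id', id_whiskerRight', Category.comp_id]
  tensorHom_comp_tensorHom f₁ f₂ g₁ g₂ := by
    simp only [tensorHom_def', whiskerLeft_comp', comp_whiskerRight', Category.assoc]
    rw [← Category.assoc (_ ◁ f₂), ← whisker_exchange', Category.assoc]
  whiskerLeft_id := whiskerLeft_id'
  id_whiskerRight := id_whiskerRight'
  associator_naturality f₁ f₂ f₃ := by
    simp only [tensorHom_def', comp_whiskerRight', whiskerLeft_comp', Category.assoc]
    rw [assoc_right, ← Category.assoc (_ ▷ _) (α_ _ _ _).hom, assoc_middle,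
      Category.assoc, ← Category.assoc (_ ▷ _) (α_ _ _ _).hom, assoc_left, Category.assoc]
  leftUnitor_naturality {X Y} f := by
    induction f using hom_induction with
    | hzero => simp only [whiskerLeft_zero', Limits.zero_comp, Limits.comp_zero]
    | hadd x y hx hy => simp only [Preadditive.add_comp, Preadditive.comp_add,
        whiskerLeft_add', hx, hy]
    | hmk c D =>
      simp only [whiskerLeft_smul', Linear.smul_comp, Linear.comp_smul, whiskerLeft_ofDiagram,
        MonoidalCategoryStruct.leftUnitor, isoOfEq, ofDiagram_comp]
      congr 2
      refine Diagram.ext ?_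
      simp [Diagram.comp, Diagram.whiskerLeft, Diagram.vert, MonoidalCategoryStruct.tensorUnit,
        shift_zero]
  rightUnitor_naturality {X Y} f := by
    induction f using hom_induction with
    | hzero => simp only [zero_whiskerRight', Limits.zero_comp, Limits.comp_zero]
    | hadd x y hx hy => simp only [Preadditive.add_comp, Preadditive.comp_add,
        add_whiskerRight', hx, hy]
    | hmk c D =>
      simp only [smul_whiskerRight', Linear.smul_comp, Linear.comp_smul, whiskerRight_ofDiagram,
        MonoidalCategoryStruct.rightUnitor, isoOfEq, ofDiagram_comp]
      congr 2
      refine Diagram.ext ?_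
      simp [Diagram.comp, Diagram.whiskerRight, Diagram.vert, MonoidalCategoryStruct.tensorUnit,
        shift_zero]
  pentagon W X Y Z := by
    simp only [MonoidalCategoryStruct.associator, isoOfEq, whiskerRight_ofDiagram,
      whiskerLeft_ofDiagram, ofDiagram_comp]
    rfl
  triangle X Y := by
    simp only [MonoidalCategoryStruct.associator, MonoidalCategoryStruct.leftUnitor,
      MonoidalCategoryStruct.rightUnitor, isoOfEq, whiskerRight_ofDiagram,
      whiskerLeft_ofDiagram, ofDiagram_comp]
    rfl

/-- One strand passing from left to right across `m` strands. -/
def crossOne : (m : ℕ) → Diagram (1 + m) (m + 1)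
  | 0 => Diagram.vert rfl
  | m + 1 => ((crossOne m).whiskerRight 1).comp ⟨[⟨m, .pos, 0⟩], rfl, rfl⟩

/-- `n` parallel strands passing from left to right across `m` parallel strands. -/
def cross : (n m : ℕ) → Diagram (n + m) (m + n)
  | 0, m => Diagram.vert (Nat.zero_add m)
  | n + 1, m =>
    (Diagram.vert (l := n + (1 + m)) (by omega)).comp
      (((crossOne m).whiskerLeft n).comp ((cross n m).whiskerRight 1))

/-- `n` nested cups. -/
def cups : (n : ℕ) → Diagram 0 (n + n)
  | 0 => Diagram.vert rfl
  | n + 1 => (cups n).comp ⟨[⟨n, .cup, n⟩], rfl, by simp only [IsDiagram, Slice.cod, Piece.cod]; omega⟩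

/-- `n` nested caps. -/
def caps : (n : ℕ) → Diagram (n + n) 0
  | 0 => Diagram.vert rfl
  | n + 1 => Diagram.comp (l := n + n)
      ⟨[⟨n, .cap, n⟩], by simp only [Slice.dom, Piece.dom]; omega, rfl⟩ (caps n)

/-- The diagram of a curl made of `n` parallel strands. -/
def curl (n : ℕ) : Diagram n n :=
  (((((cups n).whiskerLeft n).comp
    (Diagram.vert (Nat.add_assoc n n n).symm)).comp
    ((cross n n).whiskerRight n)).comp
    (Diagram.vert (Nat.add_assoc n n n))).comp
    ((caps n).whiskerLeft n)

/-- The braiding `c_{n,m}`. -/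
def braiding (a : ℂ) (n m : ℕ) : (⟨n⟩ ⊗ ⟨m⟩ : Obj a) ⟶ ⟨m⟩ ⊗ ⟨n⟩ := ofDiagram (cross n m)

/-- The twist `θ_n`. -/
def twist (a : ℂ) (n : ℕ) : (⟨n⟩ : Obj a) ⟶ ⟨n⟩ := (-1 : ℂ) ^ n • ofDiagram (curl n)

/-- The duality morphism `b_n`, for the autoduality `n^* = n`. -/
def coev (a : ℂ) (n : ℕ) : 𝟙_ (Obj a) ⟶ (⟨n⟩ ⊗ ⟨n⟩ : Obj a) := ofDiagram (cups n)

/-- The duality morphism `d_n`, for the autoduality `n^* = n`. -/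
def ev (a : ℂ) (n : ℕ) : (⟨n⟩ ⊗ ⟨n⟩ : Obj a) ⟶ 𝟙_ (Obj a) := ofDiagram (caps n)

/-- The cup. -/
def cup (a : ℂ) : 𝟙_ (Obj a) ⟶ (⟨1⟩ ⊗ ⟨1⟩ : Obj a) :=
  ofDiagram (X := ⟨0⟩) (Y := ⟨1 + 1⟩) ⟨[⟨0, .cup, 0⟩], rfl, rfl⟩

/-- The cap. -/
def cap (a : ℂ) : (⟨1⟩ ⊗ ⟨1⟩ : Obj a) ⟶ 𝟙_ (Obj a) :=
  ofDiagram (X := ⟨1 + 1⟩) (Y := ⟨0⟩) ⟨[⟨0, .cap, 0⟩], rfl, rfl⟩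

end TemperleyLieb

/-! # The quantum enveloping algebra of `sl_2` and its finite-dimensional modules -/

namespace QuantumSL2

open scoped TensorProduct

inductive Gen : Type
  | K : Gen
  | Kinv : Gen
  | X : Gen
  | Y : Gen

/-- The generators in the free algebra. -/
def gen (x : Gen) : FreeAlgebra ℂ Gen := FreeAlgebra.ι ℂ x

/-- The defining relations of `U_q(sl_2)`. -/
inductive Rel (q : ℂ) : FreeAlgebra ℂ Gen → FreeAlgebra ℂ Gen → Prop
  | K_Kinv : Rel q (gen .K * gen .Kinv) 1
  | Kinv_K : Rel q (gen .Kinv * gen .K) 1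
  | K_X : Rel q (gen .K * gen .X * gen .Kinv) (q ^ 2 • gen .X)
  | K_Y : Rel q (gen .K * gen .Y * gen .Kinv) ((q ^ 2)⁻¹ • gen .Y)
  | X_Y : Rel q (gen .X * gen .Y - gen .Y * gen .X) ((q - q⁻¹)⁻¹ • (gen .K - gen .Kinv))

/-- The algebra `U_q(sl_2)`. -/
def Uq (q : ℂ) : Type := RingQuot (Rel q)

namespace Uq

variable {q : ℂ}

instance : Ring (Uq q) := inferInstanceAs (Ring (RingQuot (Rel q)))

instance : Algebra ℂ (Uq q) := inferInstanceAs (Algebra ℂ (RingQuot (Rel q)))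

/-- The quotient map. -/
def mkHom (q : ℂ) : FreeAlgebra ℂ Gen →ₐ[ℂ] Uq q := RingQuot.mkAlgHom ℂ (Rel q)

/-- The generators of `U_q(sl_2)`. -/
def of (q : ℂ) (x : Gen) : Uq q := mkHom q (gen x)

theorem rel {x y : FreeAlgebra ℂ Gen} (h : Rel q x y) : mkHom q x = mkHom q y :=
  RingQuot.mkAlgHom_rel ℂ h

/-- Algebra morphisms out of `U_q(sl_2)`. -/
def lift {A : Type*} [Ring A] [Algebra ℂ A] (f : Gen → A)
    (h1 : f .K * f .Kinv = 1) (h2 : f .Kinv * f .K = 1)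
    (h3 : f .K * f .X * f .Kinv = q ^ 2 • f .X)
    (h4 : f .K * f .Y * f .Kinv = (q ^ 2)⁻¹ • f .Y)
    (h5 : f .X * f .Y - f .Y * f .X = (q - q⁻¹)⁻¹ • (f .K - f .Kinv)) : Uq q →ₐ[ℂ] A :=
  RingQuot.liftAlgHom ℂ ⟨FreeAlgebra.lift ℂ f, by
    intro x y h
    cases h <;> simpa [gen] using by assumption⟩

theorem lift_of {A : Type*} [Ring A] [Algebra ℂ A] (f : Gen → A) (h1 h2 h3 h4 h5) (x : Gen) :
    lift (q := q) f h1 h2 h3 h4 h5 (of q x) = f x := by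
  have := RingQuot.liftAlgHom_mkAlgHom_apply ℂ (FreeAlgebra.lift ℂ f) (s := Rel q) (by
    intro x y h
    cases h <;> simpa [gen] using by assumption) (gen x)
  exact this.trans (by simp [gen])

theorem K_Kinv : of q .K * of q .Kinv = 1 := by
  simpa [of] using rel (q := q) .K_Kinv

theorem Kinv_K : of q .Kinv * of q .K = 1 := by
  simpa [of] using rel (q := q) .Kinv_K

theorem K_X : of q .K * of q .X * of q .Kinv = q ^ 2 • of q .X := by
  simpa [of] using rel (q := q) .K_X

theorem K_Y : of q .K * of q .Y * of q .Kinv = (q ^ 2)⁻¹ • of q .Y := by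
  simpa [of] using rel (q := q) .K_Y

theorem X_Y : of q .X * of q .Y - of q .Y * of q .X = (q - q⁻¹)⁻¹ • (of q .K - of q .Kinv) := by
  simpa [of] using rel (q := q) .X_Y

theorem X_Kinv : of q .X * of q .Kinv = q ^ 2 • (of q .Kinv * of q .X) := by
  rw [← mul_smul_comm, ← K_X, ← mul_assoc, ← mul_assoc, Kinv_K, one_mul]

theorem K_Y' : of q .K * of q .Y = (q ^ 2)⁻¹ • (of q .Y * of q .K) := by
  rw [← smul_mul_assoc, ← K_Y, mul_assoc _ (of q .Kinv), Kinv_K, mul_one]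

theorem X_eq_zero (h : q = 0) : of q .X = 0 := by
  have e : of q .X = of q .Kinv * (of q .K * of q .X * of q .Kinv) * of q .K := by
    simp only [← mul_assoc]
    rw [Kinv_K, one_mul, mul_assoc, Kinv_K, mul_one]
  rw [e, K_X, h]
  simp

theorem K_Y_X_Kinv : of q .K * of q .Y * (of q .X * of q .Kinv) = of q .Y * of q .X := by
  by_cases h : q = 0
  · simp [X_eq_zero h]
  · rw [K_Y', X_Kinv, smul_mul_smul_comm, inv_mul_cancel₀ (pow_ne_zero 2 h), one_smul, mul_assoc,
      ← mul_assoc (of q .K), K_Kinv, one_mul]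

theorem tmul_aux : (of q .X * of q .Kinv) ⊗ₜ[ℂ] (of q .K * of q .Y) =
    (of q .Kinv * of q .X) ⊗ₜ[ℂ] (of q .Y * of q .K) := by
  by_cases h : q = 0
  · simp [X_eq_zero h]
  · rw [K_Y', X_Kinv, TensorProduct.smul_tmul_smul, mul_inv_cancel₀ (pow_ne_zero 2 h), one_smul]

/-- `U_q(sl_2)` is generated by `K`, `K⁻¹`, `X`, `Y`. -/
theorem induction {P : Uq q → Prop} (halg : ∀ c : ℂ, P (algebraMap ℂ (Uq q) c))
    (hof : ∀ x, P (of q x)) (hadd : ∀ u v, P u → P v → P (u + v))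
    (hmul : ∀ u v, P u → P v → P (u * v)) (u : Uq q) : P u := by
  obtain ⟨u, rfl⟩ : ∃ v, mkHom q v = u := RingQuot.mkAlgHom_surjective ℂ (Rel q) u
  induction u using FreeAlgebra.induction with
  | grade0 c => rw [AlgHom.commutes]; exact halg c
  | grade1 x => exact hof x
  | add u v hu hv => rw [map_add]; exact hadd _ _ hu hv
  | mul u v hu hv => rw [map_mul]; exact hmul _ _ hu hv

/-- The comultiplication on generators. -/
def comulGen (q : ℂ) : Gen → Uq q ⊗[ℂ] Uq q
  | .K => of q .K ⊗ₜ of q .K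
  | .Kinv => of q .Kinv ⊗ₜ of q .Kinv
  | .X => 1 ⊗ₜ of q .X + of q .X ⊗ₜ of q .K
  | .Y => of q .Kinv ⊗ₜ of q .Y + of q .Y ⊗ₜ 1

/-- The comultiplication `Δ`. -/
def comul (q : ℂ) : Uq q →ₐ[ℂ] Uq q ⊗[ℂ] Uq q :=
  lift (comulGen q)
    (by simp [comulGen, K_Kinv, Algebra.TensorProduct.one_def])
    (by simp [comulGen, Kinv_K, Algebra.TensorProduct.one_def])
    (by
      simp only [comulGen, mul_add, add_mul, Algebra.TensorProduct.tmul_mul_tmul, mul_one,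
        K_Kinv, mul_assoc, smul_add]
      rw [← mul_assoc, K_X]
      simp [TensorProduct.smul_tmul'])
    (by
      simp only [comulGen, mul_add, add_mul, Algebra.TensorProduct.tmul_mul_tmul, mul_one,
        K_Kinv, mul_assoc, smul_add]
      rw [← mul_assoc, K_Y]
      simp [TensorProduct.smul_tmul'])
    (by
      simp only [comulGen, mul_add, add_mul, Algebra.TensorProduct.tmul_mul_tmul, mul_one, one_mul,
        tmul_aux]
      have h1 : of q .Kinv ⊗ₜ[ℂ] (of q .X * of q .Y) - of q .Kinv ⊗ₜ[ℂ] (of q .Y * of q .X) =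
          of q .Kinv ⊗ₜ[ℂ] ((q - q⁻¹)⁻¹ • (of q .K - of q .Kinv)) := by
        rw [← TensorProduct.tmul_sub, X_Y]
      have h2 : (of q .X * of q .Y) ⊗ₜ[ℂ] of q .K - (of q .Y * of q .X) ⊗ₜ[ℂ] of q .K =
          ((q - q⁻¹)⁻¹ • (of q .K - of q .Kinv)) ⊗ₜ[ℂ] of q .K := by
        rw [← TensorProduct.sub_tmul, X_Y]
      have h3 : (q - q⁻¹)⁻¹ • (of q .K ⊗ₜ[ℂ] of q .K - of q .Kinv ⊗ₜ[ℂ] of q .Kinv) =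
          of q .Kinv ⊗ₜ[ℂ] ((q - q⁻¹)⁻¹ • (of q .K - of q .Kinv)) +
          ((q - q⁻¹)⁻¹ • (of q .K - of q .Kinv)) ⊗ₜ[ℂ] of q .K := by
        rw [TensorProduct.tmul_smul, ← TensorProduct.smul_tmul', ← smul_add, TensorProduct.tmul_sub,
          TensorProduct.sub_tmul]
        congr 1
        abel
      rw [h3, ← h1, ← h2]
      abel)

/-- The counit `ε`. -/
def counit (q : ℂ) : Uq q →ₐ[ℂ] ℂ :=
  lift (fun x => match x with
    | .K => 1
    | .Kinv => 1
    | .X => 0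
    | .Y => 0) (by simp) (by simp) (by simp) (by simp) (by simp)

/-- The antipode on generators. -/
def antipodeGen (q : ℂ) : Gen → Uq q
  | .K => of q .Kinv
  | .Kinv => of q .K
  | .X => -(of q .X * of q .Kinv)
  | .Y => -(of q .K * of q .Y)

/-- The antipode `S`, an algebra morphism to the opposite algebra. -/
def antipode (q : ℂ) : Uq q →ₐ[ℂ] (Uq q)ᵐᵒᵖ :=
  lift (fun x => .op (antipodeGen q x))
    (by simp only [antipodeGen, ← MulOpposite.op_mul, K_Kinv, MulOpposite.op_one])
    (by simp only [antipodeGen, ← MulOpposite.op_mul, Kinv_K, MulOpposite.op_one])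
    (by
      simp only [antipodeGen, ← MulOpposite.op_mul, ← MulOpposite.op_smul]
      congr 1
      rw [neg_mul, mul_neg, smul_neg, ← smul_mul_assoc, ← K_X]
      simp only [mul_assoc])
    (by
      simp only [antipodeGen, ← MulOpposite.op_mul, ← MulOpposite.op_smul]
      congr 1
      rw [neg_mul, mul_neg, smul_neg, ← mul_smul_comm, ← K_Y])
    (by
      simp only [antipodeGen, ← MulOpposite.op_mul, ← MulOpposite.op_smul, ← MulOpposite.op_sub]
      congr 1
      rw [neg_mul_neg, neg_mul_neg, K_Y_X_Kinv, mul_assoc, ← mul_assoc (of q .Kinv), Kinv_K,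
        one_mul, ← neg_sub, X_Y, ← smul_neg, neg_sub])

end Uq

end QuantumSL2

namespace QuantumSL2

open scoped TensorProduct


section Actions

variable {M N P M' N' : Type} [AddCommGroup M] [Module ℂ M] [AddCommGroup N] [Module ℂ N]
  [AddCommGroup P] [Module ℂ P] [AddCommGroup M'] [Module ℂ M'] [AddCommGroup N'] [Module ℂ N']

/-- The action of the generators on a tensor product. -/
def tensorAct (A : Gen → Module.End ℂ M) (B : Gen → Module.End ℂ N) :
    Gen → Module.End ℂ (M ⊗[ℂ] N)
  | .K => TensorProduct.map (A .K) (B .K)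
  | .Kinv => TensorProduct.map (A .Kinv) (B .Kinv)
  | .X => TensorProduct.map LinearMap.id (B .X) + TensorProduct.map (A .X) (B .K)
  | .Y => TensorProduct.map (A .Kinv) (B .Y) + TensorProduct.map (A .Y) LinearMap.id

/-- The action of the generators on the trivial module. -/
def trivAct : Gen → Module.End ℂ ℂ
  | .K => LinearMap.id
  | .Kinv => LinearMap.id
  | .X => 0
  | .Y => 0

theorem tensorAct_map {A : Gen → Module.End ℂ M} {B : Gen → Module.End ℂ N}
    {A' : Gen → Module.End ℂ M'} {B' : Gen → Module.End ℂ N'} (f : M →ₗ[ℂ] M') (g : N →ₗ[ℂ] N')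
    (hf : ∀ x, f ∘ₗ A x = A' x ∘ₗ f) (hg : ∀ x, g ∘ₗ B x = B' x ∘ₗ g) (x : Gen) :
    TensorProduct.map f g ∘ₗ tensorAct A B x = tensorAct A' B' x ∘ₗ TensorProduct.map f g := by
  cases x <;> simp only [tensorAct, LinearMap.comp_add, LinearMap.add_comp,
    ← TensorProduct.map_comp, hf, hg, LinearMap.comp_id, LinearMap.id_comp]

theorem tensorAct_assoc (A : Gen → Module.End ℂ M) (B : Gen → Module.End ℂ N)
    (C : Gen → Module.End ℂ P) (x : Gen) :
    (TensorProduct.assoc ℂ M N P).toLinearMap ∘ₗ tensorAct (tensorAct A B) C x =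
      tensorAct A (tensorAct B C) x ∘ₗ (TensorProduct.assoc ℂ M N P).toLinearMap := by
  apply TensorProduct.ext_threefold
  intro m n p
  cases x <;> simp [tensorAct, TensorProduct.tmul_add, TensorProduct.add_tmul, add_assoc]

theorem tensorAct_lid (A : Gen → Module.End ℂ M) (x : Gen) :
    (TensorProduct.lid ℂ M).toLinearMap ∘ₗ tensorAct trivAct A x =
      A x ∘ₗ (TensorProduct.lid ℂ M).toLinearMap := by
  apply TensorProduct.ext'
  intro c m
  cases x <;> simp [tensorAct, trivAct]

theorem tensorAct_rid (A : Gen → Module.End ℂ M) (x : Gen) :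
    (TensorProduct.rid ℂ M).toLinearMap ∘ₗ tensorAct A trivAct x =
      A x ∘ₗ (TensorProduct.rid ℂ M).toLinearMap := by
  apply TensorProduct.ext'
  intro m c
  cases x <;> simp [tensorAct, trivAct]

/-- The action of the generators on the dual space: `(u f)(m) = f(S(u) m)`. -/
def dualAct (A : Gen → Module.End ℂ M) : Gen → Module.End ℂ (Module.Dual ℂ M)
  | .K => (A .Kinv).dualMap
  | .Kinv => (A .K).dualMap
  | .X => (-(A .X ∘ₗ A .Kinv)).dualMap
  | .Y => (-(A .K ∘ₗ A .Y)).dualMap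

theorem contract_act (A : Gen → Module.End ℂ M) (h : A .K ∘ₗ A .Kinv = LinearMap.id)
    (h' : A .Kinv ∘ₗ A .K = LinearMap.id) (x : Gen) :
    contractLeft ℂ M ∘ₗ tensorAct (dualAct A) A x = trivAct x ∘ₗ contractLeft ℂ M := by
  apply TensorProduct.ext'
  intro f m
  have e : ∀ m, A .K (A .Kinv m) = m := LinearMap.congr_fun h
  have e' : ∀ m, A .Kinv (A .K m) = m := LinearMap.congr_fun h'
  cases x <;> simp [tensorAct, dualAct, trivAct, e, e']

theorem map_dualMap_coevaluation [FiniteDimensional ℂ M] (f g : Module.End ℂ M) :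
    TensorProduct.map f g.dualMap (coevaluation ℂ M 1) =
      TensorProduct.map (f ∘ₗ g) LinearMap.id (coevaluation ℂ M 1) := by
  have key : ∀ f g : Module.End ℂ M, dualTensorHom ℂ M M (TensorProduct.comm ℂ _ _
      (TensorProduct.map f g.dualMap (coevaluation ℂ M 1))) = f ∘ₗ g := by
    intro f g
    rw [coevaluation_apply_one]
    ext m
    simp only [map_sum, TensorProduct.map_tmul, TensorProduct.comm_tmul, LinearMap.sum_apply,
      dualTensorHom_apply, LinearMap.dualMap_apply, LinearMap.comp_apply, ← map_smul]
    rw [← map_sum]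
    congr 1
    exact (Module.Basis.ofVectorSpace ℂ M).sum_repr (g m)
  apply (TensorProduct.comm ℂ _ _).injective
  apply (dualTensorHomEquiv ℂ M M).injective
  have := (key f g).trans (key (f ∘ₗ g) LinearMap.id).symm
  simpa [LinearMap.dualMap_id] using this

theorem coev_act [FiniteDimensional ℂ M] (A : Gen → Module.End ℂ M)
    (h : A .K ∘ₗ A .Kinv = LinearMap.id) (h' : A .Kinv ∘ₗ A .K = LinearMap.id) (x : Gen) :
    coevaluation ℂ M ∘ₗ trivAct x = tensorAct A (dualAct A) x ∘ₗ coevaluation ℂ M := by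
  apply LinearMap.ext_ring
  have hneg : ∀ f : Module.End ℂ M, TensorProduct.map (-f) (LinearMap.id (M := Module.Dual ℂ M)) =
      -TensorProduct.map f LinearMap.id := fun f => by
    apply TensorProduct.ext'
    intro m n
    simp [TensorProduct.neg_tmul]
  cases x <;> simp only [tensorAct, dualAct, trivAct, LinearMap.comp_apply, LinearMap.add_apply,
    map_dualMap_coevaluation, h, h', LinearMap.id_apply, LinearMap.zero_apply, map_zero,
    TensorProduct.map_id]
  · rw [LinearMap.id_comp, hneg, LinearMap.neg_apply, neg_add_cancel]
  · rw [LinearMap.comp_neg, ← LinearMap.comp_assoc, h', LinearMap.id_comp, hneg,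
      LinearMap.neg_apply, neg_add_cancel]

/-- The pairing of `N^* ⊗ M^*` with `M ⊗ N`. -/
def dualTensor (M N : Type) [AddCommGroup M] [Module ℂ M] [AddCommGroup N] [Module ℂ N]
    [FiniteDimensional ℂ M] [FiniteDimensional ℂ N] :
    Module.Dual ℂ N ⊗[ℂ] Module.Dual ℂ M ≃ₗ[ℂ] Module.Dual ℂ (M ⊗[ℂ] N) :=
  TensorProduct.comm ℂ _ _ ≪≫ₗ TensorProduct.dualDistribEquiv ℂ M N

theorem dualTensor_act [FiniteDimensional ℂ M] [FiniteDimensional ℂ N] (A : Gen → Module.End ℂ M)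
    (B : Gen → Module.End ℂ N) (h : A .K ∘ₗ A .Kinv = LinearMap.id)
    (h' : B .K ∘ₗ B .Kinv = LinearMap.id) (x : Gen) :
    (dualTensor M N).toLinearMap ∘ₗ tensorAct (dualAct B) (dualAct A) x =
      dualAct (tensorAct A B) x ∘ₗ (dualTensor M N).toLinearMap := by
  apply TensorProduct.ext'
  intro g f
  apply TensorProduct.ext'
  intro m n
  have e : ∀ m, A .K (A .Kinv m) = m := LinearMap.congr_fun h
  have e' : ∀ m, B .K (B .Kinv m) = m := LinearMap.congr_fun h'
  cases x <;> simp [tensorAct, dualAct, dualTensor, TensorProduct.dualDistribEquiv, e, e']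

/-- The identification of `ℂ` with its dual. -/
def scalarDual : ℂ ≃ₗ[ℂ] Module.Dual ℂ ℂ := (LinearMap.ringLmapEquivSelf ℂ ℂ ℂ).symm

theorem scalarDual_act (x : Gen) :
    scalarDual.toLinearMap ∘ₗ trivAct x = dualAct trivAct x ∘ₗ scalarDual.toLinearMap := by
  cases x <;> apply LinearMap.ext_ring <;> apply LinearMap.ext_ring <;>
    simp [dualAct, trivAct, scalarDual]

end Actions


/-- A finite-dimensional `U_q(sl_2)`-module. -/
structure UqMod (q : ℂ) : Type 1 where
  carrier : Type
  [addCommGroup : AddCommGroup carrier]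
  [module : Module ℂ carrier]
  [finite : FiniteDimensional ℂ carrier]
  ρ : Uq q →ₐ[ℂ] Module.End ℂ carrier

namespace UqMod

variable {q : ℂ}

instance : CoeSort (UqMod q) Type := ⟨UqMod.carrier⟩

instance (M : UqMod q) : AddCommGroup M := M.addCommGroup

instance (M : UqMod q) : Module ℂ M := M.module

instance (M : UqMod q) : FiniteDimensional ℂ M := M.finite

/-- The action of a generator. -/
def act (M : UqMod q) (x : Gen) : Module.End ℂ M := M.ρ (Uq.of q x)

/-- A morphism of modules. -/
@[ext] structure Hom (M N : UqMod q) : Type where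
  lin : M →ₗ[ℂ] N
  comm : ∀ (u : Uq q) (m : M), lin (M.ρ u m) = N.ρ u (lin m)

theorem comm_of_gen {M N : UqMod q} (f : M →ₗ[ℂ] N) (h : ∀ x, f ∘ₗ M.act x = N.act x ∘ₗ f)
    (u : Uq q) (m : M) : f (M.ρ u m) = N.ρ u (f m) := by
  induction u using Uq.induction generalizing m with
  | halg c => simp [Module.algebraMap_end_apply]
  | hof x => exact LinearMap.congr_fun (h x) m
  | hadd u v hu hv => simp [hu, hv]
  | hmul u v hu hv => simp [hu, hv]

/-- A linear map that commutes with the generators is a morphism. -/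
def Hom.ofGen {M N : UqMod q} (f : M →ₗ[ℂ] N) (h : ∀ x, f ∘ₗ M.act x = N.act x ∘ₗ f) :
    Hom M N := ⟨f, comm_of_gen f h⟩

/-- The category `U_q`-Mod of finite-dimensional `U_q(sl_2)`-modules. -/
instance : Category (UqMod q) where
  Hom := Hom
  id M := ⟨LinearMap.id, fun _ _ => rfl⟩
  comp f g := ⟨g.lin ∘ₗ f.lin, fun u m => by simp [f.comm, g.comm]⟩

/-- The underlying linear map of a morphism. -/
def toLin {M N : UqMod q} (f : M ⟶ N) : M →ₗ[ℂ] N := Hom.lin f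

@[ext] theorem hom_ext {M N : UqMod q} {f g : M ⟶ N} (h : toLin f = toLin g) : f = g := Hom.ext h

theorem toLin_id (M : UqMod q) : toLin (𝟙 M) = LinearMap.id := rfl

theorem toLin_comp {M N P : UqMod q} (f : M ⟶ N) (g : N ⟶ P) :
    toLin (f ≫ g) = toLin g ∘ₗ toLin f := rfl

theorem toLin_comm {M N : UqMod q} (f : M ⟶ N) (u : Uq q) (m : M) :
    toLin f (M.ρ u m) = N.ρ u (toLin f m) := Hom.comm f u m

/-- An equivariant linear isomorphism as an isomorphism of modules. -/
def isoOfGen {M N : UqMod q} (e : M ≃ₗ[ℂ] N)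
    (h : ∀ x, e.toLinearMap ∘ₗ M.act x = N.act x ∘ₗ e.toLinearMap) : M ≅ N where
  hom := Hom.ofGen e.toLinearMap h
  inv := Hom.ofGen e.symm.toLinearMap (fun x => by
    ext m
    have := LinearMap.congr_fun (h x) (e.symm m)
    simp only [LinearMap.comp_apply, LinearEquiv.coe_coe, LinearEquiv.apply_symm_apply] at this ⊢
    rw [← this, LinearEquiv.symm_apply_apply])
  hom_inv_id := hom_ext (LinearMap.ext fun m => e.symm_apply_apply m)
  inv_hom_id := hom_ext (LinearMap.ext fun m => e.apply_symm_apply m)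

instance {M N : UqMod q} : Zero (M ⟶ N) := ⟨⟨0, fun _ _ => by simp⟩⟩

instance {M N : UqMod q} : Add (M ⟶ N) :=
  ⟨fun f g => ⟨toLin f + toLin g, fun u m => by simp [toLin_comm]⟩⟩

instance {M N : UqMod q} : Neg (M ⟶ N) :=
  ⟨fun f => ⟨-toLin f, fun u m => by simp [toLin_comm]⟩⟩

instance {M N : UqMod q} : SMul ℂ (M ⟶ N) :=
  ⟨fun c f => ⟨c • toLin f, fun u m => by simp [toLin_comm]⟩⟩

instance (M N : UqMod q) : AddCommGroup (M ⟶ N) :=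
  { AddGroup.ofLeftAxioms (G := (M ⟶ N))
      (fun _ _ _ => hom_ext (add_assoc _ _ _)) (fun _ => hom_ext (zero_add _))
      (fun _ => hom_ext (neg_add_cancel _)) with
    add_comm := fun _ _ => hom_ext (add_comm _ _) }

instance (M N : UqMod q) : Module ℂ (M ⟶ N) where
  one_smul _ := hom_ext (one_smul _ _)
  mul_smul _ _ _ := hom_ext (mul_smul _ _ _)
  smul_zero _ := hom_ext (smul_zero _)
  smul_add _ _ _ := hom_ext (smul_add _ _ _)
  add_smul _ _ _ := hom_ext (add_smul _ _ _)
  zero_smul _ := hom_ext (zero_smul _ _)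

instance : Preadditive (UqMod q) where
  add_comp _ _ _ _ _ _ := hom_ext (LinearMap.comp_add _ _ _)
  comp_add _ _ _ _ _ _ := hom_ext (LinearMap.add_comp _ _ _)

instance : Linear ℂ (UqMod q) where
  smul_comp _ _ _ _ _ _ := hom_ext (LinearMap.comp_smul _ _ _)
  comp_smul _ _ _ _ _ _ := hom_ext (LinearMap.smul_comp _ _ _)

/-- The tensor product of modules; `U_q(sl_2)` acts through the comultiplication. -/
def tensor (M N : UqMod q) : UqMod q where
  carrier := M ⊗[ℂ] N
  ρ := (Module.endTensorEndAlgHom (R := ℂ) (S := ℂ) (A := ℂ) (M := M) (N := N)).comp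
    ((Algebra.TensorProduct.map M.ρ N.ρ).comp (Uq.comul q))

/-- The trivial module, on which `U_q(sl_2)` acts through the counit. -/
def triv (q : ℂ) : UqMod q where
  carrier := ℂ
  ρ := (Algebra.ofId ℂ (Module.End ℂ ℂ)).comp (Uq.counit q)

theorem tensor_act (M N : UqMod q) : (tensor M N).act = tensorAct M.act N.act := by
  funext x
  change Module.endTensorEndAlgHom (Algebra.TensorProduct.map M.ρ N.ρ (Uq.comul q (Uq.of q x))) = _
  rw [Uq.comul, Uq.lift_of]
  cases x <;> simp only [Uq.comulGen, map_add, Algebra.TensorProduct.map_tmul, map_one] <;> rfl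

theorem triv_act : (triv q).act = trivAct := by
  funext x
  change algebraMap ℂ (Module.End ℂ ℂ) (Uq.counit q (Uq.of q x)) = _
  rw [Uq.counit, Uq.lift_of]
  cases x <;> ext <;> simp [trivAct]

theorem K_Kinv_act (M : UqMod q) : M.act .K ∘ₗ M.act .Kinv = LinearMap.id :=
  (map_mul M.ρ _ _).symm.trans ((congrArg M.ρ Uq.K_Kinv).trans (map_one M.ρ))

theorem Kinv_K_act (M : UqMod q) : M.act .Kinv ∘ₗ M.act .K = LinearMap.id :=
  (map_mul M.ρ _ _).symm.trans ((congrArg M.ρ Uq.Kinv_K).trans (map_one M.ρ))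

theorem toLin_act {M N : UqMod q} (f : M ⟶ N) (x : Gen) :
    toLin f ∘ₗ M.act x = N.act x ∘ₗ toLin f := LinearMap.ext fun m => toLin_comm f _ m

/-- The tensor product of morphisms. -/
def tensorMap {M N M' N' : UqMod q} (f : M ⟶ M') (g : N ⟶ N') : tensor M N ⟶ tensor M' N' :=
  Hom.ofGen (M := tensor M N) (N := tensor M' N') (TensorProduct.map (toLin f) (toLin g))
    (fun x => by
      rw [tensor_act, tensor_act]
      exact tensorAct_map (toLin f) (toLin g) (toLin_act f) (toLin_act g) x)

instance : MonoidalCategoryStruct (UqMod q) where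
  tensorObj := tensor
  tensorUnit := triv q
  tensorHom := tensorMap
  whiskerLeft M _ _ f := tensorMap (𝟙 M) f
  whiskerRight f N := tensorMap f (𝟙 N)
  associator M N P := isoOfGen (M := tensor (tensor M N) P) (N := tensor M (tensor N P))
    (TensorProduct.assoc ℂ M N P) (fun x => by
      rw [tensor_act, tensor_act, tensor_act, tensor_act]
      exact tensorAct_assoc M.act N.act P.act x)
  leftUnitor M := isoOfGen (M := tensor (triv q) M) (TensorProduct.lid ℂ M) (fun x => by
    rw [tensor_act, triv_act]
    exact tensorAct_lid M.act x)
  rightUnitor M := isoOfGen (M := tensor M (triv q)) (TensorProduct.rid ℂ M) (fun x => by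
    rw [tensor_act, triv_act]
    exact tensorAct_rid M.act x)

/-- The monoidal category of finite-dimensional `U_q(sl_2)`-modules. -/
instance : MonoidalCategory (UqMod q) := MonoidalCategory.ofTensorHom
  (id_tensorHom_id := fun _ _ => hom_ext TensorProduct.map_id)
  (id_tensorHom := fun _ _ _ _ => rfl)
  (tensorHom_id := fun _ _ => rfl)
  (tensorHom_comp_tensorHom := fun _ _ _ _ => hom_ext (TensorProduct.map_comp _ _ _ _).symm)
  (associator_naturality := fun _ _ _ => hom_ext (TensorProduct.ext_threefold fun _ _ _ => rfl))
  (leftUnitor_naturality := fun f => hom_ext (TensorProduct.ext' fun c m =>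
    (map_smul (toLin f) (show ℂ from c) m).symm))
  (rightUnitor_naturality := fun f => hom_ext (TensorProduct.ext' fun m c =>
    (map_smul (toLin f) (show ℂ from c) m).symm))
  (pentagon := fun _ _ _ _ => hom_ext (TensorProduct.ext_fourfold fun _ _ _ _ => rfl))
  (triangle := fun _ _ => hom_ext (TensorProduct.ext_threefold fun m c n =>
    (TensorProduct.smul_tmul (show ℂ from c) m n).symm))

/-- The dual module: `(u f)(m) = f(S(u) m)`. -/
def dual (M : UqMod q) : UqMod q where
  carrier := Module.Dual ℂ M
  ρ := AlgHom.ofLinearMap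
    { toFun := fun u => (M.ρ (Uq.antipode q u).unop).dualMap
      map_add' := fun u v => by ext; simp
      map_smul' := fun c u => by ext; simp }
    (by ext; simp) (fun u v => by ext; simp)

theorem dual_act (M : UqMod q) : (dual M).act = dualAct M.act := by
  funext x
  change (M.ρ (Uq.antipode q (Uq.of q x)).unop).dualMap = _
  rw [Uq.antipode, Uq.lift_of]
  cases x <;> simp only [Uq.antipodeGen, MulOpposite.unop_op, map_neg, map_mul] <;> rfl

/-- The duality morphism `b_M`, which sends `1` to the sum of `e_i ⊗ e^i`. -/
def coev (M : UqMod q) : 𝟙_ (UqMod q) ⟶ M ⊗ dual M :=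
  Hom.ofGen (M := triv q) (N := tensor M (dual M)) (coevaluation ℂ M) (fun x => by
    rw [tensor_act, triv_act, dual_act]
    exact coev_act M.act M.K_Kinv_act M.Kinv_K_act x)

/-- The duality morphism `d_M`, the evaluation. -/
def ev (M : UqMod q) : dual M ⊗ M ⟶ 𝟙_ (UqMod q) :=
  Hom.ofGen (M := tensor (dual M) M) (N := triv q) (contractLeft ℂ M) (fun x => by
    rw [tensor_act, triv_act, dual_act]
    exact contract_act M.act M.K_Kinv_act M.Kinv_K_act x)

/-- The identification of `N^* ⊗ M^*` with `(M ⊗ N)^*`. -/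
def dualTensorIso (M N : UqMod q) : dual N ⊗ dual M ≅ dual (M ⊗ N) :=
  isoOfGen (M := tensor (dual N) (dual M)) (N := dual (tensor M N)) (dualTensor M N) (fun x => by
    rw [tensor_act, dual_act, dual_act, dual_act, tensor_act]
    exact dualTensor_act M.act N.act M.K_Kinv_act N.K_Kinv_act x)

/-- The identification of the trivial module with its dual. -/
def trivDualIso : 𝟙_ (UqMod q) ≅ dual (𝟙_ (UqMod q)) :=
  isoOfGen (M := triv q) (N := dual (triv q)) scalarDual (fun x => by
    rw [dual_act, triv_act]
    exact scalarDual_act x)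

end UqMod

end QuantumSL2

namespace QuantumSL2

open scoped TensorProduct
open UqMod

/-- The parameter `a` is generic (nonzero and not a root of unity) or a primitive root of unity of
order `4r` with `r ≥ 3`. -/
structure Admissible (a : ℂ) : Prop where
  ne_zero : a ≠ 0
  generic_or_root : (∀ n : ℕ, 0 < n → a ^ n ≠ 1) ∨ ∃ r : ℕ, 3 ≤ r ∧ IsPrimitiveRoot a (4 * r)

theorem Admissible.q_ne_zero {a : ℂ} (ha : Admissible a) : a ^ 2 ≠ 0 := pow_ne_zero 2 ha.ne_zero

theorem Admissible.q_sub_ne_zero {a : ℂ} (ha : Admissible a) : a ^ 2 - (a ^ 2)⁻¹ ≠ 0 := by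
  intro h
  have h4 : a ^ 4 = 1 := by
    have h2 := ha.q_ne_zero
    have h3 : a ^ 2 * (a ^ 2)⁻¹ = 1 := mul_inv_cancel₀ h2
    linear_combination a ^ 2 * h + h3
  rcases ha.generic_or_root with h0 | ⟨r, hr, h0⟩
  · exact h0 4 (by norm_num) h4
  · have := Nat.le_of_dvd (by norm_num) (h0.dvd_of_pow_eq_one 4 h4)
    omega

/-- The matrices of the generators acting on `V` in the basis `(v_0, v_1)`. -/
def fundMatrix (q : ℂ) : Gen → Matrix (Fin 2) (Fin 2) ℂ
  | .K => !![q, 0; 0, q⁻¹]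
  | .Kinv => !![q⁻¹, 0; 0, q]
  | .X => !![0, 1; 0, 0]
  | .Y => !![0, 0; 1, 0]

variable {a : ℂ}

/-- The fundamental module `V`, with basis `(v_0, v_1)`, over `U_q(sl_2)` with `q = a ^ 2`. -/
def fund (ha : Admissible a) : UqMod (a ^ 2) where
  carrier := Fin 2 → ℂ
  ρ := (Matrix.toLinAlgEquiv' (R := ℂ) (n := Fin 2)).toAlgHom.comp
    (Uq.lift (fundMatrix (a ^ 2))
      (by
        have := ha.q_ne_zero
        ext i j; fin_cases i <;> fin_cases j <;> simp [fundMatrix, ha.ne_zero])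
      (by
        have := ha.q_ne_zero
        ext i j; fin_cases i <;> fin_cases j <;> simp [fundMatrix, ha.ne_zero])
      (by ext i j; fin_cases i <;> fin_cases j <;> simp [fundMatrix]; ring)
      (by ext i j; fin_cases i <;> fin_cases j <;> simp [fundMatrix]; ring)
      (by
        have := ha.q_sub_ne_zero
        ext i j; fin_cases i <;> fin_cases j <;> simp [fundMatrix]
        · rw [inv_mul_cancel₀ this]
        · rw [← neg_sub (a ^ 2), mul_neg, inv_mul_cancel₀ this]))

theorem fund_act (ha : Admissible a) :
    (fund ha).act = fun x => Matrix.toLin' (fundMatrix (a ^ 2) x) := by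
  funext x
  change Matrix.toLinAlgEquiv' (Uq.lift (fundMatrix (a ^ 2)) _ _ _ _ _ (Uq.of _ x)) = _
  rw [Uq.lift_of]
  rfl

/-- The linear isomorphism from `ℂ ^ 2` to its dual that maps `v_0` to `v^1` and `v_1` to
`-q⁻¹ v^0`. -/
def alphaEquiv (q : ℂ) (hq : q ≠ 0) : (Fin 2 → ℂ) ≃ₗ[ℂ] Module.Dual ℂ (Fin 2 → ℂ) where
  toFun v := v 0 • LinearMap.proj 1 + v 1 • -(q⁻¹ • LinearMap.proj 0)
  map_add' v w := by ext i; simp; ring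
  map_smul' c v := by ext i; simp; ring
  invFun f := ![f (Pi.single 1 1), -(q * f (Pi.single 0 1))]
  left_inv v := by
    ext i; fin_cases i <;> simp [mul_comm q, hq]
  right_inv f := by
    ext i; fin_cases i <;> simp [mul_comm q, hq]

theorem alphaEquiv_act (q : ℂ) (hq : q ≠ 0) (x : Gen) :
    (alphaEquiv q hq).toLinearMap ∘ₗ Matrix.toLin' (fundMatrix q x) =
      dualAct (fun x => Matrix.toLin' (fundMatrix q x)) x ∘ₗ (alphaEquiv q hq).toLinearMap := by
  apply (Pi.basisFun ℂ (Fin 2)).ext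
  intro i
  apply (Pi.basisFun ℂ (Fin 2)).ext
  intro j
  cases x <;> fin_cases i <;> fin_cases j <;>
    simp [alphaEquiv, dualAct, fundMatrix, Matrix.toLin'_apply, Matrix.mulVec, dotProduct,
      Fin.sum_univ_two, hq]

/-- The isomorphism `α : V → V^*` with `α(v_0) = v^1` and `α(v_1) = -q⁻¹ v^0`. -/
def alpha (ha : Admissible a) : fund ha ≅ dual (fund ha) :=
  isoOfGen (M := fund ha) (N := dual (fund ha)) (alphaEquiv (a ^ 2) ha.q_ne_zero) (fun x => by
    rw [dual_act, fund_act]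
    exact alphaEquiv_act (a ^ 2) ha.q_ne_zero x)

/-- The morphism `b : ℂ → V ⊗ V`. -/
def bV (ha : Admissible a) : 𝟙_ (UqMod (a ^ 2)) ⟶ fund ha ⊗ fund ha :=
  coev (fund ha) ≫ fund ha ◁ (alpha ha).inv

/-- The morphism `d : V ⊗ V → ℂ`. -/
def dV (ha : Admissible a) : fund ha ⊗ fund ha ⟶ 𝟙_ (UqMod (a ^ 2)) :=
  (alpha ha).hom ▷ fund ha ≫ ev (fund ha)

/-- The tensor power `V^{⊗ n}`. -/
def fundPow (ha : Admissible a) : ℕ → UqMod (a ^ 2)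
  | 0 => 𝟙_ (UqMod (a ^ 2))
  | n + 1 => fundPow ha n ⊗ fund ha

/-- The associativity isomorphism `V^{⊗ n} ⊗ V ≅ V ⊗ V^{⊗ n}`. -/
def fundPowShift (ha : Admissible a) : (n : ℕ) → (fundPow ha n ⊗ fund ha ≅ fund ha ⊗ fundPow ha n)
  | 0 => λ_ (fund ha) ≪≫ (ρ_ (fund ha)).symm
  | n + 1 => whiskerRightIso (fundPowShift ha n) (fund ha) ≪≫ α_ (fund ha) (fundPow ha n) (fund ha)

/-- The isomorphism `α^{⊗ n}` from `V^{⊗ n}` to `(V^*)^{⊗ n}`, which is identified with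
`(V^{⊗ n})^*` by the rule `(M ⊗ N)^* = N^* ⊗ M^*`. -/
def alphaPow (ha : Admissible a) : (n : ℕ) → (fundPow ha n ≅ dual (fundPow ha n))
  | 0 => trivDualIso
  | n + 1 => fundPowShift ha n ≪≫ (alpha ha ⊗ᵢ alphaPow ha n) ≪≫
      dualTensorIso (fundPow ha n) (fund ha)

/-! ### The braiding and the twist on the tensor powers of `V`, from the universal `R`-matrix -/

/-- The projection of `V` onto the line of `v_i`. -/
def lineProj (ha : Admissible a) (i : Fin 2) : Module.End ℂ (fund ha) :=
  Matrix.toLin' (Matrix.single i i 1)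

/-- The projection of `V^{⊗ n}` onto the space of vectors of weight `i`, where `v_0` has
weight `1` and `v_1` has weight `-1`. -/
def weightProj (ha : Admissible a) : (n : ℕ) → ℤ → Module.End ℂ (fundPow ha n)
  | 0, i => if i = 0 then LinearMap.id else 0
  | n + 1, i => TensorProduct.map (weightProj ha n (i - 1)) (lineProj ha 0) +
      TensorProduct.map (weightProj ha n (i + 1)) (lineProj ha 1)

/-- The quantum factorial `[k]! = [1] [2] ⋯ [k]`, where `[j] = (q^j - q^{-j}) / (q - q^{-1})`. -/
def qFactorial (q : ℂ) (k : ℕ) : ℂ :=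
  ∏ j ∈ Finset.range k, (q ^ (j + 1) - (q ^ (j + 1))⁻¹) / (q - q⁻¹)

open Classical in
/-- The coefficient of `X^k ⊗ Y^k` in the universal `R`-matrix
`R = q^{H ⊗ H / 2} ∑ₖ q^{k (k - 1) / 2} (q - q^{-1})^k / [k]! X^k ⊗ Y^k`. At a root of unity the sum
stops before the first `k` with `[k]! = 0`. -/
def rCoeff (q : ℂ) (k : ℕ) : ℂ :=
  if qFactorial q k = 0 then 0 else q ^ (k * (k - 1) / 2) * (q - q⁻¹) ^ k / qFactorial q k

/-- The sum over `k` in the `R`-matrix, acting on `V^{⊗ n} ⊗ V^{⊗ m}`, where `X ^ (n + 1) = 0`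
on `V^{⊗ n}`. -/
def quasiR (ha : Admissible a) (n m : ℕ) : Module.End ℂ (fundPow ha n ⊗[ℂ] fundPow ha m) :=
  ∑ k ∈ Finset.range (n + 1), rCoeff (a ^ 2) k •
    TensorProduct.map ((fundPow ha n).act .X ^ k) ((fundPow ha m).act .Y ^ k)

/-- The operator `q^{H ⊗ H / 2}` on `V^{⊗ n} ⊗ V^{⊗ m}`, for `q^{1/2} = a`: it multiplies the
tensor product of vectors of weights `i` and `j` by `a ^ (i * j)`. -/
def cartanR (ha : Admissible a) (n m : ℕ) : Module.End ℂ (fundPow ha n ⊗[ℂ] fundPow ha m) :=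
  ∑ i ∈ Finset.Icc (-n : ℤ) n, ∑ j ∈ Finset.Icc (-m : ℤ) m, a ^ (i * j) •
    TensorProduct.map (weightProj ha n i) (weightProj ha m j)

/-- The braiding of `V^{⊗ n}` and `V^{⊗ m}`: the action of the `R`-matrix, followed by the flip.
With `q^{1/2} = a`, the braiding of `V` with itself maps `v_0 ⊗ v_0` to `q^{1/2} v_0 ⊗ v_0`,
`v_1 ⊗ v_1` to `q^{1/2} v_1 ⊗ v_1`, `v_0 ⊗ v_1` to `q^{-1/2} v_1 ⊗ v_0`, and `v_1 ⊗ v_0` to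
`q^{-1/2} v_0 ⊗ v_1 + q^{-1/2} (q - q^{-1}) v_1 ⊗ v_0`. -/
def modBraiding (ha : Admissible a) (n m : ℕ) :
    fundPow ha n ⊗[ℂ] fundPow ha m →ₗ[ℂ] fundPow ha m ⊗[ℂ] fundPow ha n :=
  (TensorProduct.comm ℂ (fundPow ha n) (fundPow ha m)).toLinearMap ∘ₗ
    cartanR ha n m ∘ₗ quasiR ha n m

/-- The twist of `V^{⊗ n}`: the action of `∑ t K s`, where `R = ∑ s ⊗ t`, which is the inverse of
the ribbon element. The term `X^k ⊗ Y^k` of `R` maps a vector `w` of weight `i` to the vector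
`Y^k X^k w`, multiplied by `q^{i + 2k}` (for `K`) and by `a^{i (i + 2k)}` (for `q^{H ⊗ H / 2}`).
The twist of `V` is multiplication by `q^{3/2} = a^3`. -/
def modTwist (ha : Admissible a) (n : ℕ) : Module.End ℂ (fundPow ha n) :=
  ∑ k ∈ Finset.range (n + 1), ∑ i ∈ Finset.Icc (-n : ℤ) n,
    (rCoeff (a ^ 2) k * a ^ (i * (i + 2 * k)) * (a ^ 2) ^ (i + 2 * k)) •
      ((fundPow ha n).act .Y ^ k * (fundPow ha n).act .X ^ k * weightProj ha n i)

/-! ### Functors from the Temperley-Lieb category -/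

open Functor.LaxMonoidal Functor.OplaxMonoidal

/-- A functor `F : S(a) ⥤ U_q`-Mod that preserves the tensor structures (linear on morphisms,
compatible with tensor products and units through coherent isomorphisms, bijective on the
endomorphisms of the unit), with an identification `F(1) ≅ V` that turns the images of the cup and
of the cap into `b` and `d`. -/
structure TensorFunctor (ha : Admissible a) where
  functor : TemperleyLieb.Obj a ⥤ UqMod (a ^ 2)
  [additive : functor.Additive]
  [linear : functor.Linear ℂ]
  [monoidal : functor.Monoidal]
  end_bijective : Function.Bijective fun
    f : 𝟙_ (TemperleyLieb.Obj a) ⟶ 𝟙_ (TemperleyLieb.Obj a) => functor.map f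
  objOne : functor.obj ⟨1⟩ ≅ fund ha
  map_cup : ε functor ≫ functor.map (TemperleyLieb.cup a) ≫ δ functor ⟨1⟩ ⟨1⟩ ≫
    (objOne.hom ⊗ₘ objOne.hom) = bV ha
  map_cap : (objOne.inv ⊗ₘ objOne.inv) ≫ μ functor ⟨1⟩ ⟨1⟩ ≫ functor.map (TemperleyLieb.cap a) ≫
    η functor = dV ha

namespace TensorFunctor

variable {ha : Admissible a}

instance (F : TensorFunctor ha) : F.functor.Additive := F.additive

instance (F : TensorFunctor ha) : F.functor.Linear ℂ := F.linear

instance (F : TensorFunctor ha) : F.functor.Monoidal := F.monoidal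

/-- The identification `F(n) ≅ V^{⊗ n}`. -/
def objIso (F : TensorFunctor ha) : (n : ℕ) → (F.functor.obj ⟨n⟩ ≅ fundPow ha n)
  | 0 => (Functor.Monoidal.εIso F.functor).symm
  | n + 1 => (Functor.Monoidal.μIso F.functor ⟨n⟩ ⟨1⟩).symm ≪≫ (F.objIso n ⊗ᵢ F.objOne)

/-- The identification `F(n ⊗ m) ≅ V^{⊗ n} ⊗ V^{⊗ m}`. -/
def tensorIso (F : TensorFunctor ha) (n m : ℕ) :
    F.functor.obj (⟨n⟩ ⊗ ⟨m⟩) ≅ fundPow ha n ⊗ fundPow ha m :=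
  (Functor.Monoidal.μIso F.functor ⟨n⟩ ⟨m⟩).symm ≪≫ (F.objIso n ⊗ᵢ F.objIso m)

end TensorFunctor

end QuantumSL2

end

open QuantumSL2

/-!
The functor sends `n` to `V^{⊗ n}`, a cup to `b` and a cap to `d` inserted between identities, and a
crossing to the combination of identities, `b` and `d` that Kauffman's relation prescribes
(`diagMap`). The local relations hold because `b` and `d` are natural in the object to their left
(exchange of heights), satisfy the zigzag identities (`zigzag_left`, `zigzag_right`), and compose to
`-(q + q⁻¹)` (`bV_dV`); the rotation of a crossing follows from the zigzag identities after
expansion of the crossing. Hence `diagMap` descends to the skein spaces and gives the monoidal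
functor `stdFunctor`, whose tensor structure is the juxtaposition
`powMul : V^{⊗ n} ⊗ V^{⊗ m} ≅ V^{⊗ (n + m)}`. It is bijective on the endomorphisms of the unit
because every closed diagram is a multiple of the empty one (`Skein.exists_eq_smul`): the diagrams
made of cups span every `E_{0,k}`, since a cap that follows cups moves down until it cancels with a
cup or closes a circle.

For any other functor `F`, the identifications `F(n) ≅ V^{⊗ n}` are compatible with juxtaposition
(`TensorFunctor.μ_objIso`) and natural at the cup and the cap, so they are natural at every slice and
thus at every diagram (`TensorFunctor.map_ofDiagram`). This gives the monoidal isomorphism between two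
functors. It is unique because a monoidal transformation is determined by its value at the object
`1`. It also reduces the last four formulas to computations with `diagMap`.

* Braiding (`joinLin_modBraiding`). On vectors of weights `i` and `j` the `R`-matrix acts by
  `∑ₖ cₖ a ^ ((i + 2k) (j - 2k)) X^k ⊗ Y^k`. One strand passing `m` strands is computed by induction
  on `m` from Kauffman's relation (`HasWeight.passOne_zero`, `HasWeight.passOne_one`), and `n` strands
  by induction on `n`; the inductive step is the recursion `c_{k+1} [k+1] = q^k (q - q⁻¹) c_k`. At a
  root of unity this recursion fails for the first `k` with `[k] = 0`, but there `Y^k = 0` on all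
  tensor powers (`act_Y_pow_eq_zero`), so the truncated `R`-matrix satisfies the same identity.
* Caps and cups (`diagLin_caps`, `contract_cupsElt`). The pairing of `V^{⊗ n}` with itself given by
  `α^{⊗ n}` is multiplicative both in the outer and in the inner tensor factors
  (`pairing_cons_snoc`, `pairing_snoc_cons`). The nested caps peel off the inner factors, and the
  nested cups are dual to the pairing.
* Twist (`HasWeight.diagLin_curl`). Contraction of the cups in the curl turns the braiding
  `∑ t ⊗ s` into `∑ t φ s`, where `φ` exchanges the arguments of the pairing. This `φ` is
  `(-1) ^ n K` (`pairing_act_K`), so that `θ_n` acts by `∑ t K s`.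
-/

noncomputable section

namespace TemperleyLieb

/-! ### Cups and caps on the right of an object of a monoidal category -/

section Generic

variable {C : Type*} [Category C] [MonoidalCategory C] {V : C}

/-- The morphism `X ⟶ X ⊗ V ⊗ V` that inserts `b` to the right of `X`. -/
def cupAt (b : 𝟙_ C ⟶ V ⊗ V) (X : C) : X ⟶ (X ⊗ V) ⊗ V :=
  (ρ_ X).inv ≫ X ◁ b ≫ (α_ X V V).inv

/-- The morphism `X ⊗ V ⊗ V ⟶ X` that applies `d` to the right of `X`. -/
def capAt (d : V ⊗ V ⟶ 𝟙_ C) (X : C) : (X ⊗ V) ⊗ V ⟶ X :=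
  (α_ X V V).hom ≫ X ◁ d ≫ (ρ_ X).hom

variable (b : 𝟙_ C ⟶ V ⊗ V) (d : V ⊗ V ⟶ 𝟙_ C)

theorem cupAt_naturality {X Y : C} (f : X ⟶ Y) : f ≫ cupAt b Y = cupAt b X ≫ f ▷ V ▷ V := by
  simp only [cupAt, Category.assoc, rightUnitor_inv_naturality_assoc, ← whisker_exchange_assoc,
    associator_inv_naturality_left]

theorem capAt_naturality {X Y : C} (f : X ⟶ Y) : f ▷ V ▷ V ≫ capAt d Y = capAt d X ≫ f := by
  simp only [capAt, Category.assoc, associator_naturality_left_assoc, ← rightUnitor_naturality,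
    whisker_exchange_assoc]

theorem whiskerLeft_cupAt (X Y : C) :
    X ◁ cupAt b Y ≫ (α_ X (Y ⊗ V) V).inv ≫ (α_ X Y V).inv ▷ V = cupAt b (X ⊗ Y) := by
  simp only [cupAt]; monoidal

theorem whiskerLeft_capAt (X Y : C) :
    (α_ X Y V).hom ▷ V ≫ (α_ X (Y ⊗ V) V).hom ≫ X ◁ capAt d Y = capAt d (X ⊗ Y) := by
  simp only [capAt]; monoidal

/-- The combination `x • 𝟙 + y • (cap ≫ cup)` on the two strands to the right of `X`. -/
def crossAt [Preadditive C] [Linear ℂ C] (x y : ℂ) (X : C) : (X ⊗ V) ⊗ V ⟶ (X ⊗ V) ⊗ V :=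
  x • 𝟙 _ + y • (capAt d X ≫ cupAt b X)

theorem crossAt_naturality [Preadditive C] [Linear ℂ C] (x y : ℂ) {X Y : C} (f : X ⟶ Y) :
    f ▷ V ▷ V ≫ crossAt b d x y Y = crossAt b d x y X ≫ f ▷ V ▷ V := by
  simp only [crossAt, Preadditive.comp_add, Preadditive.add_comp, Linear.comp_smul,
    Linear.smul_comp, Category.comp_id, Category.id_comp, Category.assoc, ← cupAt_naturality]
  rw [← Category.assoc, capAt_naturality, Category.assoc]

/-- A zigzag identity for `b` and `d`, with `X` to the left. -/
theorem cupAt_capAt_left (h : (λ_ V).inv ≫ b ▷ V ≫ (α_ V V V).hom ≫ V ◁ d ≫ (ρ_ V).hom = 𝟙 V)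
    (X : C) : cupAt b X ▷ V ≫ capAt d (X ⊗ V) = 𝟙 (X ⊗ V) := by
  have : cupAt b X ▷ V ≫ capAt d (X ⊗ V) =
      X ◁ ((λ_ V).inv ≫ b ▷ V ≫ (α_ V V V).hom ≫ V ◁ d ≫ (ρ_ V).hom) := by
    simp only [cupAt, capAt]; monoidal
  rw [this, h, whiskerLeft_id]

/-- The other zigzag identity for `b` and `d`, with `X` to the left. -/
theorem cupAt_capAt_right (h : (ρ_ V).inv ≫ V ◁ b ≫ (α_ V V V).inv ≫ d ▷ V ≫ (λ_ V).hom = 𝟙 V)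
    (X : C) : cupAt b (X ⊗ V) ≫ capAt d X ▷ V = 𝟙 (X ⊗ V) := by
  have : cupAt b (X ⊗ V) ≫ capAt d X ▷ V =
      X ◁ ((ρ_ V).inv ≫ V ◁ b ≫ (α_ V V V).inv ≫ d ▷ V ≫ (λ_ V).hom) := by
    simp only [cupAt, capAt]; monoidal
  rw [this, h, whiskerLeft_id]

/-- Rotation of a crossing past a cap: both zigzags straighten, which exchanges the two
coefficients of the crossing. -/
theorem crossAt_capAt [Preadditive C] [Linear ℂ C] [MonoidalPreadditive C] [MonoidalLinear ℂ C]
    {X : C} (h : cupAt b X ▷ V ≫ capAt d (X ⊗ V) = 𝟙 (X ⊗ V))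
    (h' : cupAt b (X ⊗ V) ≫ capAt d X ▷ V = 𝟙 (X ⊗ V)) (x y : ℂ) :
    crossAt b d x y (X ⊗ V) ≫ capAt d X ▷ V = crossAt b d y x X ▷ V ≫ capAt d (X ⊗ V) := by
  simp only [crossAt, Preadditive.add_comp, Linear.smul_comp, Category.assoc, h',
    MonoidalPreadditive.add_whiskerRight, MonoidalLinear.smul_whiskerRight, comp_whiskerRight, h,
    id_whiskerRight, Category.id_comp, Category.comp_id]
  exact add_comm _ _

/-- Rotation of a crossing past a cup. -/
theorem cupAt_crossAt [Preadditive C] [Linear ℂ C] [MonoidalPreadditive C] [MonoidalLinear ℂ C]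
    {X : C} (h : cupAt b X ▷ V ≫ capAt d (X ⊗ V) = 𝟙 (X ⊗ V))
    (h' : cupAt b (X ⊗ V) ≫ capAt d X ▷ V = 𝟙 (X ⊗ V)) (x y : ℂ) :
    cupAt b X ▷ V ≫ crossAt b d x y (X ⊗ V) = cupAt b (X ⊗ V) ≫ crossAt b d y x X ▷ V := by
  simp only [crossAt, Preadditive.comp_add, Linear.comp_smul, reassoc_of% h, reassoc_of% h',
    MonoidalPreadditive.add_whiskerRight, MonoidalLinear.smul_whiskerRight, comp_whiskerRight,
    id_whiskerRight, Category.comp_id]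
  exact add_comm _ _

theorem cupAt_capAt (X : C) : cupAt b X ≫ capAt d X = (ρ_ X).inv ≫ X ◁ (b ≫ d) ≫ (ρ_ X).hom := by
  simp only [cupAt, capAt]; monoidal

/-! The morphisms `cupAt`, `capAt` and `crossAt` commute with an isomorphism `m : A ⊗ B ⟶ T` that
juxtaposes objects, when `V` is added twice on the right. -/

theorem cupAt_juxtapose {A B T : C} (m : A ⊗ B ⟶ T) : m ≫ cupAt b T =
    A ◁ cupAt b B ≫ (α_ A (B ⊗ V) V).inv ≫ ((α_ A B V).inv ≫ m ▷ V) ▷ V := by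
  rw [cupAt_naturality, ← whiskerLeft_cupAt]
  simp

theorem capAt_juxtapose {A B T : C} (m : A ⊗ B ⟶ T) :
    ((α_ A (B ⊗ V) V).inv ≫ ((α_ A B V).inv ≫ m ▷ V) ▷ V) ≫ capAt d T =
      A ◁ capAt d B ≫ m := by
  simp only [comp_whiskerRight, Category.assoc]
  rw [capAt_naturality, ← whiskerLeft_capAt]
  simp

theorem crossAt_juxtapose [Preadditive C] [Linear ℂ C] [MonoidalPreadditive C]
    [MonoidalLinear ℂ C] (x y : ℂ) {A B T : C} (m : A ⊗ B ⟶ T) :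
    ((α_ A (B ⊗ V) V).inv ≫ ((α_ A B V).inv ≫ m ▷ V) ▷ V) ≫ crossAt b d x y T =
      A ◁ crossAt b d x y B ≫ ((α_ A (B ⊗ V) V).inv ≫ ((α_ A B V).inv ≫ m ▷ V) ▷ V) := by
  simp only [crossAt, MonoidalPreadditive.whiskerLeft_add, MonoidalLinear.whiskerLeft_smul,
    Preadditive.comp_add, Preadditive.add_comp, Linear.comp_smul, Linear.smul_comp,
    MonoidalCategory.whiskerLeft_comp, Category.assoc, ← cupAt_juxtapose, whiskerLeft_id,
    Category.comp_id, Category.id_comp]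
  have := capAt_juxtapose d m
  simp only [Category.assoc] at this
  rw [reassoc_of% this]

/-- Adding `V` on the right of a juxtaposition with a morphism on the right. -/
theorem juxtapose_left_succ {A B B' S S' T T' : C} {m : A ⊗ B ⟶ S} {c : S ⟶ S'} {s : S' ⟶ T'}
    {c' : T' ⟶ T} {s₀ : B ⟶ B'} {m' : A ⊗ B' ⟶ T} {c₁ : S ⊗ V ⟶ S' ⊗ V} {c₁' : T' ⊗ V ⟶ T ⊗ V}
    (hc : c₁ = c ▷ V) (hc' : c₁' = c' ▷ V) (h : m ≫ c ≫ s ≫ c' = A ◁ s₀ ≫ m') :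
    ((α_ A B V).inv ≫ m ▷ V) ≫ c₁ ≫ s ▷ V ≫ c₁' =
      A ◁ (s₀ ▷ V) ≫ (α_ A B' V).inv ≫ m' ▷ V := by
  have e := congrArg (fun f => (α_ _ _ _).inv ≫ f ▷ V) h
  simp only [comp_whiskerRight] at e
  simpa [hc, hc'] using e

/-- Adding `V` on the right of a juxtaposition with a morphism on the left. -/
theorem juxtapose_right_succ {A A' B S S' T T' : C} {m : A ⊗ B ⟶ S} {c : S ⟶ S'} {s : S' ⟶ T'}
    {c' : T' ⟶ T} {s₀ : A ⟶ A'} {m' : A' ⊗ B ⟶ T} {c₁ : S ⊗ V ⟶ S' ⊗ V} {c₁' : T' ⊗ V ⟶ T ⊗ V}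
    (hc : c₁ = c ▷ V) (hc' : c₁' = c' ▷ V) (h : m ≫ c ≫ s ≫ c' = s₀ ▷ B ≫ m') :
    ((α_ A B V).inv ≫ m ▷ V) ≫ c₁ ≫ s ▷ V ≫ c₁' =
      s₀ ▷ (B ⊗ V) ≫ (α_ A' B V).inv ≫ m' ▷ V := by
  have e := congrArg (fun f => (α_ _ _ _).inv ≫ f ▷ V) h
  simp only [comp_whiskerRight] at e
  simpa [hc, hc'] using e

end Generic

end TemperleyLieb

namespace QuantumSL2

open TemperleyLieb UqMod
open scoped TensorProduct

variable {q : ℂ}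

/-! ### The duality of the fundamental module -/

namespace UqMod

instance : MonoidalPreadditive (UqMod q) where
  whiskerLeft_zero := hom_ext (TensorProduct.map_zero_right _)
  zero_whiskerRight := hom_ext (TensorProduct.map_zero_left _)
  whiskerLeft_add _ _ := hom_ext (TensorProduct.map_add_right _ _ _)
  add_whiskerRight _ _ := hom_ext (TensorProduct.map_add_left _ _ _)

instance : MonoidalLinear ℂ (UqMod q) where
  whiskerLeft_smul _ _ _ _ _ := hom_ext (TensorProduct.map_smul_right _ _ _)
  smul_whiskerRight _ _ _ _ _ := hom_ext (TensorProduct.map_smul_left _ _ _)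

end UqMod

variable {a : ℂ} (ha : Admissible a)

/-- The basis vector `v_i` of `V`. -/
def vec (i : Fin 2) : fund ha := (Pi.single i 1 : Fin 2 → ℂ)

/-- Linear maps on `V` are determined by their values at `v_0` and `v_1`. -/
theorem fund_ext {M : Type*} [AddCommGroup M] [Module ℂ M] {f g : fund ha →ₗ[ℂ] M}
    (h : ∀ i, f (vec ha i) = g (vec ha i)) : f = g :=
  (Pi.basisFun ℂ (Fin 2)).ext fun i => by
    rw [Pi.basisFun_apply]
    exact h i

theorem alphaEquiv_apply_apply (q : ℂ) (hq : q ≠ 0) (u v : Fin 2 → ℂ) :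
    alphaEquiv q hq u v = u 0 * v 1 - q⁻¹ * u 1 * v 0 := by
  change (u 0 • LinearMap.proj 1 + u 1 • -(q⁻¹ • LinearMap.proj 0) :
    Module.Dual ℂ (Fin 2 → ℂ)) v = _
  simp
  ring

theorem alphaEquiv_single (q : ℂ) (hq : q ≠ 0) (i j : Fin 2) :
    alphaEquiv q hq (Pi.single i 1) (Pi.single j 1) =
      (!![0, 1; -q⁻¹, 0] : Matrix (Fin 2) (Fin 2) ℂ) i j := by
  rw [alphaEquiv_apply_apply]
  fin_cases i <;> fin_cases j <;> simp

/-- The pairing `d` as a linear form on the tensor product of vector spaces. -/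
def dLin : fund ha ⊗[ℂ] fund ha →ₗ[ℂ] ℂ := toLin (dV ha)

/-- The element `b(1)` of `V ⊗ V`. -/
def bElt : fund ha ⊗[ℂ] fund ha := toLin (bV ha) (1 : ℂ)

theorem dLin_vec (i j : Fin 2) : dLin ha (vec ha i ⊗ₜ[ℂ] vec ha j) =
    (!![0, 1; -(a ^ 2)⁻¹, 0] : Matrix (Fin 2) (Fin 2) ℂ) i j :=
  alphaEquiv_single _ ha.q_ne_zero i j

/-- The canonical element of `M ⊗ M^*` is the one whose contraction is the identity of `M`. -/
theorem eq_coevaluation {M : Type*} [AddCommGroup M] [Module ℂ M] [FiniteDimensional ℂ M]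
    (z : M ⊗[ℂ] Module.Dual ℂ M)
    (h : ∀ y, TensorProduct.rid ℂ M (TensorProduct.map LinearMap.id (Module.Dual.eval ℂ M y) z) = y) :
    z = coevaluation ℂ M 1 := by
  have key : ∀ (z : M ⊗[ℂ] Module.Dual ℂ M) (y : M),
      dualTensorHom ℂ M M (TensorProduct.comm ℂ _ _ z) y =
        TensorProduct.rid ℂ M (TensorProduct.map LinearMap.id (Module.Dual.eval ℂ M y) z) := by
    intro z y
    induction z using TensorProduct.induction_on with
    | zero => simp
    | tmul m f => simp
    | add u v hu hv => simp only [map_add, LinearMap.add_apply, hu, hv]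
  apply (TensorProduct.comm ℂ _ _).injective
  apply (dualTensorHomEquiv ℂ M M).injective
  ext y
  change dualTensorHom ℂ M M (TensorProduct.comm ℂ _ _ z) y =
    dualTensorHom ℂ M M (TensorProduct.comm ℂ _ _ (coevaluation ℂ M 1)) y
  rw [key, h, key]
  rw [coevaluation_apply_one]
  simp only [map_sum, TensorProduct.map_tmul, LinearMap.id_apply, TensorProduct.rid_tmul]
  exact ((Module.Basis.ofVectorSpace ℂ M).sum_repr y).symm

theorem coevaluation_fin_two (q : ℂ) (hq : q ≠ 0) :
    (TensorProduct.congr (LinearEquiv.refl ℂ (Fin 2 → ℂ)) (alphaEquiv q hq)).symm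
      (coevaluation ℂ (Fin 2 → ℂ) 1) =
      (Pi.single 1 1 : Fin 2 → ℂ) ⊗ₜ[ℂ] (Pi.single 0 1 : Fin 2 → ℂ) -
        q • ((Pi.single 0 1 : Fin 2 → ℂ) ⊗ₜ[ℂ] (Pi.single 1 1 : Fin 2 → ℂ)) := by
  rw [LinearEquiv.symm_apply_eq]
  symm
  apply eq_coevaluation
  intro y
  simp only [map_sub, map_smul, TensorProduct.congr_tmul, TensorProduct.map_tmul,
    LinearEquiv.refl_apply, LinearMap.id_apply, TensorProduct.rid_tmul, Module.Dual.eval_apply,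
    alphaEquiv_apply_apply]
  ext i
  fin_cases i <;> simp [hq]

theorem bElt_eq : bElt ha =
    vec ha 1 ⊗ₜ[ℂ] vec ha 0 - a ^ 2 • (vec ha 0 ⊗ₜ[ℂ] vec ha 1) :=
  coevaluation_fin_two _ ha.q_ne_zero

theorem zigzag_left : (λ_ (fund ha)).inv ≫ bV ha ▷ fund ha ≫ (α_ _ _ _).hom ≫ fund ha ◁ dV ha ≫
    (ρ_ (fund ha)).hom = 𝟙 (fund ha) := by
  apply hom_ext
  apply fund_ext
  intro i
  change TensorProduct.rid ℂ (fund ha) (TensorProduct.map LinearMap.id (dLin ha)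
    (TensorProduct.assoc ℂ (fund ha) (fund ha) (fund ha) (bElt ha ⊗ₜ[ℂ] vec ha i)))
      = vec ha i
  rw [bElt_eq]
  have h := ha.ne_zero
  fin_cases i <;> simp [TensorProduct.sub_tmul, TensorProduct.smul_tmul', dLin_vec, smul_smul, h]

theorem zigzag_right : (ρ_ (fund ha)).inv ≫ fund ha ◁ bV ha ≫ (α_ _ _ _).inv ≫ dV ha ▷ fund ha ≫
    (λ_ (fund ha)).hom = 𝟙 (fund ha) := by
  apply hom_ext
  apply fund_ext
  intro i
  change TensorProduct.lid ℂ (fund ha) (TensorProduct.map (dLin ha) LinearMap.id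
    ((TensorProduct.assoc ℂ (fund ha) (fund ha) (fund ha)).symm
      (vec ha i ⊗ₜ[ℂ] bElt ha))) = vec ha i
  rw [bElt_eq]
  have h := ha.ne_zero
  fin_cases i <;> simp [TensorProduct.tmul_sub, dLin_vec, smul_smul, h]

theorem bV_dV : bV ha ≫ dV ha = (-(a ^ 2 + (a ^ 2)⁻¹)) • 𝟙 (𝟙_ (UqMod (a ^ 2))) := by
  apply hom_ext
  apply LinearMap.ext_ring
  change dLin ha (bElt ha) = (-(a ^ 2 + (a ^ 2)⁻¹)) • (1 : ℂ)
  rw [bElt_eq, map_sub, map_smul, dLin_vec, dLin_vec]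
  simp
  ring

end QuantumSL2

namespace QuantumSL2

open TemperleyLieb UqMod
open scoped TensorProduct

variable {a : ℂ} (ha : Admissible a)

/-! ### The evaluation of diagrams on the tensor powers of `V` -/

/-- The identity of `V^{⊗ n} = V^{⊗ m}` for `n = m`. -/
def powCast {n m : ℕ} (h : n = m) : fundPow ha n ⟶ fundPow ha m := eqToHom (congrArg _ h)

@[simp] theorem powCast_self {n : ℕ} (h : n = n) : powCast ha h = 𝟙 _ := rfl

@[simp] theorem powCast_trans {n m p : ℕ} (h : n = m) (h' : m = p) :
    powCast ha h ≫ powCast ha h' = powCast ha (h.trans h') := eqToHom_trans _ _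

@[simp] theorem powCast_trans_assoc {n m p : ℕ} (h : n = m) (h' : m = p) {X : UqMod (a ^ 2)}
    (f : fundPow ha p ⟶ X) :
    powCast ha h ≫ powCast ha h' ≫ f = powCast ha (h.trans h') ≫ f := eqToHom_trans_assoc _ _ _

theorem powCast_whiskerRight {n m : ℕ} (h : n = m) (h' : n + 1 = m + 1) :
    powCast ha h' = powCast ha h ▷ fund ha := by
  subst h
  exact (id_whiskerRight _ _).symm

/-- The juxtaposition isomorphism `V^{⊗ n} ⊗ V^{⊗ m} ≅ V^{⊗ (n + m)}`. -/
def powMul (n : ℕ) : (m : ℕ) → (fundPow ha n ⊗ fundPow ha m ≅ fundPow ha (n + m))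
  | 0 => ρ_ _
  | m + 1 => (α_ _ _ _).symm ≪≫ whiskerRightIso (powMul n m) (fund ha)

theorem powMul_powCast_left {n n' : ℕ} (h : n = n') (m : ℕ) (h' : n + m = n' + m) :
    (powMul ha n m).hom ≫ powCast ha h' = powCast ha h ▷ fundPow ha m ≫ (powMul ha n' m).hom := by
  subst h
  rw [powCast_self, powCast_self, id_whiskerRight, Category.id_comp, Category.comp_id]

theorem powMul_powCast_right (n : ℕ) {m m' : ℕ} (h : m = m') (h' : n + m = n + m') :
    (powMul ha n m).hom ≫ powCast ha h' = fundPow ha n ◁ powCast ha h ≫ (powMul ha n m').hom := by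
  subst h
  rw [powCast_self, powCast_self, whiskerLeft_id, Category.id_comp, Category.comp_id]

/-- The morphism of a piece with `i` strands to its left. A crossing is given by Kauffman's
relation. -/
def pieceMap (i : ℕ) : (P : Piece) → (fundPow ha (i + P.dom) ⟶ fundPow ha (i + P.cod))
  | .cup => cupAt (bV ha) (fundPow ha i)
  | .cap => capAt (dV ha) (fundPow ha i)
  | .pos => crossAt (bV ha) (dV ha) a a⁻¹ (fundPow ha i)
  | .neg => crossAt (bV ha) (dV ha) a⁻¹ a (fundPow ha i)

/-- The morphism of a piece with `i` strands to its left and `j` strands to its right. -/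
def stripMap (i : ℕ) (P : Piece) :
    (j : ℕ) → (fundPow ha (i + P.dom + j) ⟶ fundPow ha (i + P.cod + j))
  | 0 => pieceMap ha i P
  | j + 1 => stripMap i P j ▷ fund ha

/-- The morphism of a slice. -/
def sliceMap (s : Slice) : fundPow ha s.dom ⟶ fundPow ha s.cod :=
  stripMap ha s.left s.piece s.right

/-- The morphism of a word of slices. -/
def wordMap : (k : ℕ) → (w : List Slice) → (l : ℕ) → IsDiagram k w l →
    (fundPow ha k ⟶ fundPow ha l)
  | _, [], _, h => powCast ha h
  | _, s :: w, l, h => powCast ha h.1.symm ≫ sliceMap ha s ≫ wordMap s.cod w l h.2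

/-- The morphism of a diagram. -/
def diagMap {k l : ℕ} (D : Diagram k l) : fundPow ha k ⟶ fundPow ha l := wordMap ha k D.1 l D.2

theorem wordMap_append {k l m : ℕ} {v w : List Slice} (hv : IsDiagram k v l)
    (hw : IsDiagram l w m) (hvw : IsDiagram k (v ++ w) m) :
    wordMap ha k (v ++ w) m hvw = wordMap ha k v l hv ≫ wordMap ha l w m hw := by
  induction v generalizing k with
  | nil =>
    obtain rfl : k = l := hv
    exact (Category.id_comp _).symm
  | cons s v ih =>
    change powCast ha _ ≫ sliceMap ha s ≫ wordMap ha _ (v ++ w) _ _ =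
      (powCast ha _ ≫ sliceMap ha s ≫ wordMap ha _ v _ _) ≫ _
    rw [ih hv.2]
    simp only [Category.assoc]

theorem diagMap_comp {k l m : ℕ} (D : Diagram k l) (D' : Diagram l m) :
    diagMap ha (D.comp D') = diagMap ha D ≫ diagMap ha D' := wordMap_append ha D.2 D'.2 _

theorem sliceMap_congr {s t : Slice} (h : s = t) (h₁ : s.dom = t.dom) (h₂ : t.cod = s.cod) :
    sliceMap ha s = powCast ha h₁ ≫ sliceMap ha t ≫ powCast ha h₂ := by
  subst h
  rw [powCast_self, powCast_self, Category.id_comp, Category.comp_id]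

/-- Used to remove the casts between equal tensor powers when they are identities by definition. -/
theorem comp_ids {C : Type*} [Category C] {X Y Z : C} {f : X ⟶ Y} {g : Y ⟶ Z} {h : X ⟶ Z}
    (e : f ≫ g = h) : f ≫ 𝟙 Y ≫ g ≫ 𝟙 Z = h := by
  rw [Category.comp_id, Category.id_comp, e]

/-- A piece with `n + i` strands to its left. -/
theorem powMul_pieceMap (n i : ℕ) (P : Piece) (h : n + (i + P.dom) = n + i + P.dom)
    (h' : n + i + P.cod = n + (i + P.cod)) :
    (powMul ha n (i + P.dom)).hom ≫ powCast ha h ≫ pieceMap ha (n + i) P ≫ powCast ha h' =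
      fundPow ha n ◁ pieceMap ha i P ≫ (powMul ha n (i + P.cod)).hom := by
  cases P with
  | cup => exact comp_ids (cupAt_juxtapose _ (powMul ha n i).hom)
  | cap => exact comp_ids (capAt_juxtapose _ (powMul ha n i).hom)
  | pos => exact comp_ids (crossAt_juxtapose _ _ _ _ (powMul ha n i).hom)
  | neg => exact comp_ids (crossAt_juxtapose _ _ _ _ (powMul ha n i).hom)

theorem powMul_sliceMap_left (n : ℕ) (s : Slice) (h : n + s.dom = (s.shift n 0).dom)
    (h' : (s.shift n 0).cod = n + s.cod) :
    (powMul ha n s.dom).hom ≫ powCast ha h ≫ sliceMap ha (s.shift n 0) ≫ powCast ha h' =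
      fundPow ha n ◁ sliceMap ha s ≫ (powMul ha n s.cod).hom := by
  obtain ⟨i, P, j⟩ := s
  induction j with
  | zero => exact powMul_pieceMap ha n i P h h'
  | succ j ih =>
    have h₀ : n + (i + P.dom + j) = n + i + P.dom + j := by omega
    have h₀' : n + i + P.cod + j = n + (i + P.cod + j) := by omega
    exact juxtapose_left_succ (powCast_whiskerRight ha h₀ _) (powCast_whiskerRight ha h₀' _)
      (ih h₀ h₀')

theorem powMul_stripMap_right (m i : ℕ) (P : Piece) (j : ℕ)
    (h : i + P.dom + j + m = i + P.dom + (j + m))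
    (h' : i + P.cod + (j + m) = i + P.cod + j + m) :
    (powMul ha (i + P.dom + j) m).hom ≫ powCast ha h ≫ stripMap ha i P (j + m) ≫ powCast ha h' =
      stripMap ha i P j ▷ fundPow ha m ≫ (powMul ha (i + P.cod + j) m).hom := by
  induction m with
  | zero =>
    exact comp_ids (rightUnitor_naturality _).symm
  | succ m ih =>
    have h₀ : i + P.dom + j + m = i + P.dom + (j + m) := by omega
    have h₀' : i + P.cod + (j + m) = i + P.cod + j + m := by omega
    exact juxtapose_right_succ (powCast_whiskerRight ha h₀ _) (powCast_whiskerRight ha h₀' _)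
      (ih h₀ h₀')

theorem powMul_sliceMap_right (m : ℕ) (s : Slice) (h : s.dom + m = (s.shift 0 m).dom)
    (h' : (s.shift 0 m).cod = s.cod + m) :
    (powMul ha s.dom m).hom ≫ powCast ha h ≫ sliceMap ha (s.shift 0 m) ≫ powCast ha h' =
      sliceMap ha s ▷ fundPow ha m ≫ (powMul ha s.cod m).hom := by
  obtain ⟨i, P, j⟩ := s
  have e0 : Slice.shift 0 m ⟨i, P, j⟩ = ⟨i, P, j + m⟩ := by simp [Slice.shift]
  rw [sliceMap_congr ha e0 (congrArg _ e0) (congrArg _ e0.symm)]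
  simp only [Category.assoc, powCast_trans, powCast_trans_assoc]
  exact powMul_stripMap_right ha m i P j _ _

theorem powMul_wordMap_left (n : ℕ) {k l : ℕ} (w : List Slice) (h : IsDiagram k w l)
    (h' : IsDiagram (n + k) (w.map (Slice.shift n 0)) (n + l)) :
    (powMul ha n k).hom ≫ wordMap ha _ _ _ h' =
      fundPow ha n ◁ wordMap ha k w l h ≫ (powMul ha n l).hom := by
  induction w generalizing k with
  | nil => exact powMul_powCast_right ha n h h'
  | cons s w ih =>
    obtain ⟨rfl, h2⟩ := h
    have e : n + s.cod = (s.shift n 0).cod := by simp only [Slice.cod, Slice.shift]; omega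
    have := powMul_sliceMap_left ha n s h'.1.symm e.symm
    change _ ≫ powCast ha _ ≫ sliceMap ha _ ≫ wordMap ha _ (w.map _) _ h'.2 =
      _ ◁ (𝟙 _ ≫ sliceMap ha s ≫ wordMap ha _ w _ h2) ≫ _
    have h3 : IsDiagram (n + s.cod) (w.map (Slice.shift n 0)) (n + l) := h'.2.congr e.symm rfl
    have e2 : wordMap ha _ _ _ h'.2 = powCast ha e.symm ≫ wordMap ha _ _ _ h3 := by
      clear this ih
      generalize_proofs q at *
      revert q h3
      generalize (s.shift n 0).cod = z at *
      subst e
      intros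
      exact (Category.id_comp _).symm
    rw [e2, Category.id_comp, MonoidalCategory.whiskerLeft_comp, Category.assoc, ← ih h2 h3]
    simpa using congrArg (fun f => f ≫ wordMap ha _ _ _ h3) this

theorem powMul_wordMap_right (m : ℕ) {k l : ℕ} (w : List Slice) (h : IsDiagram k w l)
    (h' : IsDiagram (k + m) (w.map (Slice.shift 0 m)) (l + m)) :
    (powMul ha k m).hom ≫ wordMap ha _ _ _ h' =
      wordMap ha k w l h ▷ fundPow ha m ≫ (powMul ha l m).hom := by
  induction w generalizing k with
  | nil => exact powMul_powCast_left ha h m h'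
  | cons s w ih =>
    obtain ⟨rfl, h2⟩ := h
    have e : s.cod + m = (s.shift 0 m).cod := by simp only [Slice.cod, Slice.shift]; omega
    have := powMul_sliceMap_right ha m s h'.1.symm e.symm
    change _ ≫ powCast ha _ ≫ sliceMap ha _ ≫ wordMap ha _ (w.map _) _ h'.2 =
      (𝟙 _ ≫ sliceMap ha s ≫ wordMap ha _ w _ h2) ▷ _ ≫ _
    have h3 : IsDiagram (s.cod + m) (w.map (Slice.shift 0 m)) (l + m) := h'.2.congr e.symm rfl
    have e2 : wordMap ha _ _ _ h'.2 = powCast ha e.symm ≫ wordMap ha _ _ _ h3 := by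
      clear this ih
      generalize_proofs q at *
      revert q h3
      generalize (s.shift 0 m).cod = z at *
      subst e
      intros
      exact (Category.id_comp _).symm
    rw [e2, Category.id_comp, comp_whiskerRight, Category.assoc, ← ih h2 h3]
    simpa using congrArg (fun f => f ≫ wordMap ha _ _ _ h3) this

/-- Vertical strands on the left of a diagram act as an identity tensor factor. -/
theorem powMul_diagMap_left (n : ℕ) {k l : ℕ} (D : Diagram k l) :
    (powMul ha n k).hom ≫ diagMap ha (D.whiskerLeft n) =
      fundPow ha n ◁ diagMap ha D ≫ (powMul ha n l).hom := powMul_wordMap_left ha n _ _ _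

/-- Vertical strands on the right of a diagram act as an identity tensor factor. -/
theorem powMul_diagMap_right {k l : ℕ} (D : Diagram k l) (m : ℕ) :
    (powMul ha k m).hom ≫ diagMap ha (D.whiskerRight m) =
      diagMap ha D ▷ fundPow ha m ≫ (powMul ha l m).hom := powMul_wordMap_right ha m _ _ _

end QuantumSL2

namespace QuantumSL2

open TemperleyLieb UqMod
open scoped TensorProduct

variable {a : ℂ} (ha : Admissible a)

/-! ### Invariance under the local relations -/

theorem comp_ids_eq {C : Type*} [Category C] {X Y Y' Z : C} {f : X ⟶ Y} {g : Y ⟶ Z} {f' : X ⟶ Y'}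
    {g' : Y' ⟶ Z} (e : f ≫ g = f' ≫ g') :
    𝟙 X ≫ f ≫ 𝟙 Y ≫ g ≫ 𝟙 Z = 𝟙 X ≫ f' ≫ 𝟙 Y' ≫ g' ≫ 𝟙 Z := by
  simpa using e

theorem id_comp_ids {C : Type*} [Category C] {X Y Z : C} {f : X ⟶ Y} {g : Y ⟶ Z} {h : X ⟶ Z}
    (e : f ≫ g = h) : 𝟙 X ≫ f ≫ 𝟙 Y ≫ g ≫ 𝟙 Z = h := by
  simpa using e

theorem id_comp_id {C : Type*} [Category C] {X Y : C} (f : X ⟶ Y) : 𝟙 X ≫ f ≫ 𝟙 Y = f := by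
  simp

theorem fund_cupAt_left (X : UqMod (a ^ 2)) :
    cupAt (bV ha) X ▷ fund ha ≫ capAt (dV ha) (X ⊗ fund ha) = 𝟙 (X ⊗ fund ha) :=
  cupAt_capAt_left _ _ (zigzag_left ha) X

theorem fund_cupAt_right (X : UqMod (a ^ 2)) :
    cupAt (bV ha) (X ⊗ fund ha) ≫ capAt (dV ha) X ▷ fund ha = 𝟙 (X ⊗ fund ha) :=
  cupAt_capAt_right _ _ (zigzag_right ha) X

/-- Invariance under elementary isotopies. The exchange of heights is the naturality of the upper
piece with respect to the lower one. -/
theorem wordMap_isotopy {w w' : List Slice} (h : Isotopy w w') {k l : ℕ}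
    (hw : IsDiagram k w l) (hw' : IsDiagram k w' l) :
    wordMap ha k w l hw = wordMap ha k w' l hw' := by
  cases h with
  | exchange P Q g =>
    obtain ⟨rfl, h1, rfl⟩ := hw
    cases Q with
    | cup => cases P <;> exact comp_ids_eq (cupAt_naturality (bV ha) (stripMap ha 0 _ g))
    | cap => cases P <;> exact comp_ids_eq (capAt_naturality (dV ha) (stripMap ha 0 _ g))
    | pos => cases P <;>
        exact comp_ids_eq (crossAt_naturality (bV ha) (dV ha) _ _ (stripMap ha 0 _ g))
    | neg => cases P <;>
        exact comp_ids_eq (crossAt_naturality (bV ha) (dV ha) _ _ (stripMap ha 0 _ g))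
  | zigzag_left =>
    obtain ⟨rfl, h1, rfl⟩ := hw
    exact id_comp_ids (fund_cupAt_right ha (fundPow ha 0))
  | zigzag_right =>
    obtain ⟨rfl, h1, rfl⟩ := hw
    exact id_comp_ids (fund_cupAt_left ha (fundPow ha 0))
  | cap_pos =>
    obtain ⟨rfl, h1, rfl⟩ := hw
    exact comp_ids_eq (crossAt_capAt _ _ (fund_cupAt_left ha (fundPow ha 0))
      (fund_cupAt_right ha (fundPow ha 0)) _ _)
  | cap_neg =>
    obtain ⟨rfl, h1, rfl⟩ := hw
    exact comp_ids_eq (crossAt_capAt _ _ (fund_cupAt_left ha (fundPow ha 0))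
      (fund_cupAt_right ha (fundPow ha 0)) _ _)
  | cup_pos =>
    obtain ⟨rfl, h1, rfl⟩ := hw
    exact comp_ids_eq (cupAt_crossAt _ _ (fund_cupAt_left ha (fundPow ha 0))
      (fund_cupAt_right ha (fundPow ha 0)) _ _)
  | cup_neg =>
    obtain ⟨rfl, h1, rfl⟩ := hw
    exact comp_ids_eq (cupAt_crossAt _ _ (fund_cupAt_left ha (fundPow ha 0))
      (fund_cupAt_right ha (fundPow ha 0)) _ _)

/-- The linear extension of `diagMap` to formal combinations of diagrams. -/
def chainMap (k l : ℕ) : Chain k l →ₗ[ℂ] (fundPow ha k ⟶ fundPow ha l) :=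
  Finsupp.linearCombination ℂ (diagMap ha)

theorem chainMap_single {k l : ℕ} (D : Diagram k l) (c : ℂ) :
    chainMap ha k l (Finsupp.single D c) = c • diagMap ha D := Finsupp.linearCombination_single _ _ _

theorem chainMap_eq_zero_of_eq_add {k l : ℕ} {D D₁ D₂ : Diagram k l} {x y : ℂ}
    (h : diagMap ha D = x • diagMap ha D₁ + y • diagMap ha D₂) :
    chainMap ha k l (Finsupp.single D 1 - (Finsupp.single D₁ x + Finsupp.single D₂ y)) = 0 := by
  rw [map_sub, map_add, chainMap_single, chainMap_single, chainMap_single, sub_eq_zero, one_smul, h]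

theorem chainMap_eq_zero_of_eq_smul {k l : ℕ} {D D₁ : Diagram k l} {x : ℂ}
    (h : diagMap ha D = x • diagMap ha D₁) :
    chainMap ha k l (Finsupp.single D 1 - Finsupp.single D₁ x) = 0 := by
  rw [map_sub, chainMap_single, chainMap_single, sub_eq_zero, one_smul, h]

theorem diagMap_cap_cup (h : IsDiagram 2 [⟨0, .cap, 0⟩, ⟨0, .cup, 0⟩] 2) :
    diagMap ha ⟨_, h⟩ = capAt (dV ha) (fundPow ha 0) ≫ cupAt (bV ha) (fundPow ha 0) :=
  id_comp_ids rfl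

theorem chainMap_relator {p p' : ℕ} {r : Chain p p'} (h : Relator a p p' r) :
    chainMap ha p p' r = 0 := by
  cases h with
  | isotopy D D' h =>
    rw [map_sub, chainMap_single, chainMap_single, sub_eq_zero]
    exact congrArg _ (wordMap_isotopy ha h _ _)
  | kauffman_pos =>
    refine chainMap_eq_zero_of_eq_add ha (k := 2) (l := 2)
      ((id_comp_id (crossAt (bV ha) (dV ha) a a⁻¹ (fundPow ha 0))).trans ?_)
    exact congrArg (fun f => a • 𝟙 _ + a⁻¹ • f) (diagMap_cap_cup ha _).symm
  | kauffman_neg =>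
    refine chainMap_eq_zero_of_eq_add ha (k := 2) (l := 2)
      ((id_comp_id (crossAt (bV ha) (dV ha) a⁻¹ a (fundPow ha 0))).trans ?_)
    exact congrArg (fun f => a⁻¹ • 𝟙 _ + a • f) (diagMap_cap_cup ha _).symm
  | circle =>
    refine chainMap_eq_zero_of_eq_smul ha (k := 0) (l := 0) ?_
    have e : cupAt (bV ha) (fundPow ha 0) ≫ capAt (dV ha) (fundPow ha 0) =
        (-(a ^ 2 + (a ^ 2)⁻¹)) • 𝟙 (fundPow ha 0) := by
      rw [cupAt_capAt, bV_dV, MonoidalLinear.whiskerLeft_smul, whiskerLeft_id, Linear.smul_comp,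
        Linear.comp_smul, Category.id_comp, Iso.inv_hom_id]
    exact id_comp_ids e

theorem diagMap_plug {k l p p' : ℕ} (n m : ℕ) (u : Diagram k (n + p + m))
    (v : Diagram (n + p' + m) l) (D : Diagram p p') :
    diagMap ha (Diagram.plug n m u v D) = diagMap ha u ≫
      ((powMul ha (n + p) m).inv ≫ ((powMul ha n p).inv ≫ fundPow ha n ◁ diagMap ha D ≫
        (powMul ha n p').hom) ▷ fundPow ha m ≫ (powMul ha (n + p') m).hom) ≫ diagMap ha v := by
  have e : D.whisker n m = (D.whiskerLeft n).whiskerRight m := by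
    apply Diagram.ext
    simp [Diagram.whisker, Diagram.whiskerLeft, Diagram.whiskerRight, Slice.shift_shift]
  rw [Diagram.plug, diagMap_comp, diagMap_comp, e, ← powMul_diagMap_left, Iso.inv_hom_id_assoc,
    ← powMul_diagMap_right, Iso.inv_hom_id_assoc]

/-- Insertion of a combination of diagrams in a larger diagram is linear on the values, so it maps
relators to zero. -/
theorem chainMap_plug {k l p p' : ℕ} (n m : ℕ) (u : Diagram k (n + p + m))
    (v : Diagram (n + p' + m) l) (r : Chain p p') :
    chainMap ha k l (Finsupp.mapDomain (Diagram.plug n m u v) r) = diagMap ha u ≫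
      ((powMul ha (n + p) m).inv ≫ ((powMul ha n p).inv ≫ fundPow ha n ◁ chainMap ha p p' r ≫
        (powMul ha n p').hom) ▷ fundPow ha m ≫ (powMul ha (n + p') m).hom) ≫ diagMap ha v := by
  induction r using Finsupp.induction_linear with
  | zero => simp
  | add f g hf hg =>
    rw [Finsupp.mapDomain_add, map_add, map_add, hf, hg]
    simp only [MonoidalPreadditive.whiskerLeft_add, Preadditive.comp_add, Preadditive.add_comp,
      MonoidalPreadditive.add_whiskerRight]
  | single D c =>
    rw [Finsupp.mapDomain_single, chainMap_single, chainMap_single, diagMap_plug]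
    simp only [MonoidalLinear.whiskerLeft_smul, Linear.comp_smul, Linear.smul_comp,
      MonoidalLinear.smul_whiskerRight]

/-- The linear map that sends the class of a diagram to its morphism. -/
def skeinMap (k l : ℕ) : Skein a k l →ₗ[ℂ] (fundPow ha k ⟶ fundPow ha l) :=
  Submodule.liftQ (relations a k l) (chainMap ha k l) (Submodule.span_le.2 (by
    rintro x ⟨p, p', n, m, u, v, r, hr, rfl⟩
    change chainMap ha k l _ = 0
    rw [chainMap_plug, chainMap_relator ha hr]
    simp))

theorem skeinMap_mk {k l : ℕ} (D : Diagram k l) : skeinMap ha k l (Skein.mk a D) = diagMap ha D :=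
  (chainMap_single ha D 1).trans (one_smul _ _)

/-! ### The functor `n ↦ V^{⊗ n}` -/

theorem powMul_assoc (n m p : ℕ) (h : n + m + p = n + (m + p)) :
    (powMul ha n m).hom ▷ fundPow ha p ≫ (powMul ha (n + m) p).hom ≫ powCast ha h =
      (α_ _ _ _).hom ≫ fundPow ha n ◁ (powMul ha m p).hom ≫ (powMul ha n (m + p)).hom := by
  induction p with
  | zero =>
    have e {C : Type _} [Category C] [MonoidalCategory C] {A B D : C} (f : A ⊗ B ⟶ D) :
        f ▷ 𝟙_ C ≫ (ρ_ D).hom ≫ 𝟙 D = (α_ A B (𝟙_ C)).hom ≫ A ◁ (ρ_ B).hom ≫ f := by simp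
    exact e _
  | succ p ih =>
    have e {C : Type _} [Category C] [MonoidalCategory C] {A B P D E F G V : C} (f : A ⊗ B ⟶ D)
        (g : D ⊗ P ⟶ E) (c : E ⟶ F) (f' : B ⊗ P ⟶ G) (g' : A ⊗ G ⟶ F) (c₁ : E ⊗ V ⟶ F ⊗ V)
        (hc : c₁ = c ▷ V) (h : f ▷ P ≫ g ≫ c = (α_ A B P).hom ≫ A ◁ f' ≫ g') :
        f ▷ (P ⊗ V) ≫ ((α_ D P V).inv ≫ g ▷ V) ≫ c₁ =
          (α_ A B (P ⊗ V)).hom ≫ A ◁ ((α_ B P V).inv ≫ f' ▷ V) ≫ (α_ A G V).inv ≫ g' ▷ V := by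
      have e := congrArg (fun f => (α_ _ _ _).inv ≫ f ▷ V) h
      simp only [comp_whiskerRight] at e
      simpa [hc] using e
    have h₀ : n + m + p = n + (m + p) := by omega
    exact e _ _ _ _ _ _ (powCast_whiskerRight ha h₀ _) (ih h₀)

theorem powMul_zero_left (n : ℕ) (h : 0 + n = n) :
    (powMul ha 0 n).hom ≫ powCast ha h = (λ_ (fundPow ha n)).hom := by
  induction n with
  | zero =>
    have e {C : Type _} [Category C] [MonoidalCategory C] :
        (ρ_ (𝟙_ C)).hom ≫ 𝟙 _ = (λ_ (𝟙_ C)).hom := by rw [Category.comp_id, unitors_equal]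
    exact e
  | succ n ih =>
    have e {C : Type _} [Category C] [MonoidalCategory C] {A B V : C} (f : 𝟙_ C ⊗ A ⟶ B)
        (c : B ⟶ A) (c₁ : B ⊗ V ⟶ A ⊗ V) (hc : c₁ = c ▷ V) (h : f ≫ c = (λ_ A).hom) :
        ((α_ (𝟙_ C) A V).inv ≫ f ▷ V) ≫ c₁ = (λ_ (A ⊗ V)).hom := by
      rw [hc, Category.assoc, ← comp_whiskerRight, h]
      simp
    have h₀ : 0 + n = n := by omega
    exact e _ _ _ (powCast_whiskerRight ha h₀ _) (ih h₀)

theorem skeinMap_comp {k l m : ℕ} (f : Skein a k l) (g : Skein a l m) :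
    skeinMap ha k m (Skein.comp f g) = skeinMap ha k l f ≫ skeinMap ha l m g := by
  induction f using Skein.induction with
  | hzero => simp
  | hadd x y hx hy => simp only [map_add, LinearMap.add_apply, hx, hy, Preadditive.add_comp]
  | hmk c D =>
    induction g using Skein.induction with
    | hzero => simp
    | hadd x y hx hy => simp only [map_add, hx, hy, Preadditive.comp_add]
    | hmk c' D' =>
      simp only [map_smul, LinearMap.smul_apply, Skein.comp_mk, skeinMap_mk, diagMap_comp,
        Linear.smul_comp, Linear.comp_smul]

theorem powMul_skeinMap_left (n : ℕ) {k l : ℕ} (f : Skein a k l) :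
    fundPow ha n ◁ skeinMap ha k l f ≫ (powMul ha n l).hom =
      (powMul ha n k).hom ≫ skeinMap ha (n + k) (n + l) (Skein.whiskerLeft n f) := by
  induction f using Skein.induction with
  | hzero => simp
  | hadd x y hx hy => simp only [map_add, MonoidalPreadditive.whiskerLeft_add,
      Preadditive.add_comp, Preadditive.comp_add, hx, hy]
  | hmk c D => simp only [map_smul, MonoidalLinear.whiskerLeft_smul, Linear.smul_comp,
      Linear.comp_smul, Skein.whiskerLeft_mk, skeinMap_mk, powMul_diagMap_left]

theorem powMul_skeinMap_right {k l : ℕ} (f : Skein a k l) (m : ℕ) :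
    skeinMap ha k l f ▷ fundPow ha m ≫ (powMul ha l m).hom =
      (powMul ha k m).hom ≫ skeinMap ha (k + m) (l + m) (Skein.whiskerRight m f) := by
  induction f using Skein.induction with
  | hzero => simp
  | hadd x y hx hy => simp only [map_add, MonoidalPreadditive.add_whiskerRight,
      Preadditive.add_comp, Preadditive.comp_add, hx, hy]
  | hmk c D => simp only [map_smul, MonoidalLinear.smul_whiskerRight, Linear.smul_comp,
      Linear.comp_smul, Skein.whiskerRight_mk, skeinMap_mk, powMul_diagMap_right]

/-- The functor from the Temperley-Lieb category to `U_q`-Mod that sends `n` to `V^{⊗ n}`. -/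
def stdFunctor : Obj a ⥤ UqMod (a ^ 2) where
  obj X := fundPow ha X.strands
  map {X Y} f := skeinMap ha X.strands Y.strands f
  map_id _ := skeinMap_mk ha _
  map_comp f g := skeinMap_comp ha f g

theorem stdFunctor_map_ofDiagram {X Y : Obj a} (D : Diagram X.strands Y.strands) :
    (stdFunctor ha).map (ofDiagram D : X ⟶ Y) = diagMap ha D := skeinMap_mk ha D

instance : (stdFunctor ha).Additive where
  map_add {X Y} f g := map_add (skeinMap ha X.strands Y.strands) f g

instance : (stdFunctor ha).Linear ℂ where
  map_smul {X Y} f c := map_smul (skeinMap ha X.strands Y.strands) c f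

/-- The tensor structure of `stdFunctor`. -/
def stdCore : (stdFunctor ha).CoreMonoidal where
  εIso := Iso.refl _
  μIso X Y := powMul ha X.strands Y.strands
  μIso_hom_natural_left f X' := powMul_skeinMap_right ha f X'.strands
  μIso_hom_natural_right X' f := powMul_skeinMap_left ha X'.strands f
  associativity X Y Z :=
    (congrArg (fun f => _ ≫ _ ≫ f) (stdFunctor_map_ofDiagram ha _)).trans
      (powMul_assoc ha X.strands Y.strands Z.strands (Nat.add_assoc _ _ _))
  left_unitality X := by
    refine (powMul_zero_left ha X.strands (Nat.zero_add _)).symm.trans ?_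
    refine Eq.trans ?_ (congrArg (fun f => f ≫ _) (id_whiskerRight _ _).symm)
    refine Eq.trans ?_ (Category.id_comp _).symm
    exact congrArg (fun f => (powMul ha 0 X.strands).hom ≫ f)
      (stdFunctor_map_ofDiagram ha (X := 𝟙_ _ ⊗ X) (Y := X) (Diagram.vert (Nat.zero_add _))).symm
  right_unitality X := by
    refine Eq.trans ?_ (congrArg (fun f => f ≫ _) (MonoidalCategory.whiskerLeft_id _ _).symm)
    refine Eq.trans ?_ (Category.id_comp _).symm
    refine Eq.trans ?_ (congrArg (fun f => _ ≫ f) (stdFunctor_map_ofDiagram ha _).symm)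
    exact (Category.comp_id _).symm

instance : (stdFunctor ha).Monoidal := (stdCore ha).toMonoidal

end QuantumSL2

namespace TemperleyLieb

variable {a : ℂ}

/-! ### The endomorphisms of the unit object of the Temperley-Lieb category -/

namespace Skein

/-- The class of the diagram of a word of slices. -/
def mkWord (a : ℂ) {k l : ℕ} (w : List Slice) (h : IsDiagram k w l) : Skein a k l := mk a ⟨w, h⟩

theorem comp_mkWord {k l m : ℕ} {v w : List Slice} (hv : IsDiagram k v l) (hw : IsDiagram l w m) :
    comp (mkWord a v hv) (mkWord a w hw) = mkWord a (v ++ w) (hv.append hw) := comp_mk _ _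

theorem mkWord_congr {k l : ℕ} {w w' : List Slice} (e : w = w') (h : IsDiagram k w l)
    (h' : IsDiagram k w' l) : mkWord a w h = mkWord a w' h' := by
  subst e; rfl

theorem mk_plug_eq_mkWord {k l p p' : ℕ} (n m : ℕ) (hk : k = n + p + m) (hl : n + p' + m = l)
    (D : Diagram p p') {w : List Slice} (hw : IsDiagram k w l)
    (e : D.1.map (Slice.shift n m) = w) :
    mk a (Diagram.plug n m (Diagram.vert hk) (Diagram.vert hl) D) = mkWord a w hw := by
  subst e
  exact congrArg (mk a) (Diagram.ext (by simp [Diagram.plug, Diagram.comp, Diagram.whisker,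
    Diagram.vert]))

/-- Two diagrams that arise from elementary isotopic diagrams by adding vertical strands are
equal in the skein space. -/
theorem mkWord_eq_of_isotopy {k l p p' : ℕ} (n m : ℕ) {x y w w' : List Slice}
    (hx : IsDiagram p x p') (hy : IsDiagram p y p') (h : Isotopy x y) (hk : k = n + p + m)
    (hl : n + p' + m = l) (e : x.map (Slice.shift n m) = w) (e' : y.map (Slice.shift n m) = w')
    (hw : IsDiagram k w l) (hw' : IsDiagram k w' l) : mkWord a w hw = mkWord a w' hw' :=
  (mk_plug_eq_mkWord n m hk hl ⟨x, hx⟩ hw e).symm.trans ((mk_congr_isotopy (a := a)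
    (Diagram.vert hk) (Diagram.vert hl) ⟨x, hx⟩ ⟨y, hy⟩ h).trans
    (mk_plug_eq_mkWord n m hk hl ⟨y, hy⟩ hw' e'))

theorem mk_plug_eq {k l p p' : ℕ} (n m : ℕ) (u : Diagram k (n + p + m))
    (v : Diagram (n + p' + m) l) {D D₁ D₂ : Diagram p p'} {x y : ℂ} (h : Relator a p p'
      (Finsupp.single D 1 - (Finsupp.single D₁ x + Finsupp.single D₂ y))) :
    mk a (Diagram.plug n m u v D) =
      x • mk a (Diagram.plug n m u v D₁) + y • mk a (Diagram.plug n m u v D₂) := by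
  have := mkL_eq_zero (a := a) (Submodule.subset_span ⟨p, p', n, m, u, v, _, h, rfl⟩)
  rw [← Finsupp.lmapDomain_apply ℂ ℂ, map_sub, map_sub, sub_eq_zero, map_add, map_add] at this
  simp only [Finsupp.lmapDomain_apply, Finsupp.mapDomain_single] at this
  rw [mk, this, mk, mk, ← map_smul, ← map_smul, Finsupp.smul_single', Finsupp.smul_single',
    mul_one, mul_one]

theorem mk_plug_eq_smul {k l p p' : ℕ} (n m : ℕ) (u : Diagram k (n + p + m))
    (v : Diagram (n + p' + m) l) {D D₁ : Diagram p p'} {x : ℂ} (h : Relator a p p'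
      (Finsupp.single D 1 - Finsupp.single D₁ x)) :
    mk a (Diagram.plug n m u v D) = x • mk a (Diagram.plug n m u v D₁) := by
  have := mkL_eq_zero (a := a) (Submodule.subset_span ⟨p, p', n, m, u, v, _, h, rfl⟩)
  rw [← Finsupp.lmapDomain_apply ℂ ℂ, map_sub, map_sub, sub_eq_zero] at this
  simp only [Finsupp.lmapDomain_apply, Finsupp.mapDomain_single] at this
  rw [mk, this, mk, ← map_smul, Finsupp.smul_single', mul_one]

theorem mkWord_pos (i j : ℕ) {k l : ℕ} (h : IsDiagram k [⟨i, .pos, j⟩] l)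
    (h₂ : IsDiagram k [⟨i, .cap, j⟩, ⟨i, .cup, j⟩] l) (h₁ : IsDiagram k [] l) :
    mkWord a _ h = a • mkWord a [] h₁ + a⁻¹ • mkWord a _ h₂ := by
  obtain ⟨rfl, rfl⟩ := h
  have := mk_plug_eq (a := a) i j (Diagram.vert rfl) (Diagram.vert rfl) Relator.kauffman_pos
  exact (mk_plug_eq_mkWord i j rfl rfl (p := 2) (p' := 2) _
    (w := [⟨i, .pos, j⟩]) _ (by simp [Slice.shift])).symm.trans
    (this.trans (congrArg₂ (fun u v => a • u + a⁻¹ • v)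
      (mk_plug_eq_mkWord i j rfl rfl (p := 2) (p' := 2) _ h₁ rfl)
      (mk_plug_eq_mkWord i j rfl rfl (p := 2) (p' := 2) _ h₂ (by simp [Slice.shift]))))

theorem mkWord_neg (i j : ℕ) {k l : ℕ} (h : IsDiagram k [⟨i, .neg, j⟩] l)
    (h₂ : IsDiagram k [⟨i, .cap, j⟩, ⟨i, .cup, j⟩] l) (h₁ : IsDiagram k [] l) :
    mkWord a _ h = a⁻¹ • mkWord a [] h₁ + a • mkWord a _ h₂ := by
  obtain ⟨rfl, rfl⟩ := h
  have := mk_plug_eq (a := a) i j (Diagram.vert rfl) (Diagram.vert rfl) Relator.kauffman_neg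
  exact (mk_plug_eq_mkWord i j rfl rfl (p := 2) (p' := 2) _
    (w := [⟨i, .neg, j⟩]) _ (by simp [Slice.shift])).symm.trans
    (this.trans (congrArg₂ (fun u v => a⁻¹ • u + a • v)
      (mk_plug_eq_mkWord i j rfl rfl (p := 2) (p' := 2) _ h₁ rfl)
      (mk_plug_eq_mkWord i j rfl rfl (p := 2) (p' := 2) _ h₂ (by simp [Slice.shift]))))

theorem mkWord_circle (i j : ℕ) {k l : ℕ} (h : IsDiagram k [⟨i, .cup, j⟩, ⟨i, .cap, j⟩] l)
    (h₁ : IsDiagram k [] l) :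
    mkWord a _ h = (-(a ^ 2 + (a ^ 2)⁻¹)) • mkWord a [] h₁ := by
  obtain ⟨rfl, -, rfl⟩ := h
  have := mk_plug_eq_smul (a := a) i j (Diagram.vert rfl) (Diagram.vert rfl) Relator.circle
  exact (mk_plug_eq_mkWord i j rfl rfl (p := 0) (p' := 0) _ _
    (by simp [Slice.shift])).symm.trans (this.trans (congrArg _
      (mk_plug_eq_mkWord i j rfl rfl (p := 0) (p' := 0) _ h₁ rfl)))

/-- The exchange of two pieces with `g` strands between them. -/
theorem mkWord_exchange (P Q : Piece) (i g j : ℕ) {k l : ℕ} {x y x' y' : ℕ}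
    (hx : x = g + Q.dom + j) (hy : y = i + P.cod + g) (hx' : x' = i + P.dom + g)
    (hy' : y' = g + Q.cod + j)
    (h : IsDiagram k [⟨i, P, x⟩, ⟨y, Q, j⟩] l) (h' : IsDiagram k [⟨x', Q, j⟩, ⟨i, P, y'⟩] l) :
    mkWord a _ h = mkWord a _ h' := by
  subst hx hy hx' hy'
  have hk := h.1
  have hl := h.2.2
  simp only [Slice.dom, Slice.cod, IsDiagram] at hk hl
  exact mkWord_eq_of_isotopy i j (p := P.dom + g + Q.dom) (p' := P.cod + g + Q.cod)
    (by refine ⟨?_, ?_, ?_⟩ <;> simp only [Slice.dom, Slice.cod, IsDiagram] <;> omega)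
    (by refine ⟨?_, ?_, ?_⟩ <;> simp only [Slice.dom, Slice.cod, IsDiagram] <;> omega)
    (.exchange P Q g) (by omega) (by omega) (by simp [Slice.shift]; omega)
    (by simp [Slice.shift]; omega) _ _

theorem _root_.TemperleyLieb.IsDiagram.of_append {k m : ℕ} {v w : List Slice}
    (h : IsDiagram k (v ++ w) m) : ∃ l, IsDiagram k v l ∧ IsDiagram l w m := by
  induction v generalizing k with
  | nil => exact ⟨k, rfl, h⟩
  | cons s v ih =>
    obtain ⟨l, h1, h2⟩ := ih h.2
    exact ⟨l, ⟨h.1, h1⟩, h2⟩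

/-- The space spanned by the diagrams from `0` to `k` that are composed of cups. -/
def cupSpan (a : ℂ) (k : ℕ) : Submodule ℂ (Skein a 0 k) :=
  Submodule.span ℂ {x | ∃ (w : List Slice) (h : IsDiagram 0 w k),
    (∀ s ∈ w, s.piece = .cup) ∧ x = mkWord a w h}

/-- Composition with `g` maps diagrams composed of cups to combinations of such diagrams. -/
def PreservesCups {k l : ℕ} (g : Skein a k l) : Prop :=
  ∀ x ∈ cupSpan a k, comp x g ∈ cupSpan a l

theorem PreservesCups.of_mkWord {k l : ℕ} {g : Skein a k l}
    (h : ∀ (w : List Slice) (hw : IsDiagram 0 w k), (∀ s ∈ w, s.piece = .cup) →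
      comp (mkWord a w hw) g ∈ cupSpan a l) :
    PreservesCups g := by
  intro x hx
  induction hx using Submodule.span_induction with
  | mem x hx =>
    obtain ⟨w, hw, hD, rfl⟩ := hx
    exact h w hw hD
  | zero => rw [map_zero, LinearMap.zero_apply]; exact zero_mem _
  | add x y _ _ hx hy => rw [map_add, LinearMap.add_apply]; exact add_mem hx hy
  | smul c x _ hx => rw [map_smul, LinearMap.smul_apply]; exact Submodule.smul_mem _ _ hx

theorem PreservesCups.add {k l : ℕ} {g g' : Skein a k l} (h : PreservesCups g)
    (h' : PreservesCups g') : PreservesCups (g + g') := fun x hx => by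
  rw [map_add]; exact add_mem (h x hx) (h' x hx)

theorem PreservesCups.smul {k l : ℕ} {g : Skein a k l} (h : PreservesCups g) (c : ℂ) :
    PreservesCups (c • g) := fun x hx => by
  rw [map_smul]; exact Submodule.smul_mem _ _ (h x hx)

theorem PreservesCups.append {k l m : ℕ} {v w : List Slice} {hv : IsDiagram k v l}
    {hw : IsDiagram l w m} (h : PreservesCups (mkWord a v hv)) (h' : PreservesCups (mkWord a w hw))
    (hvw : IsDiagram k (v ++ w) m) : PreservesCups (mkWord a (v ++ w) hvw) := by
  refine .of_mkWord fun u hu hu' => ?_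
  rw [comp_mkWord, mkWord_congr (List.append_assoc u v w).symm _ ((hu.append hv).append hw),
    ← comp_mkWord (hu.append hv) hw, ← comp_mkWord hu hv]
  exact h' _ (h _ (Submodule.subset_span ⟨u, hu, hu', rfl⟩))

theorem preservesCups_nil {k l : ℕ} (h : IsDiagram k [] l) : PreservesCups (mkWord a [] h) := by
  have e : k = l := h
  subst e
  refine .of_mkWord fun w hw hw' => ?_
  rw [comp_mkWord]
  exact Submodule.subset_span ⟨w, hw, hw', mkWord_congr (List.append_nil _) _ _⟩

theorem preservesCups_cup (i j : ℕ) {k l : ℕ} (h : IsDiagram k [⟨i, .cup, j⟩] l) :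
    PreservesCups (mkWord a _ h) := by
  refine .of_mkWord fun w hw hw' => ?_
  rw [comp_mkWord]
  refine Submodule.subset_span ⟨_, _, ?_, rfl⟩
  intro s hs
  rcases List.mem_append.1 hs with hs | hs
  · exact hw' s hs
  · rw [List.mem_singleton.1 hs]

/-- A cap that follows cups can be moved down to the first cup that it meets, where it cancels
with this cup or closes a circle. -/
theorem mkWord_cups_cap (w : List Slice) (hw : ∀ s ∈ w, s.piece = .cup) (i j : ℕ) {k l : ℕ}
    (h : IsDiagram 0 w k) (h' : IsDiagram k [⟨i, .cap, j⟩] l) :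
    comp (mkWord a w h) (mkWord a _ h') ∈ cupSpan a l := by
  induction w using List.reverseRecOn generalizing i j k l with
  | nil =>
    obtain rfl : 0 = k := h
    have := h'.1
    simp only [Slice.dom, Piece.dom] at this
    omega
  | append_singleton w s ih =>
    have hw' : ∀ s ∈ w, s.piece = .cup := fun s hs => hw s (List.mem_append_left _ hs)
    obtain ⟨i', P, j'⟩ := s
    obtain rfl : P = .cup := hw ⟨i', P, j'⟩ (List.mem_append_right _ (List.mem_singleton_self _))
    obtain ⟨m, hm, hs⟩ := h.of_append
    have hmem : mkWord a w hm ∈ cupSpan a m := Submodule.subset_span ⟨_, _, hw', rfl⟩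
    have hsc : IsDiagram m [⟨i', .cup, j'⟩, ⟨i, .cap, j⟩] l := hs.append h'
    rw [comp_mkWord, mkWord_congr (w' := w ++ [_, _]) (List.append_assoc w [_] [_]) _
        (hm.append hsc),
      ← comp_mkWord hm hsc]
    have e1 : i' + j' = m := hs.1
    have e2 : i' + 2 + j' = k := hs.2
    have e3 : i + 2 + j = k := h'.1
    have e4 : i + j = l := h'.2
    -- The cap is moved below the cup, after which the induction hypothesis applies.
    have key : ∀ {i₁ j₁ i₂ j₂ : ℕ} (d : IsDiagram m [⟨i₁, .cap, j₁⟩, ⟨i₂, .cup, j₂⟩] l),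
        comp (mkWord a w hm) (mkWord a _ d) ∈ cupSpan a l := by
      intro i₁ j₁ i₂ j₂ d
      have d₁ : IsDiagram m [⟨i₁, .cap, j₁⟩] (Slice.cod ⟨i₁, .cap, j₁⟩) := ⟨d.1, rfl⟩
      rw [comp_mkWord, mkWord_congr (w := w ++ [_, _]) (List.append_assoc w [_] [_]).symm _
        ((hm.append d₁).append d.2),
        ← comp_mkWord (hm.append d₁) d.2, ← comp_mkWord hm d₁]
      exact preservesCups_cup _ _ d.2 _ (ih hw' _ _ hm d₁)
    rcases lt_trichotomy i i' with hlt | rfl | hlt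
    · obtain rfl | ⟨g, rfl⟩ : i' = i + 1 ∨ ∃ g, i' = i + 2 + g := by
        rcases Nat.lt_or_ge (i + 1) i' with h | h
        · exact .inr ⟨i' - (i + 2), by omega⟩
        · exact .inl (by omega)
      · rw [mkWord_eq_of_isotopy i j' (p := 1) (p' := 1)
          (x := [⟨1, .cup, 0⟩, ⟨0, .cap, 1⟩]) (y := []) ⟨rfl, rfl, rfl⟩ rfl .zigzag_left (by omega) (by omega)
          (by simp [Slice.shift]; omega) rfl _ (show m = l by omega)]
        exact preservesCups_nil _ _ hmem
      · have d : IsDiagram m [⟨i, .cap, g + j'⟩, ⟨i + g, .cup, j'⟩] l := by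
          refine ⟨?_, ?_, ?_⟩ <;>
            simp only [Slice.dom, Slice.cod, Piece.dom, Piece.cod, IsDiagram] <;> omega
        have e : mkWord a _ d = mkWord a _ hsc := mkWord_exchange .cap .cup i g j' rfl rfl rfl
          (by simp only [Piece.cod]; omega) d hsc
        rw [← e]
        exact key d
    · obtain rfl : j' = j := by omega
      rw [mkWord_circle i j' hsc (show m = l by omega), map_smul]
      exact Submodule.smul_mem _ _ (preservesCups_nil _ _ hmem)
    · obtain rfl | ⟨g, rfl⟩ : i = i' + 1 ∨ ∃ g, i = i' + 2 + g := by
        rcases Nat.lt_or_ge (i' + 1) i with h | h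
        · exact .inr ⟨i - (i' + 2), by omega⟩
        · exact .inl (by omega)
      · rw [mkWord_eq_of_isotopy i' j (p := 1) (p' := 1)
          (x := [⟨0, .cup, 1⟩, ⟨1, .cap, 0⟩]) (y := []) ⟨rfl, rfl, rfl⟩ rfl .zigzag_right (by omega) (by omega)
          (by simp [Slice.shift]; omega) rfl _ (show m = l by omega)]
        exact preservesCups_nil _ _ hmem
      · have d : IsDiagram m [⟨i' + g, .cap, j⟩, ⟨i', .cup, g + j⟩] l := by
          refine ⟨?_, ?_, ?_⟩ <;>
            simp only [Slice.dom, Slice.cod, Piece.dom, Piece.cod, IsDiagram] <;> omega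
        have e : mkWord a _ hsc = mkWord a _ d := mkWord_exchange .cup .cap i' g j
          (by simp only [Piece.dom]; omega) rfl rfl
          (by simp only [Piece.cod]; omega) hsc d
        rw [e]
        exact key d

/-- Every slice preserves the span of the cup diagrams; a crossing does by Kauffman's relation. -/
theorem preservesCups_slice (s : Slice) {k l : ℕ} (h : IsDiagram k [s] l) :
    PreservesCups (mkWord a [s] h) := by
  obtain ⟨i, P, j⟩ := s
  have hcap : ∀ {k l : ℕ} (h : IsDiagram k [⟨i, .cap, j⟩] l), PreservesCups (mkWord a _ h) :=
    fun h => .of_mkWord fun w hw hw' => mkWord_cups_cap w hw' i j hw h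
  have hcapcup : ∀ {k l : ℕ} (h : IsDiagram k ([⟨i, .cap, j⟩] ++ [⟨i, .cup, j⟩]) l),
      PreservesCups (mkWord a _ h) := by
    intro k l h
    obtain ⟨m, h₁, h₂⟩ := h.of_append
    exact (hcap h₁).append (preservesCups_cup _ _ h₂) h
  cases P with
  | cup => exact preservesCups_cup i j h
  | cap => exact hcap h
  | pos =>
    rw [mkWord_pos i j h ⟨h.1, rfl, h.2⟩ (h.1.symm.trans h.2)]
    exact ((preservesCups_nil _).smul _).add ((hcapcup _).smul _)
  | neg =>
    rw [mkWord_neg i j h ⟨h.1, rfl, h.2⟩ (h.1.symm.trans h.2)]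
    exact ((preservesCups_nil _).smul _).add ((hcapcup _).smul _)

theorem preservesCups_word (w : List Slice) {k l : ℕ} (h : IsDiagram k w l) :
    PreservesCups (mkWord a w h) := by
  induction w generalizing k with
  | nil => exact preservesCups_nil h
  | cons s w ih => exact (preservesCups_slice s ⟨h.1, rfl⟩).append (ih h.2) h

theorem cupSpan_eq_top (k : ℕ) : cupSpan a k = ⊤ := by
  refine eq_top_iff.2 fun x _ => ?_
  induction x using Skein.induction with
  | hzero => exact zero_mem _
  | hadd x y hx hy => exact add_mem (hx trivial) (hy trivial)
  | hmk c D =>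
    refine Submodule.smul_mem _ _ ?_
    have h₀ : IsDiagram 0 [] 0 := rfl
    have h := preservesCups_word D.1 D.2 (mkWord a [] h₀)
      (Submodule.subset_span ⟨[], h₀, by simp, rfl⟩)
    rwa [comp_mkWord] at h

theorem _root_.TemperleyLieb.IsDiagram.eq_add_of_cups {k l : ℕ} {w : List Slice}
    (h : IsDiagram k w l) (hw : ∀ s ∈ w, s.piece = .cup) : l = k + 2 * w.length := by
  induction w generalizing k with
  | nil => exact (show k = l from h).symm
  | cons s w ih =>
    have e := ih h.2 fun t ht => hw t (List.mem_cons_of_mem _ ht)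
    have e1 := h.1
    simp only [Slice.dom, Slice.cod, hw s List.mem_cons_self, Piece.dom, Piece.cod] at e e1
    rw [List.length_cons]
    omega

/-- The space of closed diagrams is spanned by the empty diagram. -/
theorem exists_eq_smul (x : Skein a 0 0) : ∃ c : ℂ, x = c • mk a (Diagram.vert rfl) := by
  have hx : x ∈ cupSpan a 0 := cupSpan_eq_top (a := a) 0 ▸ Submodule.mem_top
  induction hx using Submodule.span_induction with
  | mem x hx =>
    obtain ⟨w, h, hw, rfl⟩ := hx
    have := h.eq_add_of_cups hw
    obtain rfl : w = [] := List.eq_nil_of_length_eq_zero (by omega)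
    exact ⟨1, (one_smul _ _).symm⟩
  | zero => exact ⟨0, (zero_smul _ _).symm⟩
  | add x y _ _ hx hy =>
    obtain ⟨c, rfl⟩ := hx
    obtain ⟨d, rfl⟩ := hy
    exact ⟨c + d, (add_smul _ _ _).symm⟩
  | smul c x _ hx =>
    obtain ⟨d, rfl⟩ := hx
    exact ⟨c * d, smul_smul _ _ _⟩

end Skein

end TemperleyLieb

namespace QuantumSL2

open TemperleyLieb UqMod
open scoped TensorProduct
open Functor.LaxMonoidal Functor.OplaxMonoidal Functor.Monoidal

variable {a : ℂ} {ha : Admissible a}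

/-! ### Existence of the functor -/

theorem stdFunctor_map_smul_id (ha : Admissible a) (c : ℂ) :
    (stdFunctor ha).map (c • 𝟙 (𝟙_ (Obj a))) = c • 𝟙 (fundPow ha 0) :=
  (Functor.map_smul _ _ _).trans (congrArg (fun f => c • f) ((stdFunctor ha).map_id _))

theorem std_end_bijective (ha : Admissible a) :
    Function.Bijective fun f : 𝟙_ (Obj a) ⟶ 𝟙_ (Obj a) => (stdFunctor ha).map f := by
  constructor
  · intro f g h
    obtain ⟨c, hc⟩ : ∃ c : ℂ, f = c • 𝟙 (𝟙_ (Obj a)) := Skein.exists_eq_smul f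
    obtain ⟨c', hc'⟩ : ∃ c : ℂ, g = c • 𝟙 (𝟙_ (Obj a)) := Skein.exists_eq_smul g
    subst hc hc'
    have h' := (stdFunctor_map_smul_id ha c).symm.trans (h.trans (stdFunctor_map_smul_id ha c'))
    have e : c • (1 : ℂ) = c' • (1 : ℂ) := LinearMap.congr_fun (congrArg toLin h') (1 : ℂ)
    simp only [smul_eq_mul, mul_one] at e
    rw [e]
  · intro f
    refine ⟨(show ℂ from toLin f (1 : ℂ)) • 𝟙 _, (stdFunctor_map_smul_id ha _).trans (hom_ext ?_)⟩
    exact LinearMap.ext_ring (mul_one (show ℂ from toLin f (1 : ℂ)))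

/-- `cupAt b` at the unit object is `b`, up to the unitors that occur in `V^{⊗ 1} ⊗ V^{⊗ 1} ≅ V^{⊗ 2}`. -/
theorem cupAt_unit {C : Type*} [Category C] [MonoidalCategory C] {V : C} (b : 𝟙_ C ⟶ V ⊗ V) :
    𝟙 (𝟙_ C) ≫ cupAt b (𝟙_ C) ≫
      ((α_ (𝟙_ C ⊗ V) (𝟙_ C) V).symm ≪≫ whiskerRightIso (ρ_ (𝟙_ C ⊗ V)) V).inv ≫
      ((λ_ V).hom ⊗ₘ (λ_ V).hom) = b := by
  simp only [cupAt, Iso.trans_inv, Iso.symm_inv, whiskerRightIso_inv]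
  monoidal

/-- `capAt d` at the unit object is `d`, up to the same unitors. -/
theorem capAt_unit {C : Type*} [Category C] [MonoidalCategory C] {V : C} (d : V ⊗ V ⟶ 𝟙_ C) :
    ((λ_ V).inv ⊗ₘ (λ_ V).inv) ≫
      ((α_ (𝟙_ C ⊗ V) (𝟙_ C) V).symm ≪≫ whiskerRightIso (ρ_ (𝟙_ C ⊗ V)) V).hom ≫
      capAt d (𝟙_ C) ≫ 𝟙 (𝟙_ C) = d := by
  simp only [capAt, Iso.trans_hom, Iso.symm_hom, whiskerRightIso_hom]
  monoidal

theorem stdFunctor_map_cup (ha : Admissible a) :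
    (stdFunctor ha).map (cup a) = cupAt (bV ha) (fundPow ha 0) :=
  (stdFunctor_map_ofDiagram ha _).trans (id_comp_id _)

theorem stdFunctor_map_cap (ha : Admissible a) :
    (stdFunctor ha).map (cap a) = capAt (dV ha) (fundPow ha 0) :=
  (stdFunctor_map_ofDiagram ha _).trans (id_comp_id _)

/-- The functor `n ↦ V^{⊗ n}` with the identification `1 ⊗ V ≅ V`. -/
def stdTensorFunctor (ha : Admissible a) : TensorFunctor ha where
  functor := stdFunctor ha
  end_bijective := std_end_bijective ha
  objOne := λ_ (fund ha)
  map_cup := (congrArg (fun f => 𝟙 (fundPow ha 0) ≫ f ≫ (powMul ha 1 1).inv ≫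
    ((λ_ (fund ha)).hom ⊗ₘ (λ_ (fund ha)).hom)) (stdFunctor_map_cup ha)).trans (cupAt_unit (bV ha))
  map_cap := (congrArg (fun f => ((λ_ (fund ha)).inv ⊗ₘ (λ_ (fund ha)).inv) ≫
    (powMul ha 1 1).hom ≫ f ≫ 𝟙 (fundPow ha 0)) (stdFunctor_map_cap ha)).trans (capAt_unit (dV ha))

/-! ### Comparison of a functor with the standard one -/

/-- Associativity of the juxtaposition, transported along isomorphisms of the factors. -/
theorem juxtapose_transport {C : Type*} [Category C] [MonoidalCategory C]
    {A B D AB BD ABD A' B' V AB' : C} {m₁ : A ⊗ B ⟶ AB} {m₂ : AB ⊗ D ⟶ ABD} {e₂ : ABD ⟶ AB ⊗ D}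
    {m₃ : B ⊗ D ⟶ BD} {e₃ : BD ⟶ B ⊗ D} {m₄ : A ⊗ BD ⟶ ABD} {o₁ : A ⟶ A'} {o₂ : B ⟶ B'}
    {o₃ : D ⟶ V} {o : AB ⟶ AB'} {p : A' ⊗ B' ⟶ AB'} (h₂ : m₂ ≫ e₂ = 𝟙 _) (h₃ : e₃ ≫ m₃ = 𝟙 _)
    (h : m₁ ▷ D ≫ m₂ = (α_ A B D).hom ≫ A ◁ m₃ ≫ m₄) (ih : m₁ ≫ o = (o₁ ⊗ₘ o₂) ≫ p) :
    m₄ ≫ e₂ ≫ (o ⊗ₘ o₃) =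
      (o₁ ⊗ₘ (e₃ ≫ (o₂ ⊗ₘ o₃))) ≫ (α_ A' B' V).inv ≫ p ▷ V := by
  have e : m₄ = A ◁ e₃ ≫ (α_ A B D).inv ≫ m₁ ▷ D ≫ m₂ := by
    rw [h, Iso.inv_hom_id_assoc, ← MonoidalCategory.whiskerLeft_comp_assoc, h₃]
    simp
  rw [e]
  simp only [Category.assoc, reassoc_of% h₂]
  have e' : m₁ ▷ D ≫ (o ⊗ₘ o₃) = ((o₁ ⊗ₘ o₂) ⊗ₘ o₃) ≫ p ▷ V := by
    rw [whiskerRight_comp_tensorHom, ih, ← tensorHom_comp_whiskerRight]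
  rw [e', ← associator_inv_naturality_assoc, whiskerLeft_comp_tensorHom_assoc]

namespace TensorFunctor

/-- The identifications `F(n) ≅ V^{⊗ n}` are compatible with juxtaposition. -/
theorem μ_objIso (F : TensorFunctor ha) (n m : ℕ) :
    μ F.functor ⟨n⟩ ⟨m⟩ ≫ (F.objIso (n + m)).hom =
      ((F.objIso n).hom ⊗ₘ (F.objIso m).hom) ≫ (powMul ha n m).hom := by
  induction m with
  | zero =>
    have h : (ρ_ (F.functor.obj ⟨n⟩)).hom = F.functor.obj ⟨n⟩ ◁ ε F.functor ≫
        μ F.functor ⟨n⟩ ⟨0⟩ := by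
      refine (Functor.LaxMonoidal.right_unitality F.functor ⟨n⟩).trans ?_
      exact congrArg (fun f => _ ≫ f)
        ((congrArg (fun f => _ ≫ f) (F.functor.map_id ⟨n⟩)).trans (Category.comp_id _))
    have e {C : Type _} [Category C] [MonoidalCategory C] {A U A' : C} {m : A ⊗ U ⟶ A}
        {u : 𝟙_ C ⟶ U} {v : U ⟶ 𝟙_ C} {o : A ⟶ A'} (huv : v ≫ u = 𝟙 _)
        (h : (ρ_ A).hom = A ◁ u ≫ m) : m ≫ o = (o ⊗ₘ v) ≫ (ρ_ A').hom := by
      have : m = A ◁ v ≫ (ρ_ A).hom := by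
        rw [h, ← MonoidalCategory.whiskerLeft_comp_assoc, huv]
        simp
      rw [this, MonoidalCategory.tensorHom_def']
      simp
    exact e (Functor.Monoidal.η_ε F.functor) h
  | succ m ih =>
    have h : μ F.functor ⟨n⟩ ⟨m⟩ ▷ F.functor.obj ⟨1⟩ ≫ μ F.functor ⟨n + m⟩ ⟨1⟩ =
        (α_ _ _ _).hom ≫ F.functor.obj ⟨n⟩ ◁ μ F.functor ⟨m⟩ ⟨1⟩ ≫
          μ F.functor ⟨n⟩ ⟨m + 1⟩ := by
      refine Eq.trans ?_ (associativity F.functor ⟨n⟩ ⟨m⟩ ⟨1⟩)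
      exact congrArg (fun f => _ ≫ f) ((Category.comp_id _).symm.trans
        (congrArg (fun f => _ ≫ f) (F.functor.map_id ⟨n + m + 1⟩).symm))
    exact juxtapose_transport (μ_δ F.functor ⟨n + m⟩ ⟨1⟩) (δ_μ F.functor ⟨m⟩ ⟨1⟩) h ih

theorem tensorIso_hom_powMul (F : TensorFunctor ha) (n m : ℕ) :
    (F.tensorIso n m).hom ≫ (powMul ha n m).hom = (F.objIso (n + m)).hom := by
  change (δ F.functor ⟨n⟩ ⟨m⟩ ≫ ((F.objIso n).hom ⊗ₘ (F.objIso m).hom)) ≫ (powMul ha n m).hom = _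
  rw [Category.assoc, ← μ_objIso]
  exact (δ_μ_assoc F.functor _ _ _)

theorem objIso_one (F : TensorFunctor ha) :
    (F.objIso 1).hom = F.objOne.hom ≫ (λ_ (fund ha)).inv := by
  change δ F.functor ⟨0⟩ ⟨1⟩ ≫ (η F.functor ⊗ₘ F.objOne.hom) = _
  have h : (λ_ (F.functor.obj ⟨1⟩)).inv = δ F.functor ⟨0⟩ ⟨1⟩ ≫ η F.functor ▷ _ := by
    refine (Functor.OplaxMonoidal.left_unitality F.functor ⟨1⟩).trans ?_
    exact (congrArg (fun f => f ≫ _) (F.functor.map_id ⟨1⟩)).trans (Category.id_comp _)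
  rw [MonoidalCategory.tensorHom_def]
  have := congrArg (fun f => f ≫ 𝟙_ _ ◁ F.objOne.hom) h
  simp only [leftUnitor_inv_naturality] at this ⊢
  exact (this.trans (Category.assoc _ _ _)).symm

/-- The identification of `F(X)` with the value of the standard functor. -/
def compIso (F : TensorFunctor ha) (X : Obj a) : F.functor.obj X ≅ (stdFunctor ha).obj X :=
  F.objIso X.strands

theorem μ_compIso (F : TensorFunctor ha) (X Y : Obj a) :
    μ F.functor X Y ≫ (F.compIso (X ⊗ Y)).hom =
      ((F.compIso X).hom ⊗ₘ (F.compIso Y).hom) ≫ μ (stdFunctor ha) X Y :=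
  F.μ_objIso X.strands Y.strands

theorem ε_compIso (F : TensorFunctor ha) :
    ε F.functor ≫ (F.compIso (𝟙_ _)).hom = ε (stdFunctor ha) :=
  Functor.Monoidal.ε_η F.functor

end TensorFunctor

section Intertwines

variable {C D : Type*} [Category C] [Category D] {F G : C ⥤ D} (o : ∀ X, F.obj X ≅ G.obj X)

/-- The family of isomorphisms `o` is natural with respect to `f`. -/
def Intertwines {X Y : C} (f : X ⟶ Y) : Prop :=
  F.map f ≫ (o Y).hom = (o X).hom ≫ G.map f

variable {o}

theorem Intertwines.id (X : C) : Intertwines o (𝟙 X) := by simp [Intertwines]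

theorem Intertwines.comp {X Y Z : C} {f : X ⟶ Y} {g : Y ⟶ Z} (hf : Intertwines o f)
    (hg : Intertwines o g) : Intertwines o (f ≫ g) := by
  unfold Intertwines at *
  rw [Functor.map_comp, Category.assoc, hg, reassoc_of% hf, Functor.map_comp]

theorem Intertwines.whiskerLeft [MonoidalCategory C] [MonoidalCategory D] [F.Monoidal] [G.Monoidal]
    (hμ : ∀ X Y, μ F X Y ≫ (o (X ⊗ Y)).hom = ((o X).hom ⊗ₘ (o Y).hom) ≫ μ G X Y) {Y Z : C}
    {f : Y ⟶ Z} (hf : Intertwines o f) (X : C) :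
    Intertwines o (X ◁ f) := by
  unfold Intertwines at *
  rw [← cancel_epi (μ F X Y), ← reassoc_of% μ_natural_right F X f, hμ, reassoc_of% hμ X Y,
    ← μ_natural_right, MonoidalCategory.tensorHom_def, MonoidalCategory.tensorHom_def]
  simp only [Category.assoc]
  rw [whisker_exchange_assoc, ← MonoidalCategory.whiskerLeft_comp_assoc, hf]
  simp

theorem Intertwines.whiskerRight [MonoidalCategory C] [MonoidalCategory D] [F.Monoidal] [G.Monoidal]
    (hμ : ∀ X Y, μ F X Y ≫ (o (X ⊗ Y)).hom = ((o X).hom ⊗ₘ (o Y).hom) ≫ μ G X Y) {Y Z : C}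
    {f : Y ⟶ Z} (hf : Intertwines o f) (X : C) :
    Intertwines o (f ▷ X) := by
  unfold Intertwines at *
  rw [← cancel_epi (μ F Y X), ← reassoc_of% μ_natural_left F f X, hμ, reassoc_of% hμ Y X,
    ← μ_natural_left, MonoidalCategory.tensorHom_def, MonoidalCategory.tensorHom_def]
  simp only [Category.assoc]
  rw [← comp_whiskerRight_assoc, hf, whisker_exchange_assoc]
  simp

variable [Preadditive C] [Preadditive D]

theorem Intertwines.zero [F.Additive] [G.Additive] (X Y : C) : Intertwines o (0 : X ⟶ Y) := by simp [Intertwines]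

theorem Intertwines.add [F.Additive] [G.Additive] {X Y : C} {f g : X ⟶ Y} (hf : Intertwines o f)
    (hg : Intertwines o g) : Intertwines o (f + g) := by
  unfold Intertwines at *
  rw [Functor.map_add, Functor.map_add, Preadditive.add_comp, Preadditive.comp_add, hf, hg]

variable [Linear ℂ C] [Linear ℂ D] [F.Linear ℂ] [G.Linear ℂ]

theorem Intertwines.smul {X Y : C} {f : X ⟶ Y} (hf : Intertwines o f) (c : ℂ) :
    Intertwines o (c • f) := by
  unfold Intertwines at *
  rw [Functor.map_smul, Functor.map_smul, Linear.smul_comp, Linear.comp_smul, hf]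

end Intertwines

/-- The condition on the image of the cup, as naturality of the identifications at the cup. -/
theorem eq_comp_cupAt_unit {C : Type*} [Category C] [MonoidalCategory C] {V U O T : C}
    {e : 𝟙_ C ⟶ U} {h : U ⟶ 𝟙_ C} {m : U ⟶ T} {δ : T ⟶ O ⊗ O} {o : O ⟶ V} {b : 𝟙_ C ⟶ V ⊗ V}
    (he : h ≫ e = 𝟙 U) (hb : e ≫ m ≫ δ ≫ (o ⊗ₘ o) = b) :
    m ≫ δ ≫ ((o ≫ (λ_ V).inv) ⊗ₘ o) = h ≫ cupAt b (𝟙_ C) := by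
  have e1 : cupAt b (𝟙_ C) = b ≫ (λ_ V).inv ▷ V := by
    simp only [cupAt]; monoidal
  rw [e1, ← hb, ← tensorHom_comp_whiskerRight]
  simp only [Category.assoc, reassoc_of% he]

/-- The condition on the image of the cap, as naturality of the identifications at the cap. -/
theorem comp_capAt_unit_eq {C : Type*} [Category C] [MonoidalCategory C] {V U T : C} {O : C}
    {h : U ⟶ 𝟙_ C} {m : T ⟶ U} {δ : T ⟶ O ⊗ O} {μ : O ⊗ O ⟶ T} {o : O ≅ V}
    {d : V ⊗ V ⟶ 𝟙_ C} (hδ : δ ≫ μ = 𝟙 T) (hd : (o.inv ⊗ₘ o.inv) ≫ μ ≫ m ≫ h = d) :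
    m ≫ h = (δ ≫ ((o.hom ≫ (λ_ V).inv) ⊗ₘ o.hom)) ≫ capAt d (𝟙_ C) := by
  have e1 : capAt d (𝟙_ C) = (λ_ V).hom ▷ V ≫ d := by
    simp only [capAt]; monoidal
  rw [e1, ← hd, ← tensorHom_comp_whiskerRight]
  have e2 : (λ_ V).inv ▷ V ≫ (λ_ V).hom ▷ V = 𝟙 _ := by simp
  simp only [Category.assoc, reassoc_of% e2]
  rw [tensorHom_comp_tensorHom_assoc, Iso.hom_inv_id, id_tensorHom_id, Category.id_comp,
    reassoc_of% hδ]

namespace TensorFunctor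

theorem objIso_two (F : TensorFunctor ha) : (F.objIso 2).hom =
    δ F.functor ⟨1⟩ ⟨1⟩ ≫ ((F.objOne.hom ≫ (λ_ (fund ha)).inv) ⊗ₘ F.objOne.hom) :=
  congrArg (fun f => δ F.functor ⟨1⟩ ⟨1⟩ ≫ (f ⊗ₘ F.objOne.hom)) F.objIso_one

theorem intertwines_cup (F : TensorFunctor ha) : Intertwines F.compIso (cup a) :=
  (congrArg (fun f => F.functor.map (cup a) ≫ f) F.objIso_two).trans
    ((eq_comp_cupAt_unit (η_ε F.functor) F.map_cup).trans
    (congrArg (fun f => η F.functor ≫ f) (stdFunctor_map_cup ha).symm))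

theorem intertwines_cap (F : TensorFunctor ha) : Intertwines F.compIso (cap a) :=
  (comp_capAt_unit_eq (δ_μ F.functor ⟨1⟩ ⟨1⟩) F.map_cap).trans
    (congrArg₂ (fun f g => f ≫ g) F.objIso_two.symm (stdFunctor_map_cap ha).symm)

theorem _root_.TemperleyLieb.cap_comp_cup (a : ℂ) : cap a ≫ cup a =
    (Skein.mkWord a [⟨0, .cap, 0⟩, ⟨0, .cup, 0⟩] ⟨rfl, rfl, rfl⟩ : Skein a 2 2) :=
  Skein.comp_mk _ _

/-- A piece without further strands, as a morphism. -/
def _root_.TemperleyLieb.ofPiece (a : ℂ) (P : Piece) : (⟨P.dom⟩ : Obj a) ⟶ ⟨P.cod⟩ :=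
  Skein.mkWord a [⟨0, P, 0⟩] ⟨Nat.zero_add _, Nat.zero_add _⟩

theorem _root_.TemperleyLieb.ofPiece_pos (a : ℂ) :
    ofPiece a .pos = a • 𝟙 (⟨2⟩ : Obj a) + a⁻¹ • (cap a ≫ cup a) := by
  rw [cap_comp_cup]
  exact Skein.mkWord_pos 0 0 _ _ rfl

theorem _root_.TemperleyLieb.ofPiece_neg (a : ℂ) :
    ofPiece a .neg = a⁻¹ • 𝟙 (⟨2⟩ : Obj a) + a • (cap a ≫ cup a) := by
  rw [cap_comp_cup]
  exact Skein.mkWord_neg 0 0 _ _ rfl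

theorem _root_.TemperleyLieb.ofSlice_eq (a : ℂ) (s : Slice) :
    ofSlice a s = ((⟨s.left⟩ : Obj a) ◁ ofPiece a s.piece) ▷ (⟨s.right⟩ : Obj a) := by
  symm
  refine (congrArg (fun f => f ▷ (⟨s.right⟩ : Obj a)) (whiskerLeft_ofDiagram (⟨s.left⟩ : Obj a)
    (Y := ⟨s.piece.dom⟩) (Z := ⟨s.piece.cod⟩) _)).trans ((whiskerRight_ofDiagram (a := a)
      (Y := ⟨s.left + s.piece.dom⟩) (Z := ⟨s.left + s.piece.cod⟩) _ _).trans ?_)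
  refine congrArg (Skein.mk a) (Diagram.ext ?_)
  simp [Diagram.whiskerLeft, Diagram.whiskerRight, Slice.shift]

theorem intertwines_piece (F : TensorFunctor ha) (P : Piece) :
    Intertwines F.compIso (ofPiece a P) := by
  have hcapcup := F.intertwines_cap.comp F.intertwines_cup
  cases P with
  | cup => exact F.intertwines_cup
  | cap => exact F.intertwines_cap
  | pos => rw [ofPiece_pos]; exact ((Intertwines.id _).smul _).add (hcapcup.smul _)
  | neg => rw [ofPiece_neg]; exact ((Intertwines.id _).smul _).add (hcapcup.smul _)

theorem intertwines_slice (F : TensorFunctor ha) (s : Slice) :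
    Intertwines F.compIso (ofSlice a s) := by
  rw [ofSlice_eq]
  exact ((F.intertwines_piece s.piece).whiskerLeft F.μ_compIso _).whiskerRight F.μ_compIso _

/-- The identifications are natural: they are so at the pieces, and naturality is stable under
tensoring with identities, composition and linear combination. -/
theorem intertwines (F : TensorFunctor ha) {X Y : Obj a} (f : X ⟶ Y) :
    Intertwines F.compIso f := by
  induction f using hom_induction with
  | hzero => exact .zero _ _
  | hadd x y hx hy => exact hx.add hy
  | hmk c D =>
    exact (diagram_induction (P := fun f => Intertwines F.compIso f) .id F.intertwines_slice
      (fun _ _ hf hg => hf.comp hg) D).smul c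

theorem map_ofDiagram (F : TensorFunctor ha) {n m : ℕ} (D : Diagram n m) :
    F.functor.map (ofDiagram D : (⟨n⟩ : Obj a) ⟶ ⟨m⟩) =
      (F.objIso n).hom ≫ diagMap ha D ≫ (F.objIso m).inv := by
  have h := F.intertwines (ofDiagram D : (⟨n⟩ : Obj a) ⟶ ⟨m⟩)
  rw [Intertwines, stdFunctor_map_ofDiagram] at h
  exact ((Iso.eq_comp_inv _).2 h).trans (Category.assoc _ _ _)

/-- The monoidal isomorphism between two functors. -/
def isoOf (F G : TensorFunctor ha) : F.functor ≅ G.functor :=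
  NatIso.ofComponents (fun X => F.compIso X ≪≫ (G.compIso X).symm) (fun {X Y} f => by
    have hF := F.intertwines f
    have hG := G.intertwines f
    unfold Intertwines at hF hG
    rw [Iso.trans_hom, Iso.trans_hom, reassoc_of% hF, Category.assoc, Iso.symm_hom, Iso.symm_hom,
      ← cancel_mono (G.compIso Y).hom]
    simp [hG])

theorem isoOf_hom_app (F G : TensorFunctor ha) (X : Obj a) :
    (isoOf F G).hom.app X = (F.compIso X).hom ≫ (G.compIso X).inv := rfl

theorem isMonoidal_isoOf (F G : TensorFunctor ha) : NatTrans.IsMonoidal (isoOf F G).hom where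
  unit := by
    rw [isoOf_hom_app, reassoc_of% F.ε_compIso, ← G.ε_compIso]
    simp
  tensor X Y := by
    rw [isoOf_hom_app, isoOf_hom_app, isoOf_hom_app, reassoc_of% F.μ_compIso,
      ← cancel_mono (G.compIso (X ⊗ Y)).hom]
    simp only [Category.assoc, Iso.inv_hom_id, Category.comp_id, G.μ_compIso]
    rw [tensorHom_comp_tensorHom_assoc]
    simp

theorem comp_inv_comp_eq {C : Type*} [Category C] {A B P V : C} {e : A ⟶ P} {e' : B ≅ P}
    {o : A ⟶ V} {o' : B ⟶ V} {l : V ≅ P} (he : e = o ≫ l.hom) (he' : e'.hom = o' ≫ l.hom) :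
    (e ≫ e'.inv) ≫ o' = o := by
  rw [← cancel_mono l.hom, Category.assoc, ← he', Category.assoc, Iso.inv_hom_id, Category.comp_id,
    he]

theorem isoOf_app_one (F G : TensorFunctor ha) :
    (isoOf F G).hom.app ⟨1⟩ ≫ G.objOne.hom = F.objOne.hom :=
  comp_inv_comp_eq (e := (F.objIso 1).hom) (e' := G.objIso 1) (l := (λ_ (fund ha)).symm)
    F.objIso_one G.objIso_one

/-- A monoidal transformation is determined at `n + 1` by its values at `n` and `1`. -/
theorem app_eq_of_isMonoidal {F G : TensorFunctor ha} {τ τ' : F.functor ⟶ G.functor}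
    (h : NatTrans.IsMonoidal τ) (h' : NatTrans.IsMonoidal τ') (h1 : τ.app ⟨1⟩ = τ'.app ⟨1⟩) :
    τ = τ' := by
  have key : ∀ n : ℕ, τ.app ⟨n⟩ = τ'.app ⟨n⟩ := by
    intro n
    induction n with
    | zero => exact (cancel_epi (ε F.functor)).1 (h.unit.trans h'.unit.symm)
    | succ n ih =>
      refine (cancel_epi (μ F.functor ⟨n⟩ ⟨1⟩)).1 ((h.tensor ⟨n⟩ ⟨1⟩).trans ?_)
      rw [ih, h1]
      exact (h'.tensor ⟨n⟩ ⟨1⟩).symm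
  exact NatTrans.ext (funext fun X => key X.strands)

theorem existsUnique_iso (F G : TensorFunctor ha) : ∃! i : F.functor ≅ G.functor,
    NatTrans.IsMonoidal i.hom ∧ i.hom.app ⟨1⟩ ≫ G.objOne.hom = F.objOne.hom := by
  refine ⟨isoOf F G, ⟨isMonoidal_isoOf F G, isoOf_app_one F G⟩, ?_⟩
  rintro i ⟨h, h1⟩
  refine Iso.ext (app_eq_of_isMonoidal h (isMonoidal_isoOf F G) ?_)
  rw [← cancel_mono G.objOne.hom, h1, isoOf_app_one]

end TensorFunctor

end QuantumSL2

namespace QuantumSL2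

open UqMod
open scoped TensorProduct

variable {a : ℂ} (ha : Admissible a)

/-! ### Weight vectors and the action of the generators on the tensor powers of `V` -/

/-- The linear map `u ↦ u ⊗ v_e` from `V^{⊗ n}` to `V^{⊗ (n + 1)}`. -/
def snoc {n : ℕ} (e : Fin 2) : fundPow ha n →ₗ[ℂ] fundPow ha (n + 1) :=
  (TensorProduct.mk ℂ (fundPow ha n) (fund ha)).flip (vec ha e)

/-- The element `1` of `V^{⊗ 0} = ℂ`. -/
def one : fundPow ha 0 := (1 : ℂ)

theorem pow_succ_apply {W : Type*} [AddCommGroup W] [Module ℂ W] (f : Module.End ℂ W) (k : ℕ)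
    (w : W) : (f ^ (k + 1)) w = f ((f ^ k) w) := by
  rw [pow_succ', Module.End.mul_apply]

theorem pow_zero_ext {M : Type*} [AddCommGroup M] [Module ℂ M] {f g : fundPow ha 0 →ₗ[ℂ] M}
    (h : f (one ha) = g (one ha)) : f = g := LinearMap.ext_ring h

theorem pow_succ_ext {n : ℕ} {M : Type*} [AddCommGroup M] [Module ℂ M]
    {f g : fundPow ha (n + 1) →ₗ[ℂ] M} (h : ∀ e, f ∘ₗ snoc ha e = g ∘ₗ snoc ha e) : f = g := by
  have e {W : Type _} [AddCommGroup W] [Module ℂ W] {f g : W ⊗[ℂ] fund ha →ₗ[ℂ] M}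
      (h : ∀ e w, f (w ⊗ₜ[ℂ] vec ha e) = g (w ⊗ₜ[ℂ] vec ha e)) : f = g :=
    TensorProduct.ext (LinearMap.ext fun w => fund_ext ha fun i => h i w)
  exact e fun i w => LinearMap.congr_fun (h i) w

theorem fund_act_vec (x : Gen) (e : Fin 2) : (fund ha).act x (vec ha e) =
    fundMatrix (a ^ 2) x 0 e • vec ha 0 + fundMatrix (a ^ 2) x 1 e • vec ha 1 := by
  rw [fund_act]
  change Matrix.toLin' (fundMatrix (a ^ 2) x) (Pi.single e 1 : Fin 2 → ℂ) =
    fundMatrix (a ^ 2) x 0 e • (Pi.single 0 1 : Fin 2 → ℂ) +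
      fundMatrix (a ^ 2) x 1 e • (Pi.single 1 1 : Fin 2 → ℂ)
  ext i
  fin_cases i <;> simp

theorem act_pow_succ (n : ℕ) (x : Gen) : (fundPow ha (n + 1)).act x =
    tensorAct (fundPow ha n).act (fund ha).act x := congrFun (tensor_act _ _) x

theorem act_X_snoc_zero {n : ℕ} (u : fundPow ha n) : (fundPow ha (n + 1)).act .X (snoc ha 0 u) =
    a ^ 2 • snoc ha 0 ((fundPow ha n).act .X u) := by
  rw [act_pow_succ]
  change u ⊗ₜ[ℂ] (fund ha).act .X (vec ha 0) + (fundPow ha n).act .X u ⊗ₜ[ℂ]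
    (fund ha).act .K (vec ha 0) = a ^ 2 • ((fundPow ha n).act .X u ⊗ₜ[ℂ] vec ha 0)
  rw [fund_act_vec, fund_act_vec]
  simp [fundMatrix]

theorem act_X_snoc_one {n : ℕ} (u : fundPow ha n) : (fundPow ha (n + 1)).act .X (snoc ha 1 u) =
    snoc ha 0 u + (a ^ 2)⁻¹ • snoc ha 1 ((fundPow ha n).act .X u) := by
  rw [act_pow_succ]
  change u ⊗ₜ[ℂ] (fund ha).act .X (vec ha 1) + (fundPow ha n).act .X u ⊗ₜ[ℂ]
    (fund ha).act .K (vec ha 1) =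
      u ⊗ₜ[ℂ] vec ha 0 + (a ^ 2)⁻¹ • ((fundPow ha n).act .X u ⊗ₜ[ℂ] vec ha 1)
  rw [fund_act_vec, fund_act_vec]
  simp [fundMatrix]

theorem act_Y_snoc_zero {n : ℕ} (u : fundPow ha n) : (fundPow ha (n + 1)).act .Y (snoc ha 0 u) =
    snoc ha 1 ((fundPow ha n).act .Kinv u) + snoc ha 0 ((fundPow ha n).act .Y u) := by
  rw [act_pow_succ]
  change (fundPow ha n).act .Kinv u ⊗ₜ[ℂ] (fund ha).act .Y (vec ha 0) +
    (fundPow ha n).act .Y u ⊗ₜ[ℂ] vec ha 0 =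
      (fundPow ha n).act .Kinv u ⊗ₜ[ℂ] vec ha 1 + (fundPow ha n).act .Y u ⊗ₜ[ℂ] vec ha 0
  rw [fund_act_vec]
  simp [fundMatrix]

theorem act_Y_snoc_one {n : ℕ} (u : fundPow ha n) : (fundPow ha (n + 1)).act .Y (snoc ha 1 u) =
    snoc ha 1 ((fundPow ha n).act .Y u) := by
  rw [act_pow_succ]
  change (fundPow ha n).act .Kinv u ⊗ₜ[ℂ] (fund ha).act .Y (vec ha 1) +
    (fundPow ha n).act .Y u ⊗ₜ[ℂ] vec ha 1 = (fundPow ha n).act .Y u ⊗ₜ[ℂ] vec ha 1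
  rw [fund_act_vec]
  simp [fundMatrix]

theorem act_K_snoc {n : ℕ} (e : Fin 2) (u : fundPow ha n) :
    (fundPow ha (n + 1)).act .K (snoc ha e u) =
      fundMatrix (a ^ 2) .K e e • snoc ha e ((fundPow ha n).act .K u) := by
  rw [act_pow_succ]
  change (fundPow ha n).act .K u ⊗ₜ[ℂ] (fund ha).act .K (vec ha e) =
    fundMatrix (a ^ 2) .K e e • ((fundPow ha n).act .K u ⊗ₜ[ℂ] vec ha e)
  rw [fund_act_vec]
  fin_cases e <;> simp [fundMatrix]

theorem act_pow_zero (x : Gen) : (fundPow ha 0).act x = trivAct x := congrFun triv_act x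

theorem weightProj_snoc_zero {n : ℕ} (i : ℤ) (u : fundPow ha n) :
    weightProj ha (n + 1) i (snoc ha 0 u) = snoc ha 0 (weightProj ha n (i - 1) u) := by
  change weightProj ha n (i - 1) u ⊗ₜ[ℂ] lineProj ha 0 (vec ha 0) +
    weightProj ha n (i + 1) u ⊗ₜ[ℂ] lineProj ha 1 (vec ha 0) =
      weightProj ha n (i - 1) u ⊗ₜ[ℂ] vec ha 0
  have h0 : lineProj ha 0 (vec ha 0) = vec ha 0 := by
    change Matrix.toLin' (Matrix.single 0 0 1) (Pi.single 0 1) = (Pi.single 0 1 : Fin 2 → ℂ)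
    ext i; fin_cases i <;> simp
  have h1 : lineProj ha 1 (vec ha 0) = 0 := by
    change Matrix.toLin' (Matrix.single 1 1 1) (Pi.single 0 1) = (0 : Fin 2 → ℂ)
    ext i; fin_cases i <;> simp
  rw [h0, h1, TensorProduct.tmul_zero, add_zero]

theorem weightProj_snoc_one {n : ℕ} (i : ℤ) (u : fundPow ha n) :
    weightProj ha (n + 1) i (snoc ha 1 u) = snoc ha 1 (weightProj ha n (i + 1) u) := by
  change weightProj ha n (i - 1) u ⊗ₜ[ℂ] lineProj ha 0 (vec ha 1) +
    weightProj ha n (i + 1) u ⊗ₜ[ℂ] lineProj ha 1 (vec ha 1) =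
      weightProj ha n (i + 1) u ⊗ₜ[ℂ] vec ha 1
  have h0 : lineProj ha 0 (vec ha 1) = 0 := by
    change Matrix.toLin' (Matrix.single 0 0 1) (Pi.single 1 1) = (0 : Fin 2 → ℂ)
    ext i; fin_cases i <;> simp
  have h1 : lineProj ha 1 (vec ha 1) = vec ha 1 := by
    change Matrix.toLin' (Matrix.single 1 1 1) (Pi.single 1 1) = (Pi.single 1 1 : Fin 2 → ℂ)
    ext i; fin_cases i <;> simp
  rw [h0, h1, TensorProduct.tmul_zero, zero_add]

/-- The vector `w` of `V^{⊗ n}` has weight `i`. -/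
def HasWeight {n : ℕ} (i : ℤ) (w : fundPow ha n) : Prop :=
  ∀ j, weightProj ha n j w = if j = i then w else 0

variable {ha}

theorem HasWeight.snoc_zero {n : ℕ} {i : ℤ} {w : fundPow ha n} (h : HasWeight ha i w) :
    HasWeight ha (i + 1) (snoc ha 0 w) := by
  intro j
  rw [weightProj_snoc_zero, h]
  by_cases hj : j = i + 1
  · rw [if_pos (by omega), if_pos hj]
  · rw [if_neg (by omega), if_neg hj, map_zero]

theorem HasWeight.snoc_one {n : ℕ} {i : ℤ} {w : fundPow ha n} (h : HasWeight ha i w) :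
    HasWeight ha (i - 1) (snoc ha 1 w) := by
  intro j
  rw [weightProj_snoc_one, h]
  by_cases hj : j = i - 1
  · rw [if_pos (by omega), if_pos hj]
  · rw [if_neg (by omega), if_neg hj, map_zero]

theorem hasWeight_zero (w : fundPow ha 0) : HasWeight ha 0 w := by
  intro j
  change (if j = 0 then LinearMap.id else 0 : Module.End ℂ (fundPow ha 0)) w = _
  split_ifs <;> rfl

/-- The weight vectors span `V^{⊗ n}`. -/
theorem weight_ext {n : ℕ} {M : Type*} [AddCommGroup M] [Module ℂ M] {f g : fundPow ha n →ₗ[ℂ] M}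
    (h : ∀ i w, HasWeight ha i w → f w = g w) : f = g := by
  induction n with
  | zero => exact LinearMap.ext fun w => h 0 w (hasWeight_zero w)
  | succ n ih =>
    refine pow_succ_ext ha fun e => ih fun i w hw => ?_
    match e with
    | 0 => exact h _ _ hw.snoc_zero
    | 1 => exact h _ _ hw.snoc_one

theorem weightProj_eq_zero (n : ℕ) {i : ℤ} (hi : i ∉ Finset.Icc (-n : ℤ) n) :
    weightProj ha n i = 0 := by
  induction n generalizing i with
  | zero =>
    have : i ≠ 0 := by rintro rfl; simp at hi
    exact if_neg this
  | succ n ih =>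
    rw [Finset.mem_Icc] at hi
    push_cast at hi
    refine pow_succ_ext ha fun e => LinearMap.ext fun w => ?_
    match e with
    | 0 =>
      refine (weightProj_snoc_zero ha i w).trans ?_
      rw [ih (by rw [Finset.mem_Icc]; omega)]
      simp
    | 1 =>
      refine (weightProj_snoc_one ha i w).trans ?_
      rw [ih (by rw [Finset.mem_Icc]; omega)]
      simp

theorem HasWeight.proj_self {n : ℕ} {i : ℤ} {w : fundPow ha n} (h : HasWeight ha i w) :
    weightProj ha n i w = w := (h i).trans (if_pos rfl)

theorem HasWeight.eq_zero {n : ℕ} {i : ℤ} {w : fundPow ha n} (h : HasWeight ha i w)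
    (hi : i ∉ Finset.Icc (-n : ℤ) n) : w = 0 := by
  rw [← h.proj_self, weightProj_eq_zero n hi, LinearMap.zero_apply]

theorem hasWeight_weightProj {n : ℕ} (i : ℤ) (w : fundPow ha n) :
    HasWeight ha i (weightProj ha n i w) := by
  intro j
  have : weightProj ha n j ∘ₗ weightProj ha n i = if j = i then weightProj ha n i else 0 := by
    refine weight_ext fun k u hu => ?_
    rw [LinearMap.comp_apply, hu]
    split_ifs with h1 h2 h2
    · rw [hu, hu, if_pos h1, if_pos (h2.trans h1)]
    · rw [hu, if_neg (fun h3 => h2 (h3.trans h1.symm)), LinearMap.zero_apply]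
    · rw [map_zero, hu, if_neg h1]
    · rw [map_zero, LinearMap.zero_apply]
  rw [← LinearMap.comp_apply, this]
  split_ifs <;> rfl

/-- Linear maps on `V^{⊗ (n + 1)}` are compared on the vectors `u ⊗ v_e` of a given weight. -/
theorem HasWeight.eq_of_snoc {n : ℕ} {M : Type*} [AddCommGroup M] [Module ℂ M]
    {f g : fundPow ha (n + 1) →ₗ[ℂ] M} {j : ℤ} {w : fundPow ha (n + 1)} (hw : HasWeight ha j w)
    (h0 : ∀ u, HasWeight ha (j - 1) u → f (snoc ha 0 u) = g (snoc ha 0 u))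
    (h1 : ∀ u, HasWeight ha (j + 1) u → f (snoc ha 1 u) = g (snoc ha 1 u)) : f w = g w := by
  have : f ∘ₗ weightProj ha (n + 1) j = g ∘ₗ weightProj ha (n + 1) j := by
    refine pow_succ_ext ha fun e => LinearMap.ext fun u => ?_
    simp only [LinearMap.comp_apply]
    match e with
    | 0 => rw [weightProj_snoc_zero]; exact h0 _ (hasWeight_weightProj _ _)
    | 1 => rw [weightProj_snoc_one]; exact h1 _ (hasWeight_weightProj _ _)
  have := LinearMap.congr_fun this w
  rwa [LinearMap.comp_apply, LinearMap.comp_apply, hw.proj_self] at this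

theorem HasWeight.act_K {n : ℕ} {i : ℤ} {w : fundPow ha n} (h : HasWeight ha i w) :
    (fundPow ha n).act .K w = (a ^ 2) ^ i • w := by
  have hq := ha.q_ne_zero
  have key : ∀ (n : ℕ) (i : ℤ), (fundPow ha n).act .K ∘ₗ weightProj ha n i =
      (a ^ 2) ^ i • weightProj ha n i := by
    intro n
    induction n with
    | zero =>
      intro i
      by_cases hi : i = 0
      · subst hi
        rw [act_pow_zero, zpow_zero, one_smul]
        rfl
      · have : weightProj ha 0 i = 0 := if_neg hi
        rw [this, smul_zero]; exact LinearMap.comp_zero _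
    | succ n ih =>
      intro i
      refine pow_succ_ext ha fun e => LinearMap.ext fun w => ?_
      match e with
      | 0 =>
        have := LinearMap.congr_fun (ih (i - 1)) w
        simp only [LinearMap.comp_apply, LinearMap.smul_apply] at this ⊢
        rw [weightProj_snoc_zero, act_K_snoc, this, map_smul, smul_smul]
        congr 1
        change a ^ 2 * _ = _
        rw [zpow_sub_one₀ hq, mul_left_comm, mul_inv_cancel₀ hq, mul_one]
      | 1 =>
        have := LinearMap.congr_fun (ih (i + 1)) w
        simp only [LinearMap.comp_apply, LinearMap.smul_apply] at this ⊢
        rw [weightProj_snoc_one, act_K_snoc, this, map_smul, smul_smul]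
        congr 1
        change (a ^ 2)⁻¹ * _ = _
        rw [zpow_add_one₀ hq, mul_left_comm, inv_mul_cancel₀ hq, mul_one]
  have := LinearMap.congr_fun (key n i) w
  simpa only [LinearMap.comp_apply, LinearMap.smul_apply, h.proj_self] using this

theorem HasWeight.act_Kinv {n : ℕ} {i : ℤ} {w : fundPow ha n} (h : HasWeight ha i w) :
    (fundPow ha n).act .Kinv w = (a ^ 2) ^ (-i) • w := by
  have e : (fundPow ha n).act .Kinv ((fundPow ha n).act .K w) = w :=
    LinearMap.congr_fun (fundPow ha n).Kinv_K_act w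
  rw [h.act_K, map_smul] at e
  rw [zpow_neg, eq_inv_smul_iff₀ (zpow_ne_zero _ ha.q_ne_zero), e]

theorem HasWeight.act_X {n : ℕ} {i : ℤ} {w : fundPow ha n} (h : HasWeight ha i w) :
    HasWeight ha (i + 2) ((fundPow ha n).act .X w) := by
  have key : ∀ (n : ℕ) (j : ℤ), weightProj ha n (j + 2) ∘ₗ (fundPow ha n).act .X =
      (fundPow ha n).act .X ∘ₗ weightProj ha n j := by
    intro n
    induction n with
    | zero =>
      intro j
      have : (fundPow ha 0).act .X = 0 := act_pow_zero ha _
      rw [this, LinearMap.comp_zero, LinearMap.zero_comp]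
    | succ n ih =>
      intro j
      refine pow_succ_ext ha fun e => LinearMap.ext fun w => ?_
      match e with
      | 0 =>
        have := LinearMap.congr_fun (ih (j - 1)) w
        simp only [LinearMap.comp_apply] at this ⊢
        rw [weightProj_snoc_zero, act_X_snoc_zero, act_X_snoc_zero, map_smul,
          weightProj_snoc_zero, ← this, show j + 2 - 1 = j - 1 + 2 by ring]
      | 1 =>
        have := LinearMap.congr_fun (ih (j + 1)) w
        simp only [LinearMap.comp_apply] at this ⊢
        rw [weightProj_snoc_one, act_X_snoc_one, act_X_snoc_one, map_add, map_smul,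
          weightProj_snoc_zero, weightProj_snoc_one, ← this, show j + 2 - 1 = j + 1 by ring,
          show j + 2 + 1 = j + 1 + 2 by ring]
  intro j
  have := LinearMap.congr_fun (key n (j - 2)) w
  simp only [LinearMap.comp_apply, sub_add_cancel] at this
  rw [this, h]
  by_cases hj : j = i + 2
  · rw [if_pos (by omega), if_pos hj]
  · rw [if_neg (by omega), if_neg hj, map_zero]

theorem weightProj_Kinv (n : ℕ) (i : ℤ) (w : fundPow ha n) :
    weightProj ha n i ((fundPow ha n).act .Kinv w) =
      (fundPow ha n).act .Kinv (weightProj ha n i w) := by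
  have : weightProj ha n i ∘ₗ (fundPow ha n).act .Kinv =
      (fundPow ha n).act .Kinv ∘ₗ weightProj ha n i := by
    refine weight_ext fun j w hw => ?_
    simp only [LinearMap.comp_apply]
    rw [hw.act_Kinv, map_smul, hw]
    split_ifs
    · rw [hw.act_Kinv]
    · simp
  exact LinearMap.congr_fun this w

theorem HasWeight.act_Y {n : ℕ} {i : ℤ} {w : fundPow ha n} (h : HasWeight ha i w) :
    HasWeight ha (i - 2) ((fundPow ha n).act .Y w) := by
  have key : ∀ (n : ℕ) (j : ℤ), weightProj ha n (j - 2) ∘ₗ (fundPow ha n).act .Y =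
      (fundPow ha n).act .Y ∘ₗ weightProj ha n j := by
    intro n
    induction n with
    | zero =>
      intro j
      have : (fundPow ha 0).act .Y = 0 := act_pow_zero ha _
      rw [this, LinearMap.comp_zero, LinearMap.zero_comp]
    | succ n ih =>
      intro j
      refine pow_succ_ext ha fun e => LinearMap.ext fun w => ?_
      match e with
      | 0 =>
        have := LinearMap.congr_fun (ih (j - 1)) w
        simp only [LinearMap.comp_apply] at this ⊢
        rw [weightProj_snoc_zero, act_Y_snoc_zero, act_Y_snoc_zero, map_add,
          weightProj_snoc_zero, weightProj_snoc_one, weightProj_Kinv, ← this,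
          show j - 2 - 1 = j - 1 - 2 by ring, show j - 2 + 1 = j - 1 by ring]
      | 1 =>
        have := LinearMap.congr_fun (ih (j + 1)) w
        simp only [LinearMap.comp_apply] at this ⊢
        rw [weightProj_snoc_one, act_Y_snoc_one, act_Y_snoc_one,
          weightProj_snoc_one, ← this, show j - 2 + 1 = j + 1 - 2 by ring]
  intro j
  have := LinearMap.congr_fun (key n (j + 2)) w
  simp only [LinearMap.comp_apply, add_sub_cancel_right] at this
  rw [this, h]
  by_cases hj : j = i - 2
  · rw [if_pos (by omega), if_pos hj]
  · rw [if_neg (by omega), if_neg hj, map_zero]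

theorem HasWeight.act_X_pow {n : ℕ} {i : ℤ} {w : fundPow ha n} (h : HasWeight ha i w) (k : ℕ) :
    HasWeight ha (i + 2 * k) (((fundPow ha n).act .X ^ k) w) := by
  induction k with
  | zero => simpa using h
  | succ k ih =>
    rw [pow_succ_apply]
    convert ih.act_X using 1
    push_cast; ring

theorem HasWeight.act_Y_pow {n : ℕ} {i : ℤ} {w : fundPow ha n} (h : HasWeight ha i w) (k : ℕ) :
    HasWeight ha (i - 2 * k) (((fundPow ha n).act .Y ^ k) w) := by
  induction k with
  | zero => simpa using h
  | succ k ih =>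
    rw [pow_succ_apply]
    convert ih.act_Y using 1
    push_cast; ring

variable (ha)

/-- The quantum integer `[k] = (q^k - q^{-k}) / (q - q^{-1})`. -/
def qInt (q : ℂ) (k : ℕ) : ℂ := (q ^ k - (q ^ k)⁻¹) / (q - q⁻¹)

theorem qInt_succ {q : ℂ} (hq : q ≠ 0) (hq' : q - q⁻¹ ≠ 0) (k : ℕ) :
    qInt q (k + 1) = (q ^ k)⁻¹ + q * qInt q k := by
  have hk := pow_ne_zero k hq
  unfold qInt
  rw [mul_div_assoc', div_eq_iff hq', add_mul, div_mul_cancel₀ _ hq', pow_succ, mul_inv]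
  field_simp
  ring

/-- The recursion for the coefficient in `HasWeight.act_Y_pow_snoc_zero`. -/
theorem sq_add_qInt {q : ℂ} (hq : q ≠ 0) (hq' : q - q⁻¹ ≠ 0) (k : ℕ) :
    (q ^ (k + 1)) ^ 2 + q ^ k * qInt q (k + 1) = q ^ (k + 1) * qInt q (k + 2) := by
  have hk := pow_ne_zero k hq
  unfold qInt
  rw [mul_div_assoc', mul_div_assoc', eq_div_iff hq', add_mul, div_mul_cancel₀ _ hq', pow_succ q (k + 1),
    pow_succ]
  field_simp
  ring

theorem act_X_pow_snoc_zero {n : ℕ} (k : ℕ) (u : fundPow ha n) :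
    ((fundPow ha (n + 1)).act .X ^ k) (snoc ha 0 u) =
      (a ^ 2) ^ k • snoc ha 0 (((fundPow ha n).act .X ^ k) u) := by
  induction k with
  | zero => simp
  | succ k ih =>
    rw [pow_succ_apply, ih, map_smul, act_X_snoc_zero, smul_smul, ← pow_succ (a ^ 2) k,
      pow_succ_apply ((fundPow ha n).act .X) k]

theorem act_X_pow_snoc_one {n : ℕ} (k : ℕ) (u : fundPow ha n) :
    ((fundPow ha (n + 1)).act .X ^ k) (snoc ha 1 u) =
      ((a ^ 2) ^ k)⁻¹ • snoc ha 1 (((fundPow ha n).act .X ^ k) u) +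
        qInt (a ^ 2) k • snoc ha 0 (((fundPow ha n).act .X ^ (k - 1)) u) := by
  induction k with
  | zero => simp [qInt]
  | succ k ih =>
    have e : qInt (a ^ 2) k • (fundPow ha n).act .X (((fundPow ha n).act .X ^ (k - 1)) u) =
        qInt (a ^ 2) k • ((fundPow ha n).act .X ^ k) u := by
      cases k with
      | zero => simp [qInt]
      | succ k => rw [pow_succ_apply _ k, Nat.add_sub_cancel]
    rw [pow_succ_apply, ih, map_add, map_smul, map_smul, act_X_snoc_zero,
      act_X_snoc_one, Nat.add_sub_cancel, qInt_succ ha.q_ne_zero ha.q_sub_ne_zero,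
      smul_comm (qInt _ _), ← map_smul (snoc ha 0) (qInt _ _), e, map_smul,
      pow_succ_apply ((fundPow ha n).act .X) k, pow_succ (a ^ 2) k, mul_inv]
    module

theorem act_Y_pow_snoc_one {n : ℕ} (k : ℕ) (u : fundPow ha n) :
    ((fundPow ha (n + 1)).act .Y ^ k) (snoc ha 1 u) =
      snoc ha 1 (((fundPow ha n).act .Y ^ k) u) := by
  induction k with
  | zero => simp
  | succ k ih =>
    rw [pow_succ_apply, ih, act_Y_snoc_one,
      pow_succ_apply ((fundPow ha n).act .Y) k]

variable {ha}

/-- The factor `q ^ (-i)` comes from the action of `K⁻¹` on `u`. -/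
theorem HasWeight.act_Y_pow_snoc_zero {n : ℕ} {i : ℤ} {u : fundPow ha n} (h : HasWeight ha i u)
    (k : ℕ) : ((fundPow ha (n + 1)).act .Y ^ (k + 1)) (snoc ha 0 u) =
      snoc ha 0 (((fundPow ha n).act .Y ^ (k + 1)) u) +
        ((a ^ 2) ^ (-i) * (a ^ 2) ^ k * qInt (a ^ 2) (k + 1)) •
          snoc ha 1 (((fundPow ha n).act .Y ^ k) u) := by
  have hq := ha.q_ne_zero
  have hq' := ha.q_sub_ne_zero
  induction k with
  | zero =>
    have : qInt (a ^ 2) 1 = 1 := by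
      rw [qInt, pow_one]
      exact div_self hq'
    simp only [zero_add, pow_one, pow_zero, Module.End.one_apply, mul_one, this]
    rw [act_Y_snoc_zero, h.act_Kinv, map_smul, add_comm (_ • _)]
  | succ k ih =>
    have hw := (h.act_Y_pow (k + 1)).act_Kinv
    rw [pow_succ_apply, ih, map_add, map_smul, act_Y_snoc_zero, act_Y_snoc_one,
      hw, map_smul, pow_succ_apply _ (k + 1), pow_succ_apply _ k,
      add_comm (_ • _), add_assoc, ← add_smul]
    congr 2
    have e : (a ^ 2) ^ (-(i - 2 * ((k + 1 : ℕ) : ℤ))) = (a ^ 2) ^ (-i) * ((a ^ 2) ^ (k + 1)) ^ 2 := by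
      rw [← pow_mul, ← zpow_natCast (a ^ 2) ((k + 1) * 2), ← zpow_add₀ hq]
      congr 1
      push_cast; ring
    rw [e, mul_assoc _ _ (qInt _ _), ← mul_add, sq_add_qInt hq hq', mul_assoc]

variable (ha)

theorem act_X_pow_eq_zero (n : ℕ) (u : fundPow ha n) :
    ((fundPow ha n).act .X ^ (n + 1)) u = 0 := by
  induction n with
  | zero =>
    rw [pow_one, act_pow_zero]
    rfl
  | succ n ih =>
    have h (u : fundPow ha n) : ((fundPow ha n).act .X ^ (n + 2)) u = 0 := by
      rw [pow_succ_apply, ih, map_zero]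
    have : (fundPow ha (n + 1)).act .X ^ (n + 2) = 0 := by
      refine pow_succ_ext ha fun e => LinearMap.ext fun w => ?_
      match e with
      | 0 =>
        rw [LinearMap.comp_apply, LinearMap.comp_apply, LinearMap.zero_apply]
        refine (act_X_pow_snoc_zero ha _ w).trans ?_
        rw [h, map_zero, smul_zero]
      | 1 =>
        rw [LinearMap.comp_apply, LinearMap.comp_apply, LinearMap.zero_apply]
        refine (act_X_pow_snoc_one ha _ w).trans ?_
        rw [h, show n + 2 - 1 = n + 1 from rfl, ih, map_zero, map_zero, smul_zero, smul_zero,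
          add_zero]
    exact LinearMap.congr_fun this u

/-- At a root of unity the powers of `Y` vanish from the first `k` with `[k] = 0` on. -/
theorem act_Y_pow_eq_zero (n k : ℕ) (hk : qInt (a ^ 2) (k + 1) = 0) (u : fundPow ha n) :
    ((fundPow ha n).act .Y ^ (k + 1)) u = 0 := by
  induction n with
  | zero =>
    rw [pow_succ_apply, act_pow_zero]
    rfl
  | succ n ih =>
    have : (fundPow ha (n + 1)).act .Y ^ (k + 1) = 0 := by
      refine pow_succ_ext ha fun e => weight_ext fun i w hw => ?_
      match e with
      | 0 =>
        rw [LinearMap.comp_apply, LinearMap.comp_apply, LinearMap.zero_apply]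
        refine (hw.act_Y_pow_snoc_zero k).trans ?_
        rw [ih, hk, map_zero, mul_zero, zero_smul, add_zero]
      | 1 =>
        rw [LinearMap.comp_apply, LinearMap.comp_apply, LinearMap.zero_apply]
        refine (act_Y_pow_snoc_one ha _ w).trans ?_
        rw [ih, map_zero]
    exact LinearMap.congr_fun this u

/-! ### The coefficients of the `R`-matrix -/

theorem qFactorial_succ (q : ℂ) (k : ℕ) :
    qFactorial q (k + 1) = qFactorial q k * qInt q (k + 1) := Finset.prod_range_succ _ _

theorem rCoeff_zero (q : ℂ) : rCoeff q 0 = 1 := by simp [rCoeff, qFactorial]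

theorem rCoeff_succ {q : ℂ} (k : ℕ) (h : qInt q (k + 1) ≠ 0) :
    rCoeff q (k + 1) * qInt q (k + 1) = q ^ k * (q - q⁻¹) * rCoeff q k := by
  unfold rCoeff
  rw [qFactorial_succ]
  by_cases h' : qFactorial q k = 0
  · simp [h']
  · have e : (k + 1) * (k + 1 - 1) / 2 = k + k * (k - 1) / 2 := by
      have := Nat.triangle_succ k
      omega
    rw [if_neg (mul_ne_zero h' h), if_neg h', e]
    field_simp
    ring

end QuantumSL2

namespace TemperleyLieb

/-! ### Pieces on the last strands -/

/-- A cup to the right of `n` strands. -/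
def lastCup (n : ℕ) : Diagram n (n + 2) := ⟨[⟨n, .cup, 0⟩], rfl, rfl⟩

/-- A cap of the last two of `n + 2` strands. -/
def lastCap (n : ℕ) : Diagram (n + 2) n := ⟨[⟨n, .cap, 0⟩], rfl, rfl⟩

/-- A crossing of the last two of `n + 2` strands. -/
def lastPos (n : ℕ) : Diagram (n + 2) (n + 2) := ⟨[⟨n, .pos, 0⟩], rfl, rfl⟩

end TemperleyLieb

namespace QuantumSL2

open TemperleyLieb UqMod
open scoped TensorProduct

variable {a : ℂ} (ha : Admissible a)

/-! ### The action of diagrams on vectors -/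

/-- The juxtaposition `V^{⊗ n} × V^{⊗ m} → V^{⊗ (n + m)}` of tensors. -/
def join {n m : ℕ} : fundPow ha n →ₗ[ℂ] fundPow ha m →ₗ[ℂ] fundPow ha (n + m) :=
  TensorProduct.curry (M := fundPow ha n) (N := fundPow ha m) (toLin (powMul ha n m).hom)

/-- The linear map of a diagram. -/
def diagLin {k l : ℕ} (D : Diagram k l) : fundPow ha k →ₗ[ℂ] fundPow ha l := toLin (diagMap ha D)

theorem diagLin_comp {k l m : ℕ} (D : Diagram k l) (D' : Diagram l m) (x : fundPow ha k) :
    diagLin ha (D.comp D') x = diagLin ha D' (diagLin ha D x) :=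
  LinearMap.congr_fun (congrArg toLin (diagMap_comp ha D D')) x

theorem diagLin_vert {k : ℕ} (h : k = k) (x : fundPow ha k) :
    diagLin ha (Diagram.vert h) x = x := rfl

theorem diagLin_vert_vert {k l m : ℕ} (h : k = l) (h' : l = m) (x : fundPow ha k) :
    diagLin ha (Diagram.vert h') (diagLin ha (Diagram.vert h) x) =
      diagLin ha (Diagram.vert (h.trans h')) x := by
  subst h h'
  rfl

theorem diagLin_vert_snoc {k l : ℕ} (h : k = l) (h' : k + 1 = l + 1) (e : Fin 2)
    (x : fundPow ha k) : diagLin ha (Diagram.vert h') (snoc ha e x) =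
      snoc ha e (diagLin ha (Diagram.vert h) x) := by
  subst h
  rfl

theorem diagLin_whiskerLeft {n k l : ℕ} (D : Diagram k l) (u : fundPow ha n) (x : fundPow ha k) :
    diagLin ha (D.whiskerLeft n) (join ha u x) = join ha u (diagLin ha D x) :=
  LinearMap.congr_fun (congrArg toLin (powMul_diagMap_left ha n D))
    (u ⊗ₜ[ℂ] x : fundPow ha n ⊗[ℂ] fundPow ha k)

theorem diagLin_whiskerRight {k l m : ℕ} (D : Diagram k l) (x : fundPow ha k) (w : fundPow ha m) :
    diagLin ha (D.whiskerRight m) (join ha x w) = join ha (diagLin ha D x) w :=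
  LinearMap.congr_fun (congrArg toLin (powMul_diagMap_right ha D m))
    (x ⊗ₜ[ℂ] w : fundPow ha k ⊗[ℂ] fundPow ha m)

theorem join_one {n : ℕ} (u : fundPow ha n) : join ha u (one ha) = u :=
  one_smul ℂ u

theorem join_snoc {n m : ℕ} (u : fundPow ha n) (e : Fin 2) (w : fundPow ha m) :
    join ha u (snoc ha e w) = snoc ha e (join ha u w) := rfl

theorem join_assoc {n m p : ℕ} (u : fundPow ha n) (v : fundPow ha m) (w : fundPow ha p) :
    diagLin ha (Diagram.vert (Nat.add_assoc n m p)) (join ha (join ha u v) w) =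
      join ha u (join ha v w) :=
  LinearMap.congr_fun (congrArg toLin (powMul_assoc ha n m p (Nat.add_assoc n m p)))
    ((u ⊗ₜ[ℂ] v) ⊗ₜ[ℂ] w : (fundPow ha n ⊗[ℂ] fundPow ha m) ⊗[ℂ] fundPow ha p)

theorem one_join {n : ℕ} (u : fundPow ha n) :
    diagLin ha (Diagram.vert (Nat.zero_add n)) (join ha (one ha) u) = u :=
  (LinearMap.congr_fun (congrArg toLin (powMul_zero_left ha n (Nat.zero_add n)))
    ((1 : ℂ) ⊗ₜ[ℂ] u : ℂ ⊗[ℂ] fundPow ha n)).trans (one_smul ℂ u)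

theorem diagLin_whiskerRight_snoc {k l : ℕ} (D : Diagram k l) (e : Fin 2) (x : fundPow ha k) :
    diagLin ha (D.whiskerRight 1) (snoc ha e x) = snoc ha e (diagLin ha D x) := by
  have h := diagLin_whiskerRight ha D x (snoc ha e (one ha))
  rwa [join_snoc, join_snoc, join_one, join_one] at h

/-! ### Cups, caps and crossings on vectors -/

theorem diagLin_lastCap {n : ℕ} (e f : Fin 2) (u : fundPow ha n) :
    diagLin ha (lastCap n) (snoc ha f (snoc ha e u)) = dLin ha (vec ha e ⊗ₜ[ℂ] vec ha f) • u := rfl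

theorem diagLin_lastCup {n : ℕ} (u : fundPow ha n) : diagLin ha (lastCup n) u =
    snoc ha 0 (snoc ha 1 u) - a ^ 2 • snoc ha 1 (snoc ha 0 u) := by
  change (TensorProduct.assoc ℂ (fundPow ha n) (fund ha) (fund ha)).symm (u ⊗ₜ[ℂ] bElt ha) =
    (u ⊗ₜ[ℂ] vec ha 1) ⊗ₜ[ℂ] vec ha 0 - a ^ 2 • ((u ⊗ₜ[ℂ] vec ha 0) ⊗ₜ[ℂ] vec ha 1)
  rw [bElt_eq]
  simp [TensorProduct.tmul_sub]

theorem diagLin_lastPos {n : ℕ} (e f : Fin 2) (u : fundPow ha n) :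
    diagLin ha (lastPos n) (snoc ha f (snoc ha e u)) = a • snoc ha f (snoc ha e u) +
      (a⁻¹ * dLin ha (vec ha e ⊗ₜ[ℂ] vec ha f)) •
        (snoc ha 0 (snoc ha 1 u) - a ^ 2 • snoc ha 1 (snoc ha 0 u)) := by
  have e1 (x : fundPow ha (n + 2)) : diagLin ha (lastPos n) x =
      a • x + a⁻¹ • diagLin ha (lastCup n) (diagLin ha (lastCap n) x) := rfl
  rw [e1, diagLin_lastCap, map_smul, diagLin_lastCup, smul_smul]

/-! ### The braiding -/

/-- One strand that carries `v_e`, crossing `m` strands. -/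
def passOne {m : ℕ} (e : Fin 2) : fundPow ha m →ₗ[ℂ] fundPow ha (m + 1) :=
  diagLin ha (crossOne m) ∘ₗ join ha (snoc ha e (one ha))

theorem passOne_apply {m : ℕ} (e : Fin 2) (w : fundPow ha m) :
    passOne ha e w = diagLin ha (crossOne m) (join ha (snoc ha e (one ha)) w) := rfl

theorem passOne_zero (e : Fin 2) : passOne ha (m := 0) e = snoc ha e :=
  pow_zero_ext ha (congrArg (diagLin ha (crossOne 0)) (join_one ha (snoc ha e (one ha))))

theorem passOne_snoc {m : ℕ} (e f : Fin 2) (w : fundPow ha m) : passOne ha e (snoc ha f w) =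
    diagLin ha (lastPos m) (snoc ha f (passOne ha e w)) := by
  rw [passOne_apply, join_snoc]
  exact (diagLin_comp ha _ _ _).trans (congrArg _ (diagLin_whiskerRight_snoc ha _ _ _))

variable {ha}

/-- A strand that carries `v_0` passes a vector of weight `j` with the factor `a ^ j`. -/
theorem HasWeight.passOne_zero {m : ℕ} {j : ℤ} {w : fundPow ha m} (h : HasWeight ha j w) :
    passOne ha 0 w = a ^ j • snoc ha 0 w := by
  have hz := ha.ne_zero
  induction m generalizing j with
  | zero =>
    by_cases hj : j = 0
    · subst hj
      rw [QuantumSL2.passOne_zero, zpow_zero, one_smul]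
    · rw [h.eq_zero (by simpa using hj)]
      simp
  | succ m ih =>
    refine h.eq_of_snoc (g := a ^ j • snoc ha 0) (fun u hu => ?_) (fun u hu => ?_)
    · rw [passOne_snoc, ih hu, map_smul, map_smul, diagLin_lastPos, dLin_vec, LinearMap.smul_apply,
        zpow_sub_one₀ hz]
      simp only [Matrix.of_apply, Matrix.cons_val_zero, mul_zero, zero_smul, add_zero, smul_smul]
      congr 1
      field_simp
    · rw [passOne_snoc, ih hu, map_smul, map_smul, diagLin_lastPos, dLin_vec, LinearMap.smul_apply,
        zpow_add_one₀ hz]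
      have h1 : a ^ j * a * (a⁻¹ * a ^ 2) = a ^ j * a * a := by field_simp
      have h2 : a ^ j * a * a⁻¹ = a ^ j := by field_simp
      simp only [Matrix.of_apply, Matrix.cons_val_zero, Matrix.cons_val_one, mul_one, smul_add,
        smul_sub, smul_smul, h1, h2]
      abel

/-- A strand that carries `v_1` can become `v_0` by lowering the vector that it passes. -/
theorem HasWeight.passOne_one {m : ℕ} {j : ℤ} {w : fundPow ha m} (h : HasWeight ha j w) :
    passOne ha 1 w = a ^ (-j) • snoc ha 1 w +
      ((a ^ 2 - (a ^ 2)⁻¹) * a ^ (j - 2)) • snoc ha 0 ((fundPow ha m).act .Y w) := by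
  have hz := ha.ne_zero
  induction m generalizing j with
  | zero =>
    have hY : (fundPow ha 0).act .Y w = 0 := by rw [act_pow_zero]; rfl
    rw [hY, map_zero, smul_zero, add_zero]
    by_cases hj : j = 0
    · subst hj
      rw [QuantumSL2.passOne_zero, neg_zero, zpow_zero, one_smul]
    · rw [h.eq_zero (by simpa using hj)]
      simp
  | succ m ih =>
    refine h.eq_of_snoc (g := a ^ (-j) • snoc ha 1 +
      ((a ^ 2 - (a ^ 2)⁻¹) * a ^ (j - 2)) • (snoc ha 0 ∘ₗ (fundPow ha (m + 1)).act .Y))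
      (fun u hu => ?_) (fun u hu => ?_)
    · have hK : (a ^ 2) ^ (-(j - 1)) = a ^ (-(j - 1)) * a ^ (-(j - 1)) := by rw [sq, mul_zpow]
      simp only [LinearMap.add_apply, LinearMap.smul_apply, LinearMap.comp_apply]
      rw [passOne_snoc, ih hu, map_add, map_smul, map_smul, map_add, map_smul, map_smul,
        diagLin_lastPos, diagLin_lastPos, dLin_vec, dLin_vec, act_Y_snoc_zero, hu.act_Kinv, hK, map_smul,
        map_add, map_smul]
      simp only [Matrix.of_apply, Matrix.cons_val_zero, Matrix.cons_val_one, mul_zero, zero_smul,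
        smul_add, smul_sub, smul_smul]
      match_scalars <;>
        simp only [neg_sub, zpow_sub₀ hz, zpow_neg, zpow_ofNat] <;> field_simp <;> ring
    · simp only [LinearMap.add_apply, LinearMap.smul_apply, LinearMap.comp_apply]
      rw [passOne_snoc, ih hu, map_add, map_smul, map_smul, map_add, map_smul, map_smul,
        diagLin_lastPos, diagLin_lastPos, dLin_vec, dLin_vec, act_Y_snoc_one]
      simp only [Matrix.of_apply, Matrix.cons_val_zero, Matrix.cons_val_one, mul_zero, zero_smul,
        smul_add, smul_sub, smul_smul]
      match_scalars <;>
        simp only [neg_add, zpow_sub₀ hz, zpow_add₀ hz, zpow_neg, zpow_ofNat] <;> field_simp <;> ring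

/-- The braiding without the flip, on the pure tensor `u ⊗ w`: the sum over the first `N` terms of
the `R`-matrix, for vectors `u` of weight `i` and `w` of weight `j`. -/
def braidSum {n m : ℕ} (N : ℕ) (i j : ℤ) (w : fundPow ha m) : fundPow ha n →ₗ[ℂ] fundPow ha (m + n) :=
  ∑ k ∈ Finset.range N, (rCoeff (a ^ 2) k * a ^ ((i + 2 * k) * (j - 2 * k))) •
    (join ha (((fundPow ha m).act .Y ^ k) w) ∘ₗ (fundPow ha n).act .X ^ k)

theorem braidSum_apply {n m : ℕ} (N : ℕ) (i j : ℤ) (w : fundPow ha m) (u : fundPow ha n) :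
    braidSum N i j w u =
      ∑ k ∈ Finset.range N, (rCoeff (a ^ 2) k * a ^ ((i + 2 * k) * (j - 2 * k))) •
        join ha (((fundPow ha m).act .Y ^ k) w) (((fundPow ha n).act .X ^ k) u) := by
  rw [braidSum, LinearMap.sum_apply]
  rfl

/-- The last of `n + 1` strands passes first. -/
theorem diagLin_cross_succ {n m : ℕ} (e : Fin 2) (u : fundPow ha n) (w : fundPow ha m) :
    diagLin ha (cross (n + 1) m) (join ha (snoc ha e u) w) =
      diagLin ha ((cross n m).whiskerRight 1) (join ha u (passOne ha e w)) := by
  have h1 : join ha (snoc ha e u) w = join ha (join ha u (snoc ha e (one ha))) w :=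
    congrArg (fun x => join ha (snoc ha e x) w) (join_one ha u).symm
  rw [passOne_apply, ← diagLin_whiskerLeft, ← join_assoc, h1]
  exact (diagLin_comp ha _ _ _).trans (diagLin_comp ha _ _ _)

theorem diagLin_cross_snoc {n m : ℕ} (f : Fin 2) (u : fundPow ha n) (w : fundPow ha m) :
    diagLin ha ((cross n m).whiskerRight 1) (join ha u (snoc ha f w)) =
      snoc ha f (diagLin ha (cross n m) (join ha u w)) :=
  diagLin_whiskerRight_snoc ha _ _ _

/-- The sum over the `R`-matrix may be cut off anywhere after `X ^ (n + 1) = 0`. -/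
theorem braidSum_eq {n m N : ℕ} (hN : n + 1 ≤ N) (i j : ℤ) (u : fundPow ha n) (w : fundPow ha m) :
    braidSum N i j w u = braidSum (n + 1) i j w u := by
  rw [braidSum_apply, braidSum_apply]
  refine (Finset.sum_subset (Finset.range_mono hN) fun k _ hk => ?_).symm
  obtain ⟨l, rfl⟩ := Nat.exists_eq_add_of_le (not_lt.1 (fun h => hk (Finset.mem_range.2 h)))
  rw [add_comm (n + 1) l, pow_add ((fundPow ha n).act .X), Module.End.mul_apply,
    act_X_pow_eq_zero, map_zero, map_zero, smul_zero]

theorem braidSum_snoc_zero {n m : ℕ} {j : ℤ} (N : ℕ) (i : ℤ) (u : fundPow ha n)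
    (w : fundPow ha m) :
    braidSum N (i + 1) j w (snoc ha 0 u) = a ^ j • snoc ha 0 (braidSum N i j w u) := by
  have hz := ha.ne_zero
  rw [braidSum_apply, braidSum_apply, map_sum, Finset.smul_sum]
  refine Finset.sum_congr rfl fun k _ => ?_
  rw [act_X_pow_snoc_zero, map_smul, map_smul, join_snoc, smul_smul, smul_smul]
  congr 1
  rw [← pow_mul, ← zpow_natCast a (2 * k), mul_assoc, ← zpow_add₀ hz, mul_left_comm,
    ← zpow_add₀ hz]
  congr 2
  push_cast
  ring

/-- The recursion of the coefficients of the `R`-matrix, applied to vectors: at a root of unity it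
fails for the first `k` with `[k] = 0`, but then `Y ^ k` vanishes. -/
theorem rCoeff_succ_smul {m : ℕ} (k : ℕ) (w : fundPow ha m) :
    (rCoeff (a ^ 2) (k + 1) * qInt (a ^ 2) (k + 1)) • ((fundPow ha m).act .Y ^ (k + 1)) w =
      ((a ^ 2) ^ k * (a ^ 2 - (a ^ 2)⁻¹) * rCoeff (a ^ 2) k) •
        ((fundPow ha m).act .Y ^ (k + 1)) w := by
  by_cases h : qInt (a ^ 2) (k + 1) = 0
  · rw [act_Y_pow_eq_zero ha m k h, smul_zero, smul_zero]
  · rw [rCoeff_succ k h]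

/-- The inductive step for `v_1`: `X ^ k` on `u ⊗ v_1` has a second term with `[k] X ^ (k - 1)`, which
matches the lowered term of `HasWeight.passOne_one` by the recursion of the coefficients. -/
theorem braidSum_snoc_one {n m : ℕ} {j : ℤ} (N : ℕ) (i : ℤ) (u : fundPow ha n)
    (w : fundPow ha m) :
    braidSum (N + 1) (i - 1) j w (snoc ha 1 u) = a ^ (-j) • snoc ha 1 (braidSum (N + 1) i j w u) +
      ((a ^ 2 - (a ^ 2)⁻¹) * a ^ (j - 2)) •
        snoc ha 0 (braidSum N i (j - 2) ((fundPow ha m).act .Y w) u) := by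
  have hz := ha.ne_zero
  have h1 : ∀ k : ℕ, (rCoeff (a ^ 2) k * a ^ ((i - 1 + 2 * k) * (j - 2 * k))) •
      join ha (((fundPow ha m).act .Y ^ k) w) (((fundPow ha (n + 1)).act .X ^ k) (snoc ha 1 u)) =
      a ^ (-j) • snoc ha 1 ((rCoeff (a ^ 2) k * a ^ ((i + 2 * k) * (j - 2 * k))) •
        join ha (((fundPow ha m).act .Y ^ k) w) (((fundPow ha n).act .X ^ k) u)) +
      (rCoeff (a ^ 2) k * a ^ ((i - 1 + 2 * k) * (j - 2 * k)) * qInt (a ^ 2) k) •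
        snoc ha 0 (join ha (((fundPow ha m).act .Y ^ k) w)
          (((fundPow ha n).act .X ^ (k - 1)) u)) := by
    intro k
    rw [act_X_pow_snoc_one, map_add, map_smul, map_smul, join_snoc, join_snoc, smul_add, smul_smul,
      smul_smul, map_smul, smul_smul]
    congr 2
    rw [← pow_mul, ← zpow_natCast a (2 * k), ← zpow_neg, mul_assoc, ← zpow_add₀ hz, mul_left_comm,
      ← zpow_add₀ hz]
    congr 2
    push_cast
    ring
  have h2 : ∀ k : ℕ, (rCoeff (a ^ 2) (k + 1) * a ^ ((i - 1 + 2 * (k + 1 : ℕ)) *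
      (j - 2 * (k + 1 : ℕ))) * qInt (a ^ 2) (k + 1)) •
        snoc ha 0 (join ha (((fundPow ha m).act .Y ^ (k + 1)) w)
          (((fundPow ha n).act .X ^ k) u)) =
      ((a ^ 2 - (a ^ 2)⁻¹) * a ^ (j - 2)) • snoc ha 0 (
        (rCoeff (a ^ 2) k * a ^ ((i + 2 * k) * (j - 2 - 2 * k))) •
        join ha (((fundPow ha m).act .Y ^ k) ((fundPow ha m).act .Y w))
          (((fundPow ha n).act .X ^ k) u)) := by
    intro k
    have e1 := congrArg (fun x => a ^ ((i - 1 + 2 * (k + 1 : ℕ)) * (j - 2 * (k + 1 : ℕ))) •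
      snoc ha 0 (join ha x (((fundPow ha n).act .X ^ k) u))) (rCoeff_succ_smul k w)
    simp only [map_smul, LinearMap.smul_apply, smul_smul] at e1
    rw [mul_right_comm, mul_comm, e1, map_smul, smul_smul, pow_succ ((fundPow ha m).act .Y),
      Module.End.mul_apply]
    congr 1
    have e2 : a ^ ((i - 1 + 2 * (k + 1 : ℕ)) * (j - 2 * (k + 1 : ℕ))) * (a ^ 2) ^ k =
        a ^ (j - 2) * a ^ ((i + 2 * k) * (j - 2 - 2 * k)) := by
      rw [← pow_mul, ← zpow_natCast a (2 * k), ← zpow_add₀ hz, ← zpow_add₀ hz]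
      congr 1
      push_cast
      ring
    linear_combination (a ^ 2 - (a ^ 2)⁻¹) * rCoeff (a ^ 2) k * e2
  rw [braidSum_apply, braidSum_apply, braidSum_apply, Finset.sum_congr rfl fun k _ => h1 k, Finset.sum_add_distrib, map_sum, Finset.smul_sum,
    map_sum, Finset.smul_sum]
  congr 1
  rw [Finset.sum_range_succ']
  refine (congrArg₂ _ (Finset.sum_congr rfl fun k _ => h2 k) ?_).trans (add_zero _)
  simp [qInt]

/-- The diagram in which `n` strands cross `m` strands acts by the `R`-matrix and the flip. -/
theorem HasWeight.diagLin_cross {n m : ℕ} {i j : ℤ} {u : fundPow ha n} {w : fundPow ha m}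
    (hu : HasWeight ha i u) (hw : HasWeight ha j w) :
    diagLin ha (cross n m) (join ha u w) = braidSum (n + 1) i j w u := by
  have hz := ha.ne_zero
  induction n generalizing i j w with
  | zero =>
    rw [braidSum_apply, Finset.sum_range_one]
    by_cases hi : i = 0
    · subst hi
      have key : diagLin ha (cross 0 m) ∘ₗ (join ha).flip w = join ha w :=
        pow_zero_ext ha ((one_join ha w).trans (join_one ha w).symm)
      have := LinearMap.congr_fun key u
      simpa [rCoeff_zero] using this
    · rw [hu.eq_zero (by simpa using hi)]
      simp
  | succ n ih =>
    have hw' := hw.act_Y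
    refine hu.eq_of_snoc (f := diagLin ha (cross (n + 1) m) ∘ₗ (join ha).flip w)
      (g := braidSum (n + 2) i j w) (fun u hu => ?_) (fun u hu => ?_)
    · have h := braidSum_snoc_zero (j := j) (n + 2) (i - 1) u w
      rw [braidSum_eq (n + 1).le_succ, sub_add_cancel] at h
      rw [h, ← ih hu hw]
      refine (diagLin_cross_succ 0 u w).trans ?_
      rw [hw.passOne_zero, map_smul, map_smul, diagLin_cross_snoc]
    · have h := braidSum_snoc_one (j := j) (n + 1) (i + 1) u w
      rw [braidSum_eq (n + 1).le_succ, add_sub_cancel_right] at h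
      rw [h, ← ih hu hw, ← ih hu hw']
      refine (diagLin_cross_succ 1 u w).trans ?_
      rw [hw.passOne_one, map_add, map_smul, map_smul, map_add, map_smul, map_smul,
        diagLin_cross_snoc, diagLin_cross_snoc]

end QuantumSL2

namespace QuantumSL2

open TemperleyLieb UqMod
open scoped TensorProduct

variable {a : ℂ} (ha : Admissible a)

/-! ### The pairing of `V^{⊗ n}` with itself -/

/-- The linear map `u ↦ v_e ⊗ u` from `V^{⊗ n}` to `V^{⊗ (n + 1)}`. -/
def cons {n : ℕ} (e : Fin 2) : fundPow ha n →ₗ[ℂ] fundPow ha (n + 1) :=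
  toLin (fundPowShift ha n).inv ∘ₗ TensorProduct.mk ℂ (fund ha) (fundPow ha n) (vec ha e)

theorem cons_one (e : Fin 2) : cons ha e (one ha) = snoc ha e (one ha) :=
  congrArg (fun v => TensorProduct.mk ℂ ℂ (fund ha) 1 v) (one_smul ℂ (vec ha e))

theorem cons_snoc {n : ℕ} (e f : Fin 2) (u : fundPow ha n) :
    cons ha e (snoc ha f u) = snoc ha f (cons ha e u) := rfl

theorem cons_ext {n : ℕ} {M : Type*} [AddCommGroup M] [Module ℂ M]
    {f g : fundPow ha (n + 1) →ₗ[ℂ] M} (h : ∀ e u, f (cons ha e u) = g (cons ha e u)) : f = g := by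
  have h1 : f ∘ₗ toLin (fundPowShift ha n).inv = g ∘ₗ toLin (fundPowShift ha n).inv :=
    TensorProduct.ext (fund_ext ha fun e => LinearMap.ext fun u => h e u)
  have h2 (x : fundPow ha (n + 1)) :
      toLin (fundPowShift ha n).inv (toLin (fundPowShift ha n).hom x) = x :=
    LinearMap.congr_fun (congrArg toLin (fundPowShift ha n).hom_inv_id) x
  exact LinearMap.ext fun x => (congrArg f (h2 x)).symm.trans
    ((LinearMap.congr_fun h1 (toLin (fundPowShift ha n).hom x)).trans (congrArg g (h2 x)))

/-- A factor `v_e` may be regarded as the first of the right vector or the last of the left one. -/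
theorem join_cons {n m : ℕ} (u : fundPow ha n) (e : Fin 2) (y : fundPow ha m)
    (h : n + (m + 1) = n + 1 + m) :
    diagLin ha (Diagram.vert h) (join ha u (cons ha e y)) = join ha (snoc ha e u) y := by
  induction m with
  | zero =>
    have : diagLin ha (Diagram.vert h) ∘ₗ join ha u ∘ₗ cons ha e = join ha (snoc ha e u) :=
      pow_zero_ext ha (by
        rw [LinearMap.comp_apply, LinearMap.comp_apply, cons_one, join_snoc, join_one, join_one]
        rfl)
    exact LinearMap.congr_fun this y
  | succ m ih =>
    have h' : n + (m + 1) = n + 1 + m := by omega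
    have : diagLin ha (Diagram.vert h) ∘ₗ join ha u ∘ₗ cons ha e = join ha (snoc ha e u) :=
      pow_succ_ext ha fun f => LinearMap.ext fun y => by
        simp only [LinearMap.comp_apply]
        rw [cons_snoc, join_snoc, join_snoc, ← ih y h']
        exact diagLin_vert_snoc ha h' h f _
    exact LinearMap.congr_fun this y

/-- The pairing of `V^{⊗ n}` with itself given by `α^{⊗ n}`. -/
def pairing {n : ℕ} : fundPow ha n →ₗ[ℂ] Module.Dual ℂ (fundPow ha n) :=
  toLin (alphaPow ha n).hom

theorem pairing_one : pairing ha (one ha) (one ha) = 1 := mul_one (1 : ℂ)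

/-- The pairing in terms of the outer tensor factors, which is how `α^{⊗ n}` is defined. -/
theorem pairing_cons_snoc {n : ℕ} (e f : Fin 2) (u w : fundPow ha n) :
    pairing ha (cons ha e u) (snoc ha f w) =
      dLin ha (vec ha e ⊗ₜ[ℂ] vec ha f) * pairing ha u w := by
  have h : toLin (fundPowShift ha n).hom (cons ha e u) = vec ha e ⊗ₜ[ℂ] u :=
    LinearMap.congr_fun (congrArg toLin (fundPowShift ha n).inv_hom_id) (vec ha e ⊗ₜ[ℂ] u)
  let δ : fund ha ⊗[ℂ] fundPow ha n →ₗ[ℂ] Module.Dual ℂ (fundPow ha (n + 1)) :=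
    toLin ((alpha ha ⊗ᵢ alphaPow ha n) ≪≫ dualTensorIso (fundPow ha n) (fund ha)).hom
  have h2 : pairing ha (cons ha e u) = δ (vec ha e ⊗ₜ[ℂ] u) := congrArg δ h
  rw [h2]
  exact mul_comm (pairing ha u w) (dLin ha (vec ha e ⊗ₜ[ℂ] vec ha f))

/-- The pairing in terms of the inner tensor factors, which is how nested caps are built. -/
theorem pairing_snoc_cons {n : ℕ} (e f : Fin 2) (u w : fundPow ha n) :
    pairing ha (snoc ha e u) (cons ha f w) =
      dLin ha (vec ha e ⊗ₜ[ℂ] vec ha f) * pairing ha u w := by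
  induction n with
  | zero =>
    have : (pairing ha).compl₁₂ (snoc ha e) (cons ha f) =
        dLin ha (vec ha e ⊗ₜ[ℂ] vec ha f) • (pairing ha (n := 0)) := by
      refine pow_zero_ext ha (pow_zero_ext ha ?_)
      rw [LinearMap.compl₁₂_apply, ← cons_one, cons_one ha f, pairing_cons_snoc]
      rfl
    exact LinearMap.congr_fun₂ this u w
  | succ n ih =>
    have : (pairing ha).compl₁₂ (snoc ha e) (cons ha f) =
        dLin ha (vec ha e ⊗ₜ[ℂ] vec ha f) • (pairing ha (n := n + 1)) := by
      refine cons_ext ha fun e' u => pow_succ_ext ha fun f' => LinearMap.ext fun w => ?_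
      rw [LinearMap.comp_apply, LinearMap.compl₁₂_apply, ← cons_snoc, cons_snoc ha f f' w,
        pairing_cons_snoc, ih, LinearMap.comp_apply, LinearMap.smul_apply, LinearMap.smul_apply,
        pairing_cons_snoc, smul_eq_mul]
      ring
    exact LinearMap.congr_fun₂ this u w

/-! ### The nested caps -/

/-- The innermost cap, as a cap on the last strands with `n` more strands added on the right. -/
theorem caps_succ (n : ℕ) : caps (n + 1) =
    ((Diagram.vert (l := n + 2 + n) (by omega)).comp ((lastCap n).whiskerRight n)).comp (caps n) := by
  refine Diagram.ext ?_
  simp [caps, Diagram.comp, Diagram.vert, lastCap, Diagram.whiskerRight, Slice.shift]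

theorem cups_succ (n : ℕ) : cups (n + 1) =
    (cups n).comp (((lastCup n).whiskerRight n).comp
      (Diagram.vert (k := n + 2 + n) (by omega))) := by
  refine Diagram.ext ?_
  simp [cups, Diagram.comp, Diagram.vert, lastCup, Diagram.whiskerRight, Slice.shift]

/-- The nested caps evaluate the pairing. -/
theorem diagLin_caps {n : ℕ} (u w : fundPow ha n) :
    diagLin ha (caps n) (join ha u w) = pairing ha u w • one ha := by
  induction n with
  | zero =>
    have : (join ha).compr₂ (diagLin ha (caps 0)) =
        (pairing ha (n := 0)).compr₂ (LinearMap.toSpanSingleton ℂ _ (one ha)) := by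
      refine pow_zero_ext ha (pow_zero_ext ha ?_)
      rw [LinearMap.compr₂_apply, LinearMap.compr₂_apply, pairing_one, join_one]
      exact (one_smul ℂ (one ha)).symm
    exact LinearMap.congr_fun₂ this u w
  | succ n ih =>
    have : (join ha).compr₂ (diagLin ha (caps (n + 1))) =
        (pairing ha (n := n + 1)).compr₂ (LinearMap.toSpanSingleton ℂ _ (one ha)) := by
      refine pow_succ_ext ha fun e => LinearMap.ext fun u => cons_ext ha fun f w => ?_
      simp only [LinearMap.comp_apply, LinearMap.compr₂_apply, LinearMap.toSpanSingleton_apply]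
      rw [caps_succ, diagLin_comp, diagLin_comp, pairing_snoc_cons, mul_smul, ← ih, ← map_smul]
      have h := join_cons ha (snoc ha e u) f w (by omega)
      refine congrArg (diagLin ha (caps n)) ((congrArg _ h).trans ?_)
      rw [diagLin_whiskerRight, diagLin_lastCap, map_smul, LinearMap.smul_apply]
    exact LinearMap.congr_fun₂ this u w

/-! ### The nested cups -/

/-- The image of `1` under the nested cups, as an element of `V^{⊗ n} ⊗ V^{⊗ n}`. -/
def cupsElt (n : ℕ) : fundPow ha n ⊗[ℂ] fundPow ha n :=
  toLin (powMul ha n n).inv (diagLin ha (cups n) (one ha))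

/-- The juxtaposition as a linear map on the tensor product. -/
def joinLin (n m : ℕ) : fundPow ha n ⊗[ℂ] fundPow ha m →ₗ[ℂ] fundPow ha (n + m) :=
  TensorProduct.lift (join ha)

theorem joinLin_eq (n m : ℕ) : joinLin ha n m = toLin (powMul ha n m).hom :=
  TensorProduct.ext' fun _ _ => rfl

theorem joinLin_tmul {n m : ℕ} (u : fundPow ha n) (w : fundPow ha m) :
    joinLin ha n m (u ⊗ₜ[ℂ] w) = join ha u w := TensorProduct.lift.tmul _ _

theorem joinLin_injective (n m : ℕ) : Function.Injective (joinLin ha n m) := by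
  rw [joinLin_eq]
  exact Function.LeftInverse.injective (g := toLin (powMul ha n m).inv) fun x =>
    LinearMap.congr_fun (congrArg toLin (powMul ha n m).hom_inv_id) x

theorem joinLin_cupsElt (n : ℕ) : joinLin ha n n (cupsElt ha n) = diagLin ha (cups n) (one ha) := by
  rw [joinLin_eq]
  exact LinearMap.congr_fun (congrArg toLin (powMul ha n n).inv_hom_id) _

/-- The contraction of the second factor of a tensor against `y`. -/
def contract {n : ℕ} :
    fundPow ha n →ₗ[ℂ] fundPow ha n ⊗[ℂ] fundPow ha n →ₗ[ℂ] fundPow ha n :=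
  (TensorProduct.rid ℂ (fundPow ha n)).toLinearMap.compRight ℂ ∘ₗ
    TensorProduct.mapBilinear (RingHom.id ℂ) (fundPow ha n) (fundPow ha n) (fundPow ha n) ℂ
      LinearMap.id ∘ₗ (pairing ha).flip

theorem contract_tmul {n : ℕ} (y u w : fundPow ha n) :
    contract ha y (u ⊗ₜ[ℂ] w) = pairing ha w y • u := rfl

/-- The insertion of a cup between the two factors of a tensor. -/
def nest (n : ℕ) : fundPow ha n ⊗[ℂ] fundPow ha n →ₗ[ℂ] fundPow ha (n + 1) ⊗[ℂ] fundPow ha (n + 1) :=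
  TensorProduct.map (snoc ha 1) (cons ha 0) - a ^ 2 • TensorProduct.map (snoc ha 0) (cons ha 1)

theorem nest_tmul {n : ℕ} (u w : fundPow ha n) : nest ha n (u ⊗ₜ[ℂ] w) =
    snoc ha 1 u ⊗ₜ[ℂ] cons ha 0 w - a ^ 2 • (snoc ha 0 u ⊗ₜ[ℂ] cons ha 1 w) := rfl

theorem cupsElt_succ (n : ℕ) : cupsElt ha (n + 1) = nest ha n (cupsElt ha n) := by
  apply joinLin_injective ha
  have key : diagLin ha (((lastCup n).whiskerRight n).comp
      (Diagram.vert (k := n + 2 + n) (l := n + 1 + (n + 1)) (by omega))) ∘ₗ joinLin ha n n =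
      joinLin ha (n + 1) (n + 1) ∘ₗ nest ha n := by
    refine TensorProduct.ext' fun u w => ?_
    have h (e f : Fin 2) : diagLin ha (Diagram.vert (k := n + 2 + n) (l := n + 1 + (n + 1))
        (by omega)) (join ha (snoc ha f (snoc ha e u)) w) =
          join ha (snoc ha e u) (cons ha f w) := by
      rw [← join_cons ha (snoc ha e u) f w (by omega)]
      exact diagLin_vert_vert ha _ _ _
    rw [LinearMap.comp_apply, LinearMap.comp_apply, nest_tmul, map_sub, map_smul, joinLin_tmul,
      joinLin_tmul, joinLin_tmul, diagLin_comp, diagLin_whiskerRight, diagLin_lastCup, map_sub,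
      map_smul, LinearMap.sub_apply, LinearMap.smul_apply, map_sub, map_smul, h, h]
  rw [← LinearMap.comp_apply, ← key, LinearMap.comp_apply, joinLin_cupsElt, joinLin_cupsElt,
    cups_succ, diagLin_comp]

theorem contract_snoc_nest {n : ℕ} (f : Fin 2) (y : fundPow ha n)
    (x : fundPow ha n ⊗[ℂ] fundPow ha n) :
    contract ha (snoc ha f y) (nest ha n x) = snoc ha f (contract ha y x) := by
  have key : contract ha (snoc ha f y) ∘ₗ nest ha n = snoc ha f ∘ₗ contract ha y := by
    refine TensorProduct.ext' fun u w => ?_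
    rw [LinearMap.comp_apply, LinearMap.comp_apply, nest_tmul, map_sub, map_smul, contract_tmul,
      contract_tmul, contract_tmul, pairing_cons_snoc, pairing_cons_snoc, dLin_vec, dLin_vec,
      map_smul, smul_smul]
    have hq := ha.q_ne_zero
    fin_cases f
    · simp [← mul_assoc, mul_inv_cancel₀ hq]
    · simp
  exact LinearMap.congr_fun key x

/-- The nested cups are dual to the pairing. -/
theorem contract_cupsElt {n : ℕ} (y : fundPow ha n) : contract ha y (cupsElt ha n) = y := by
  have key : (contract ha).flip (cupsElt ha n) = LinearMap.id := by
    induction n with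
    | zero =>
      have h : cupsElt ha 0 = one ha ⊗ₜ[ℂ] one ha := by
        apply joinLin_injective ha
        rw [joinLin_cupsElt, joinLin_tmul, join_one]
        rfl
      refine pow_zero_ext ha ?_
      rw [LinearMap.flip_apply, h, contract_tmul, pairing_one, one_smul]
      rfl
    | succ n ih =>
      refine pow_succ_ext ha fun f => LinearMap.ext fun y => ?_
      have hy : contract ha y (cupsElt ha n) = y := LinearMap.congr_fun (ih y) y
      rw [LinearMap.comp_apply, LinearMap.flip_apply, cupsElt_succ, contract_snoc_nest, hy]
      rfl
  exact LinearMap.congr_fun key y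

/-! ### The twist -/

/-- The operator `(-1) ^ n K` turns the pairing into its transpose. -/
theorem pairing_act_K {n : ℕ} (u w : fundPow ha n) :
    pairing ha w ((fundPow ha n).act .K u) = (-1) ^ n * pairing ha u w := by
  have key : (pairing ha).flip ∘ₗ (fundPow ha n).act .K = (-1 : ℂ) ^ n • pairing ha := by
    induction n with
    | zero =>
      have hK : (fundPow ha 0).act .K (one ha) = one ha := by rw [act_pow_zero]; rfl
      refine pow_zero_ext ha (pow_zero_ext ha ?_)
      rw [LinearMap.comp_apply, hK, pow_zero, one_smul]
      rfl
    | succ n ih =>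
      refine pow_succ_ext ha fun f => LinearMap.ext fun u => cons_ext ha fun e w => ?_
      have hu : pairing ha w ((fundPow ha n).act .K u) = (-1) ^ n * pairing ha u w :=
        LinearMap.congr_fun₂ (ih u w) u w
      simp only [LinearMap.comp_apply, LinearMap.smul_apply, LinearMap.flip_apply]
      rw [act_K_snoc, map_smul, pairing_cons_snoc, pairing_snoc_cons, hu, dLin_vec, dLin_vec,
        smul_eq_mul, smul_eq_mul, pow_succ (-1 : ℂ)]
      have hz := ha.ne_zero
      fin_cases e <;> fin_cases f <;> simp [fundMatrix] <;> field_simp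
  exact LinearMap.congr_fun₂ key u w

variable {ha}

/-- The operator that multiplies vectors of weight `j` by `a ^ (s * j)`. -/
def weightScale (n : ℕ) (s : ℤ) : Module.End ℂ (fundPow ha n) :=
  ∑ j ∈ Finset.Icc (-n : ℤ) n, a ^ (s * j) • weightProj ha n j

theorem HasWeight.sum_weightProj {n : ℕ} {M : Type*} [AddCommGroup M] [Module ℂ M] {j : ℤ}
    {w : fundPow ha n} (h : HasWeight ha j w) (g : ℤ → fundPow ha n →ₗ[ℂ] M) :
    ∑ i ∈ Finset.Icc (-n : ℤ) n, g i (weightProj ha n i w) = g j w := by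
  by_cases hj : j ∈ Finset.Icc (-n : ℤ) n
  · rw [Finset.sum_eq_single_of_mem j hj fun i _ hi => by rw [h, if_neg hi, map_zero], h.proj_self]
  · rw [h.eq_zero hj]
    simp

theorem HasWeight.weightScale {n : ℕ} {j : ℤ} {w : fundPow ha n} (h : HasWeight ha j w) (s : ℤ) :
    weightScale n s w = a ^ (s * j) • w := by
  have := h.sum_weightProj (fun i => a ^ (s * i) • LinearMap.id)
  rw [QuantumSL2.weightScale, LinearMap.sum_apply]
  exact this

/-- The second factor of the `k`-th term of the `R`-matrix, applied to a vector of weight `i` in the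
first factor: it multiplies by `q ^ (H ⊗ H / 2)` as well, where the first factor has weight
`i + 2k` after the action of `X ^ k`. -/
def rightFactor (n : ℕ) (i : ℤ) (k : ℕ) : Module.End ℂ (fundPow ha n) :=
  rCoeff (a ^ 2) k • (weightScale n (i + 2 * k) * (fundPow ha n).act .Y ^ k)

theorem HasWeight.rightFactor {n : ℕ} {j : ℤ} {w : fundPow ha n} (h : HasWeight ha j w) (i : ℤ)
    (k : ℕ) : rightFactor n i k w =
      (rCoeff (a ^ 2) k * a ^ ((i + 2 * k) * (j - 2 * k))) • ((fundPow ha n).act .Y ^ k) w := by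
  rw [QuantumSL2.rightFactor, LinearMap.smul_apply, Module.End.mul_apply,
    (h.act_Y_pow k).weightScale, smul_smul]

/-- The braiding as a sum over `k` of linear maps in the second argument. -/
theorem HasWeight.diagLin_cross_right {n m : ℕ} {i : ℤ} {u : fundPow ha n} (hu : HasWeight ha i u)
    (w : fundPow ha m) : diagLin ha (cross n m) (join ha u w) =
      ∑ k ∈ Finset.range (n + 1),
        join ha (QuantumSL2.rightFactor m i k w) (((fundPow ha n).act .X ^ k) u) := by
  have key : diagLin ha (cross n m) ∘ₗ join ha u = ∑ k ∈ Finset.range (n + 1),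
      (join ha).flip (((fundPow ha n).act .X ^ k) u) ∘ₗ QuantumSL2.rightFactor m i k := by
    refine weight_ext fun j w hw => ?_
    rw [LinearMap.comp_apply, hu.diagLin_cross hw, braidSum_apply, LinearMap.sum_apply]
    refine Finset.sum_congr rfl fun k _ => ?_
    rw [LinearMap.comp_apply, LinearMap.flip_apply, hw.rightFactor, map_smul,
      LinearMap.smul_apply]
  have := LinearMap.congr_fun key w
  rw [LinearMap.sum_apply] at this
  exact this

/-- The curl of `n` strands: the contraction of the nested cups by the pairing brings the factor `s`
of the `R`-matrix, multiplied by `(-1) ^ n K`, in front of the factor `t`. -/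
theorem HasWeight.diagLin_curl {n : ℕ} {i : ℤ} {u : fundPow ha n} (hu : HasWeight ha i u) :
    diagLin ha (curl n) u = (-1 : ℂ) ^ n • modTwist ha n u := by
  have h1 : modTwist ha n u = ∑ k ∈ Finset.range (n + 1),
      QuantumSL2.rightFactor n i k ((fundPow ha n).act .K (((fundPow ha n).act .X ^ k) u)) := by
    rw [modTwist, LinearMap.sum_apply]
    refine Finset.sum_congr rfl fun k _ => ?_
    rw [LinearMap.sum_apply]
    have := hu.sum_weightProj (fun i =>
      (rCoeff (a ^ 2) k * a ^ (i * (i + 2 * k)) * (a ^ 2) ^ (i + 2 * k)) •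
        ((fundPow ha n).act .Y ^ k * (fundPow ha n).act .X ^ k))
    refine this.trans ?_
    rw [(hu.act_X_pow k).act_K, map_smul, (hu.act_X_pow k).rightFactor, smul_smul,
      add_sub_cancel_right, LinearMap.smul_apply, Module.End.mul_apply, mul_comm i,
      mul_comm ((a ^ 2) ^ (i + 2 * (k : ℤ)))]
  have h2 : ∀ z : fundPow ha n ⊗[ℂ] fundPow ha n,
      diagLin ha ((caps n).whiskerLeft n) (diagLin ha (Diagram.vert (Nat.add_assoc n n n))
        (diagLin ha ((cross n n).whiskerRight n)
          (diagLin ha (Diagram.vert (Nat.add_assoc n n n).symm) (join ha u (joinLin ha n n z))))) =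
      ∑ k ∈ Finset.range (n + 1), (-1 : ℂ) ^ n • QuantumSL2.rightFactor n i k
        (contract ha ((fundPow ha n).act .K (((fundPow ha n).act .X ^ k) u)) z) := by
    intro z
    induction z using TensorProduct.induction_on with
    | zero => simp
    | add x y hx hy => simp only [map_add, smul_add, Finset.sum_add_distrib, hx, hy]
    | tmul v w =>
      rw [joinLin_tmul, ← join_assoc, diagLin_vert_vert, diagLin_vert, diagLin_whiskerRight,
        hu.diagLin_cross_right, map_sum, LinearMap.sum_apply, map_sum, map_sum]
      refine Finset.sum_congr rfl fun k _ => ?_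
      rw [join_assoc, diagLin_whiskerLeft, diagLin_caps, map_smul, join_one, contract_tmul,
        pairing_act_K, map_smul, smul_smul, ← mul_assoc, ← mul_pow]
      simp
  have h3 := h2 (cupsElt ha n)
  simp only [contract_cupsElt] at h3
  rw [h1, Finset.smul_sum, ← h3, joinLin_cupsElt, ← diagLin_whiskerLeft, join_one, curl,
    diagLin_comp, diagLin_comp, diagLin_comp, diagLin_comp]

end QuantumSL2

namespace QuantumSL2

open TemperleyLieb UqMod
open scoped TensorProduct
open Functor.LaxMonoidal Functor.OplaxMonoidal Functor.Monoidal

variable {a : ℂ} {ha : Admissible a}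

/-! ### The values of a functor at the structure morphisms -/

/-- The braiding of modules is the map of the crossing diagram. -/
theorem joinLin_modBraiding {n m : ℕ} (x : fundPow ha n ⊗[ℂ] fundPow ha m) :
    joinLin ha m n (modBraiding ha n m x) = diagLin ha (cross n m) (joinLin ha n m x) := by
  have key : joinLin ha m n ∘ₗ modBraiding ha n m = diagLin ha (cross n m) ∘ₗ joinLin ha n m := by
    refine TensorProduct.ext (weight_ext fun i u hu => weight_ext fun j w hw => ?_)
    have hR : modBraiding ha n m (u ⊗ₜ[ℂ] w) =
        ∑ k ∈ Finset.range (n + 1), (rCoeff (a ^ 2) k * a ^ ((i + 2 * k) * (j - 2 * k))) •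
          ((((fundPow ha m).act .Y ^ k) w) ⊗ₜ[ℂ] (((fundPow ha n).act .X ^ k) u)) := by
      rw [modBraiding, LinearMap.comp_apply, LinearMap.comp_apply, quasiR, LinearMap.sum_apply,
        map_sum, map_sum]
      refine Finset.sum_congr rfl fun k _ => ?_
      rw [LinearMap.smul_apply, TensorProduct.map_tmul, map_smul, map_smul, mul_smul]
      congr 1
      have hu' := hu.act_X_pow k
      have hw' := hw.act_Y_pow k
      generalize ((fundPow ha n).act .X ^ k) u = u' at *
      generalize ((fundPow ha m).act .Y ^ k) w = w' at *
      have : cartanR ha n m (u' ⊗ₜ[ℂ] w') =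
          a ^ ((i + 2 * k) * (j - 2 * k)) • (u' ⊗ₜ[ℂ] w') := by
        rw [cartanR, LinearMap.sum_apply]
        have h1 := hu'.sum_weightProj (fun i => a ^ (i * (j - 2 * k)) •
          (TensorProduct.mk ℂ (fundPow ha n) (fundPow ha m)).flip w')
        refine Eq.trans (Finset.sum_congr rfl fun i _ => ?_) h1
        rw [LinearMap.sum_apply]
        exact hw'.sum_weightProj (fun j => a ^ (i * j) •
          TensorProduct.mk ℂ (fundPow ha n) (fundPow ha m) (weightProj ha n i u'))
      rw [this, map_smul]
      rfl
    change joinLin ha m n (modBraiding ha n m (u ⊗ₜ[ℂ] w)) =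
      diagLin ha (cross n m) (joinLin ha n m (u ⊗ₜ[ℂ] w))
    rw [hR, map_sum, joinLin_tmul, hu.diagLin_cross hw, braidSum_apply]
    refine Finset.sum_congr rfl fun k _ => ?_
    rw [map_smul, joinLin_tmul]
  exact LinearMap.congr_fun key x

theorem hom_eq_comp_inv {C : Type*} [Category C] {A B P : C} {t : A ≅ B} {p : B ≅ P} {o : A ≅ P}
    (h : t.hom ≫ p.hom = o.hom) : t.hom = o.hom ≫ p.inv :=
  (Iso.eq_comp_inv _).2 h

theorem inv_eq_comp_inv {C : Type*} [Category C] {A B P : C} {t : A ≅ B} {p : B ≅ P} {o : A ≅ P}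
    (h : t.hom ≫ p.hom = o.hom) : t.inv = p.hom ≫ o.inv := by
  rw [Iso.eq_comp_inv, ← h, Iso.inv_hom_id_assoc]

/-- Conjugation by the identifications of `F(X)` and `F(Y)` with the values of another functor. -/
theorem conj_eq {C : Type*} [Category C] {A B P A' B' P' : C} {t : A ≅ B} {p : B ≅ P} {o : A ≅ P}
    {t' : A' ≅ B'} {p' : B' ≅ P'} {o' : A' ≅ P'} (h : t.hom ≫ p.hom = o.hom)
    (h' : t'.hom ≫ p'.hom = o'.hom) {f : A ⟶ A'} {g : P ⟶ P'} (hf : f = o.hom ≫ g ≫ o'.inv) :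
    t.inv ≫ f ≫ t'.hom = p.hom ≫ g ≫ p'.inv := by
  rw [hf, inv_eq_comp_inv h, hom_eq_comp_inv h']
  simp

namespace TensorFunctor

variable (F : TensorFunctor ha)

theorem map_braiding (n m : ℕ) : toLin ((F.tensorIso n m).inv ≫
    F.functor.map (braiding a n m) ≫ (F.tensorIso m n).hom) = modBraiding ha n m := by
  have h : (F.tensorIso n m).inv ≫ F.functor.map (braiding a n m) ≫ (F.tensorIso m n).hom =
      (powMul ha n m).hom ≫ diagMap ha (cross n m) ≫ (powMul ha m n).inv :=
    conj_eq (F.tensorIso_hom_powMul n m) (F.tensorIso_hom_powMul m n) (F.map_ofDiagram (cross n m))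
  refine (congrArg toLin h).trans (LinearMap.ext fun x => joinLin_injective ha m n ?_)
  refine Eq.trans ?_ (joinLin_modBraiding x).symm
  rw [joinLin_eq, joinLin_eq]
  exact LinearMap.congr_fun (congrArg toLin (powMul ha m n).inv_hom_id) _

theorem map_coev (n : ℕ) : ε F.functor ≫ F.functor.map (TemperleyLieb.coev a n) ≫
    (F.tensorIso n n).hom = UqMod.coev (fundPow ha n) ≫ fundPow ha n ◁ (alphaPow ha n).inv := by
  have h : ε F.functor ≫ F.functor.map (TemperleyLieb.coev a n) ≫ (F.tensorIso n n).hom =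
      𝟙 _ ≫ diagMap ha (cups n) ≫ (powMul ha n n).inv :=
    conj_eq (t := εIso F.functor |>.symm) (p := Iso.refl _) (o := F.objIso 0) (Category.comp_id _)
      (F.tensorIso_hom_powMul n n) (F.map_ofDiagram (cups n))
  have h2 : (diagMap ha (cups n) ≫ (powMul ha n n).inv) ≫ fundPow ha n ◁ (alphaPow ha n).hom =
      UqMod.coev (fundPow ha n) := by
    refine hom_ext (LinearMap.ext_ring ?_)
    refine eq_coevaluation (TensorProduct.map LinearMap.id (pairing ha) (cupsElt ha n)) fun y => ?_
    refine Eq.trans ?_ (contract_cupsElt ha y)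
    generalize cupsElt ha n = z
    induction z using TensorProduct.induction_on with
    | zero => simp
    | tmul u w => rfl
    | add x y hx hy => simp only [map_add, hx, hy]
  exact (h.trans (Category.id_comp _)).trans
    ((Iso.eq_comp_inv (whiskerLeftIso (fundPow ha n) (alphaPow ha n))).2 h2)

theorem map_ev (n : ℕ) : (F.tensorIso n n).inv ≫ F.functor.map (TemperleyLieb.ev a n) ≫
    η F.functor = (alphaPow ha n).hom ▷ fundPow ha n ≫ UqMod.ev (fundPow ha n) := by
  have h : (F.tensorIso n n).inv ≫ F.functor.map (TemperleyLieb.ev a n) ≫ η F.functor =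
      (powMul ha n n).hom ≫ diagMap ha (caps n) ≫ 𝟙 _ :=
    conj_eq (t' := εIso F.functor |>.symm) (p' := Iso.refl _) (o' := F.objIso 0)
      (F.tensorIso_hom_powMul n n) (Category.comp_id _) (F.map_ofDiagram (caps n))
  refine h.trans (hom_ext (TensorProduct.ext' fun u w => ?_))
  exact (diagLin_caps ha u w).trans (mul_one (pairing ha u w))

theorem map_twist (n : ℕ) : toLin ((F.objIso n).inv ≫ F.functor.map (twist a n) ≫
    (F.objIso n).hom) = modTwist ha n := by
  have h : F.functor.map (twist a n) = (-1 : ℂ) ^ n •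
      ((F.objIso n).hom ≫ diagMap ha (curl n) ≫ (F.objIso n).inv) :=
    (F.functor.map_smul _ _).trans (congrArg (fun f => (-1 : ℂ) ^ n • f) (F.map_ofDiagram (curl n)))
  have h2 : (F.objIso n).inv ≫ F.functor.map (twist a n) ≫ (F.objIso n).hom =
      (-1 : ℂ) ^ n • diagMap ha (curl n) := by
    rw [h]
    simp
  refine (congrArg toLin h2).trans (weight_ext fun i u hu => ?_)
  refine (congrArg (fun v => (-1 : ℂ) ^ n • v) hu.diagLin_curl).trans ?_
  rw [smul_smul, ← mul_pow]
  simp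

end TensorFunctor

end QuantumSL2

end

theorem mainTheorem6 (a : ℂ) (ha : Admissible a) :
    Nonempty (TensorFunctor ha) ∧
    (∀ F G : TensorFunctor ha, ∃! i : F.functor ≅ G.functor,
      NatTrans.IsMonoidal i.hom ∧ i.hom.app ⟨1⟩ ≫ G.objOne.hom = F.objOne.hom) ∧
    ∀ F : TensorFunctor ha,
      (∀ n m : ℕ, UqMod.toLin ((F.tensorIso n m).inv ≫
          F.functor.map (TemperleyLieb.braiding a n m) ≫ (F.tensorIso m n).hom) =
        modBraiding ha n m) ∧
      (∀ n : ℕ, Functor.LaxMonoidal.ε F.functor ≫ F.functor.map (TemperleyLieb.coev a n) ≫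
          (F.tensorIso n n).hom =
        UqMod.coev (fundPow ha n) ≫ fundPow ha n ◁ (alphaPow ha n).inv) ∧
      (∀ n : ℕ, (F.tensorIso n n).inv ≫ F.functor.map (TemperleyLieb.ev a n) ≫
          Functor.OplaxMonoidal.η F.functor =
        (alphaPow ha n).hom ▷ fundPow ha n ≫ UqMod.ev (fundPow ha n)) ∧
      (∀ n : ℕ, UqMod.toLin ((F.objIso n).inv ≫
          F.functor.map (TemperleyLieb.twist a n) ≫ (F.objIso n).hom) =
        modTwist ha n) :=
  ⟨⟨stdTensorFunctor ha⟩, TensorFunctor.existsUnique_iso,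
    fun F => ⟨F.map_braiding, F.map_coev, F.map_ev, F.map_twist⟩⟩
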